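/- **Setting.** For $N\in\mathbb N\cup\{\omega\}$, an $N$-globular set $X$ consists of sets $X(k)$ for all finite $k\le N$ and maps $s,t:X(k+1)\to X(k)$ with $ss=st$ and $ts=tt$; an $\omega$-globular set is just called a globular set. Two $k$-cells are *parallel* if $k=0$ or they have the same source and the same target. Let $T_N$ be the free strict $N$-category monad on $N$-globular sets (write $T=T_\omega$), and let $1$ be the terminal $N$-globular set; elements of $(T_N1)(k)$ are the $k$-dimensional pasting diagrams. A *$T_N$-operad* is an $N$-globular set $C$ with a map $d:C\to T_N1$ and maps $\mathrm{ids}:1\to C$ and $\mathrm{comp}:C\circ C\to C$ over $T_N1$, where $C\circ C=T_NC\times_{T_N1}C$, satisfying the unit and associativity laws. We write $C(\pi)=d^{-1}(\pi)$. An operad $C$ induces the monad $X\mapsto T_NX\times_{T_N1}C$ on $N$-globular sets, and $\mathrm{Alg}(C)$ is the category of algebras for this monad. For $\pi\in(T_N1)(k)$ with $1\le k\le N$, let $P_\pi(C)$ be the set of pairs $(\theta_0,\theta_1)\in C(s\pi)\times C(t\pi)$ of parallel cells. A *precontraction* on $C$ is a family of functions $\kappa_\pi:P_\pi(C)\to C(\pi)$,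 for all such $\pi$, with $s\,\kappa_\pi(\theta_0,\theta_1)=\theta_0$ and $t\,\kappa_\pi(\theta_0,\theta_1)=\theta_1$. Let $\mathbf{OWP}_N$ be the category of $T_N$-operads with a precontraction, and operad maps preserving it. For $N=\omega$ a precontraction is called a contraction, and we write $\mathbf{OWC}=\mathbf{OWP}_\omega$. For $n\in\mathbb N$, $\mathbf{OWC}_n$ is the full subcategory of $\mathbf{OWP}_n$ of the operads *with contraction*: those for which, if $n\ge1$, any two $\theta_0,\theta_1\in C(\pi)$ with $\pi\in(T_n1)(n)$, $s\theta_0=s\theta_1$ and $t\theta_0=t\theta_1$ are equal (no condition if $n=0$). Restriction of $N$-globular sets to dimensions $\le k$ induces, through the canonical isomorphism between the restriction of $T_NX$ and $T_k$ of the restriction of $X$, a restriction of operads with (pre)contraction, $R^\omega_k:\mathbf{OWC}\to\mathbf{OWP}_k$. For $n\ge1$ and $D$ in $\mathbf{OWP}_{n-1}$, $S^n_{n-1}D$ in $\mathbf{OWC}_n$ is given by $(S^n_{n-1}D)(\pi)=D(\pi)$ for $\pi$ of dimension $\le n-1$ and $(S^n_{n-1}D)(\pi)=P_\pi(D)$ for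 $\pi$ of dimension $n$ (with the two projections as source and target), with the induced operad structure and the precontraction extending that of $D$, where $\kappa_\pi(\theta_0,\theta_1)=(\theta_0,\theta_1)$ in dimension $n$. A globular set $X$ is *$n$-dimensional* if for all $m\ge n$ the maps $s,t:X(m+1)\to X(m)$ are equal and bijective. **Theorem.** Let $n\in\mathbb N$. The category $\mathbf{OWC}$ has an initial object $L$, and $\mathbf{OWC}_n$ has an initial object $L_n$. Let $\mathbf{Wk}\text{-}n\text{-}\mathbf{Cat}$ be the full subcategory of $\mathrm{Alg}(L)$ on the algebras (weak $\omega$-categories) whose underlying globular set is $n$-dimensional. Then there is an equivalence of categories $$\mathbf{Wk}\text{-}n\text{-}\mathbf{Cat}\;\simeq\;\mathrm{Alg}(L_n).$$ Moreover, if $n\ge1$, then $S^n_{n-1}R^\omega_{n-1}(L)$ is an initial object of $\mathbf{OWC}_n$, so that $L_n\cong S^n_{n-1}R^\omega_{n-1}(L)$. -/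

import Mathlib

open CategoryTheory

universe u

/-- `k + 1 ≤ N` implies `k ≤ N`, for dimensions `N ∈ ℕ ∪ {∞}`. -/
theorem dim_pred {N : ℕ∞} {k : ℕ} (h : ((k + 1 : ℕ) : ℕ∞) ≤ N) : (k : ℕ∞) ≤ N :=
  le_trans (by exact_mod_cast Nat.le_succ k) h

/-- An `N`-globular set, for `N ∈ ℕ ∪ {∞}`: sets of `k`-cells for all `k ≤ N`, with source and
target maps subject to the globularity equations.  `N = ⊤` gives globular sets. -/
structure GlobSet (N : ℕ∞) where
  cell : (k : ℕ) → (k : ℕ∞) ≤ N → Type u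
  src : ∀ {k : ℕ} {h : ((k + 1 : ℕ) : ℕ∞) ≤ N}, cell (k + 1) h → cell k (dim_pred h)
  tgt : ∀ {k : ℕ} {h : ((k + 1 : ℕ) : ℕ∞) ≤ N}, cell (k + 1) h → cell k (dim_pred h)
  src_src : ∀ {k : ℕ} {h : ((k + 2 : ℕ) : ℕ∞) ≤ N} (x : cell (k + 2) h),
    src (src x) = src (tgt x)
  tgt_src : ∀ {k : ℕ} {h : ((k + 2 : ℕ) : ℕ∞) ≤ N} (x : cell (k + 2) h),
    tgt (src x) = tgt (tgt x)

namespace GlobSet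

variable {N M : ℕ∞}

@[ext]
structure Hom (X Y : GlobSet.{u} N) where
  app : ∀ {k : ℕ} {h : (k : ℕ∞) ≤ N}, X.cell k h → Y.cell k h
  src_app : ∀ {k : ℕ} {h : ((k + 1 : ℕ) : ℕ∞) ≤ N} (x : X.cell (k + 1) h),
    Y.src (app x) = app (X.src x)
  tgt_app : ∀ {k : ℕ} {h : ((k + 1 : ℕ) : ℕ∞) ≤ N} (x : X.cell (k + 1) h),
    Y.tgt (app x) = app (X.tgt x)

instance : Category (GlobSet.{u} N) where
  Hom := Hom
  id X := ⟨fun x => x, fun _ => rfl, fun _ => rfl⟩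
  comp f g := ⟨fun x => g.app (f.app x), fun x => by rw [g.src_app, f.src_app],
    fun x => by rw [g.tgt_app, f.tgt_app]⟩

@[ext]
theorem hom_ext {X Y : GlobSet.{u} N} {f g : X ⟶ Y}
    (w : ∀ (k : ℕ) (h : (k : ℕ∞) ≤ N) (x : X.cell k h), f.app x = g.app x) : f = g := by
  apply Hom.ext
  funext k h x
  exact w k h x

@[simp]
theorem id_app {X : GlobSet.{u} N} {k : ℕ} {h : (k : ℕ∞) ≤ N} (x : X.cell k h) :
    Hom.app (𝟙 X) x = x := rfl

@[simp]
theorem comp_app {X Y Z : GlobSet.{u} N} (f : X ⟶ Y) (g : Y ⟶ Z) {k : ℕ} {h : (k : ℕ∞) ≤ N}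
    (x : X.cell k h) : Hom.app (f ≫ g) x = g.app (f.app x) := rfl

/-- `k`-cells `a`, `b` are composable along `p` if `p < k` and the iterated target
`t^{k-p} a` equals the iterated source `s^{k-p} b`. -/
def Composable (X : GlobSet.{u} N) (p : ℕ) :
    ∀ {k : ℕ} {h : (k : ℕ∞) ≤ N}, X.cell k h → X.cell k h → Prop
  | 0, _, _, _ => False
  | k + 1, _, a, b => if p = k then X.tgt a = X.src b else X.Composable p (X.tgt a) (X.src b)

/-- Two `k`-cells are parallel if `k = 0` or they have the same source and the same target. -/
def Parallel (X : GlobSet.{u} N) :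
    ∀ {k : ℕ} {h : (k : ℕ∞) ≤ N}, X.cell k h → X.cell k h → Prop
  | 0, _, _, _ => True
  | _ + 1, _, a, b => X.src a = X.src b ∧ X.tgt a = X.tgt b

/-- Restriction of an `N`-globular set to an `M`-globular set, `M ≤ N`. -/
abbrev res (e : M ≤ N) : GlobSet.{u} N ⥤ GlobSet.{u} M where
  obj X :=
    { cell := fun k h => X.cell k (h.trans e)
      src := X.src
      tgt := X.tgt
      src_src := X.src_src
      tgt_src := X.tgt_src }
  map f := ⟨f.app, f.src_app, f.tgt_app⟩

theorem composable_lt {X : GlobSet.{u} N} {p k : ℕ} {h : (k : ℕ∞) ≤ N} {a b : X.cell k h}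
    (w : X.Composable p a b) : p < k := by
  induction k with
  | zero => exact absurd w (by simp [Composable])
  | succ k ih =>
    unfold Composable at w
    split_ifs at w with e
    · omega
    · have := ih w; omega

theorem composable_top {X : GlobSet.{u} N} {k : ℕ} {h : ((k + 1 : ℕ) : ℕ∞) ≤ N}
    {a b : X.cell (k + 1) h} : X.Composable k a b ↔ X.tgt a = X.src b := by
  simp [Composable]

theorem composable_low {X : GlobSet.{u} N} {p k : ℕ} {h : ((k + 1 : ℕ) : ℕ∞) ≤ N}
    (hp : p ≠ k) {a b : X.cell (k + 1) h} :
    X.Composable p a b ↔ X.Composable p (X.tgt a) (X.src b) := by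
  simp [Composable, hp]

theorem composable_congr {X : GlobSet.{u} N} {p k : ℕ} {h : ((k + 1 : ℕ) : ℕ∞) ≤ N}
    {a b a' b' : X.cell (k + 1) h} (ha : X.tgt a = X.tgt a') (hb : X.src b = X.src b') :
    X.Composable p a b ↔ X.Composable p a' b' := by
  simp only [Composable, ha, hb]

theorem composable_map {X Y : GlobSet.{u} N} (f : X ⟶ Y) {p k : ℕ} {h : (k : ℕ∞) ≤ N}
    {a b : X.cell k h} (w : X.Composable p a b) : Y.Composable p (f.app a) (f.app b) := by
  induction k with
  | zero => exact w
  | succ k ih =>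
    by_cases hp : p = k
    · subst hp
      rw [composable_top] at w ⊢
      rw [f.tgt_app, f.src_app, w]
    · rw [composable_low hp] at w ⊢
      rw [f.tgt_app, f.src_app]
      exact ih w

/-- The iterated identity `i^{k-p} s^{k-p} a` on the `p`-dimensional source of a `k`-cell `a`
(`p < k`), for a given operation `one` of identities. -/
def srcUnit (X : GlobSet.{u} N)
    (one : ∀ {k : ℕ} {h : ((k + 1 : ℕ) : ℕ∞) ≤ N}, X.cell k (dim_pred h) → X.cell (k + 1) h)
    (p : ℕ) : ∀ {k : ℕ} {h : (k : ℕ∞) ≤ N}, X.cell k h → X.cell k h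
  | 0, _, a => a
  | k + 1, _, a => one (if p = k then X.src a else X.srcUnit one p (X.src a))

/-- The iterated identity `i^{k-p} t^{k-p} a` on the `p`-dimensional target of a `k`-cell `a`
(`p < k`), for a given operation `one` of identities. -/
def tgtUnit (X : GlobSet.{u} N)
    (one : ∀ {k : ℕ} {h : ((k + 1 : ℕ) : ℕ∞) ≤ N}, X.cell k (dim_pred h) → X.cell (k + 1) h)
    (p : ℕ) : ∀ {k : ℕ} {h : (k : ℕ∞) ≤ N}, X.cell k h → X.cell k h
  | 0, _, a => a
  | k + 1, _, a => one (if p = k then X.tgt a else X.tgtUnit one p (X.tgt a))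

end GlobSet

/-- A strict `N`-category: an `N`-globular set with identities `k`-cell ↦ `(k+1)`-cell and
compositions of `k`-cells along `p`-cells (`p < k`), written in diagrammatic order.
Hypotheses `w₁, w₂, …` of an axiom only say that the composites in it exist. -/
structure StrictCat (N : ℕ∞) extends GlobSet.{u} N where
  one : ∀ {k : ℕ} {h : ((k + 1 : ℕ) : ℕ∞) ≤ N}, cell k (dim_pred h) → cell (k + 1) h
  comp : ∀ (p : ℕ) {k : ℕ} {h : (k : ℕ∞) ≤ N} (a b : cell k h),
    toGlobSet.Composable p a b → cell k h
  src_one : ∀ {k : ℕ} {h : ((k + 1 : ℕ) : ℕ∞) ≤ N} (a : cell k (dim_pred h)),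
    src (one (h := h) a) = a
  tgt_one : ∀ {k : ℕ} {h : ((k + 1 : ℕ) : ℕ∞) ≤ N} (a : cell k (dim_pred h)),
    tgt (one (h := h) a) = a
  src_comp_top : ∀ {k : ℕ} {h : ((k + 1 : ℕ) : ℕ∞) ≤ N} (a b : cell (k + 1) h) (w),
    src (comp k a b w) = src a
  tgt_comp_top : ∀ {k : ℕ} {h : ((k + 1 : ℕ) : ℕ∞) ≤ N} (a b : cell (k + 1) h) (w),
    tgt (comp k a b w) = tgt b
  src_comp_low : ∀ {p k : ℕ} {h : ((k + 1 : ℕ) : ℕ∞) ≤ N} (a b : cell (k + 1) h) (w₁ w₂),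
    src (comp p a b w₁) = comp p (src a) (src b) w₂
  tgt_comp_low : ∀ {p k : ℕ} {h : ((k + 1 : ℕ) : ℕ∞) ≤ N} (a b : cell (k + 1) h) (w₁ w₂),
    tgt (comp p a b w₁) = comp p (tgt a) (tgt b) w₂
  assoc : ∀ {p k : ℕ} {h : (k : ℕ∞) ≤ N} (a b c : cell k h) (w₁ w₂ w₃ w₄),
    comp p (comp p a b w₁) c w₂ = comp p a (comp p b c w₃) w₄
  interchange : ∀ {q p k : ℕ} {h : (k : ℕ∞) ≤ N} (a b c d : cell k h) (w₁ w₂ w₃ w₄ w₅ w₆),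
    q < p → comp q (comp p a b w₁) (comp p c d w₂) w₃ = comp p (comp q a c w₄) (comp q b d w₅) w₆
  one_comp_one : ∀ {p k : ℕ} {h : ((k + 1 : ℕ) : ℕ∞) ≤ N} (a b : cell k (dim_pred h)) (w₁ w₂),
    one (h := h) (comp p a b w₁) = comp p (one a) (one b) w₂
  unit_comp : ∀ {p k : ℕ} {h : (k : ℕ∞) ≤ N} (a : cell k h) (w),
    comp p (toGlobSet.srcUnit one p a) a w = a
  comp_unit : ∀ {p k : ℕ} {h : (k : ℕ∞) ≤ N} (a : cell k h) (w),
    comp p a (toGlobSet.tgtUnit one p a) w = a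

namespace StrictCat

variable {N M : ℕ∞}

/-- Strict functors. -/
@[ext]
structure Hom (C D : StrictCat.{u} N) where
  map : C.toGlobSet ⟶ D.toGlobSet
  map_one : ∀ {k : ℕ} {h : ((k + 1 : ℕ) : ℕ∞) ≤ N} (a : C.cell k (dim_pred h)),
    map.app (C.one (h := h) a) = D.one (map.app a)
  map_comp : ∀ {p k : ℕ} {h : (k : ℕ∞) ≤ N} (a b : C.cell k h) (w w'),
    map.app (C.comp p a b w) = D.comp p (map.app a) (map.app b) w'

instance : Category (StrictCat.{u} N) where
  Hom := Hom
  id C := ⟨𝟙 _, fun _ => rfl, fun _ _ _ _ => rfl⟩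
  comp {C D E} f g := ⟨f.map ≫ g.map,
    fun a => by rw [GlobSet.comp_app, f.map_one, g.map_one]; rfl,
    fun a b w w' => by
      rw [GlobSet.comp_app, f.map_comp a b w (GlobSet.composable_map f.map w), g.map_comp]; rfl⟩

/-- The forgetful functor from strict `N`-categories to `N`-globular sets. -/
abbrev forget (N : ℕ∞) : StrictCat.{u} N ⥤ GlobSet.{u} N where
  obj C := C.toGlobSet
  map f := f.map

theorem composable_trunc (e : M ≤ N) {X : GlobSet.{u} N} {p k : ℕ} {h : (k : ℕ∞) ≤ M}
    {a b : X.cell k (h.trans e)} :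
    ((GlobSet.res e).obj X).Composable p (h := h) a b ↔ X.Composable p a b := by
  induction k with
  | zero => exact Iff.rfl
  | succ k ih =>
    by_cases hp : p = k
    · subst hp
      rw [GlobSet.composable_top, GlobSet.composable_top]
    · rw [GlobSet.composable_low hp, GlobSet.composable_low hp]
      exact ih

/-- The truncation of a strict `N`-category to a strict `M`-category, `M ≤ N`. -/
abbrev trunc (e : M ≤ N) (C : StrictCat.{u} N) : StrictCat.{u} M where
  toGlobSet := (GlobSet.res e).obj C.toGlobSet
  one := C.one
  comp p _ h a b w := C.comp p (h := h.trans e) a b ((composable_trunc e).1 w)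
  src_one := C.src_one
  tgt_one := C.tgt_one
  src_comp_top a b w := C.src_comp_top a b _
  tgt_comp_top a b w := C.tgt_comp_top a b _
  src_comp_low a b _ w := C.src_comp_low a b _ ((composable_trunc e).1 w)
  tgt_comp_low a b _ w := C.tgt_comp_low a b _ ((composable_trunc e).1 w)
  assoc a b c w₁ w₂ w₃ w₄ := C.assoc a b c _ _ ((composable_trunc e).1 w₃)
    ((composable_trunc e).1 w₄)
  interchange a b c d w₁ w₂ w₃ w₄ w₅ w₆ hq := C.interchange a b c d _ _ _
    ((composable_trunc e).1 w₄) ((composable_trunc e).1 w₅) ((composable_trunc e).1 w₆) hq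
  one_comp_one a b w₁ w₂ := C.one_comp_one a b _ ((composable_trunc e).1 w₂)
  unit_comp {p k h} a w := by
    have key : ∀ {k : ℕ} {h : (k : ℕ∞) ≤ M} (a : C.cell k (h.trans e)),
        ((GlobSet.res e).obj C.toGlobSet).srcUnit C.one p (h := h) a
          = C.srcUnit C.one p (h := h.trans e) a := by
      intro k
      induction k with
      | zero => intro h a; rfl
      | succ k ih =>
        intro h a
        simp only [GlobSet.srcUnit]
        congr 1
        split_ifs
        · rfl
        · exact ih _
    have w' : C.Composable p (C.srcUnit C.one p (h := h.trans e) a) a := by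
      rw [← key (h := h)]
      exact (composable_trunc e).1 w
    exact Eq.trans (by congr 1; exact key a) (C.unit_comp a w')
  comp_unit {p k h} a w := by
    have key : ∀ {k : ℕ} {h : (k : ℕ∞) ≤ M} (a : C.cell k (h.trans e)),
        ((GlobSet.res e).obj C.toGlobSet).tgtUnit C.one p (h := h) a
          = C.tgtUnit C.one p (h := h.trans e) a := by
      intro k
      induction k with
      | zero => intro h a; rfl
      | succ k ih =>
        intro h a
        simp only [GlobSet.tgtUnit]
        congr 1
        split_ifs
        · rfl
        · exact ih _
    have w' : C.Composable p a (C.tgtUnit C.one p (h := h.trans e) a) := by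
      rw [← key (h := h)]
      exact (composable_trunc e).1 w
    exact Eq.trans (by congr 1; exact key a) (C.comp_unit a w')

end StrictCat

/-- Formal composites in an `N`-globular set (not necessarily well-formed). -/
inductive Tm {N : ℕ∞} (X : GlobSet.{u} N) : ℕ → Type u
  | of {k : ℕ} (h : (k : ℕ∞) ≤ N) (x : X.cell k h) : Tm X k
  | one {k : ℕ} (a : Tm X k) : Tm X (k + 1)
  | comp {k : ℕ} (p : ℕ) (a b : Tm X k) : Tm X k

namespace Tm

variable {N : ℕ∞} {X : GlobSet.{u} N}

def src : ∀ {k : ℕ}, Tm X (k + 1) → Tm X k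
  | _, of _ x => of _ (X.src x)
  | _, one a => a
  | k, comp p a b => if p = k then a.src else comp p a.src b.src

def tgt : ∀ {k : ℕ}, Tm X (k + 1) → Tm X k
  | _, of _ x => of _ (X.tgt x)
  | _, one a => a
  | k, comp p a b => if p = k then b.tgt else comp p a.tgt b.tgt

@[simp] theorem src_top {k : ℕ} (a b : Tm X (k + 1)) : (comp k a b).src = a.src := by simp [src]
@[simp] theorem tgt_top {k : ℕ} (a b : Tm X (k + 1)) : (comp k a b).tgt = b.tgt := by simp [tgt]
theorem src_low {p k : ℕ} (hp : p ≠ k) (a b : Tm X (k + 1)) :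
    (comp p a b).src = comp p a.src b.src := by simp [src, hp]
theorem tgt_low {p k : ℕ} (hp : p ≠ k) (a b : Tm X (k + 1)) :
    (comp p a b).tgt = comp p a.tgt b.tgt := by simp [tgt, hp]
@[simp] theorem src_of {k : ℕ} (h : ((k + 1 : ℕ) : ℕ∞) ≤ N) (x : X.cell (k + 1) h) :
    (of h x).src = of _ (X.src x) := by simp [src]
@[simp] theorem tgt_of {k : ℕ} (h : ((k + 1 : ℕ) : ℕ∞) ≤ N) (x : X.cell (k + 1) h) :
    (of h x).tgt = of _ (X.tgt x) := by simp [tgt]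
@[simp] theorem src_one {k : ℕ} (a : Tm X k) : (one a).src = a := by simp [src]
@[simp] theorem tgt_one {k : ℕ} (a : Tm X k) : (one a).tgt = a := by simp [tgt]

def srcUnit (p : ℕ) : ∀ {k : ℕ}, Tm X k → Tm X k
  | 0, a => a
  | k + 1, a => one (if p = k then a.src else srcUnit p a.src)

def tgtUnit (p : ℕ) : ∀ {k : ℕ}, Tm X k → Tm X k
  | 0, a => a
  | k + 1, a => one (if p = k then a.tgt else tgtUnit p a.tgt)

/-- `Ev f t v`: the formal composite `t` has the value `v` in the strict category `D`. -/
def Ev {M : ℕ∞} {e : M ≤ N} {D : StrictCat.{u} M} (f : (GlobSet.res e).obj X ⟶ D.toGlobSet) :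
    ∀ {k : ℕ} {h : (k : ℕ∞) ≤ M}, Tm X k → D.cell k h → Prop
  | _, _, of _ x, v => v = f.app x
  | _, h, one a, v => ∃ u : D.cell _ (dim_pred h), Ev f a u ∧ v = D.one u
  | _, h, comp p a b, v => ∃ (u u' : D.cell _ h) (w : D.Composable p u u'),
      Ev f a u ∧ Ev f b u' ∧ v = D.comp p u u' w

section Ev

variable {M : ℕ∞} {e : M ≤ N} {D : StrictCat.{u} M} {f : (GlobSet.res e).obj X ⟶ D.toGlobSet}

theorem Ev.unique {k : ℕ} {h : (k : ℕ∞) ≤ M} {t : Tm X k} {v v' : D.cell k h}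
    (h₁ : Ev f t v) (h₂ : Ev f t v') : v = v' := by
  induction t with
  | of _ x => simp only [Ev] at h₁ h₂; rw [h₁, h₂]
  | one a ih =>
    obtain ⟨u, hu, rfl⟩ := h₁
    obtain ⟨u', hu', rfl⟩ := h₂
    rw [ih hu hu']
  | comp p a b iha ihb =>
    obtain ⟨u₁, u₂, w, hu₁, hu₂, rfl⟩ := h₁
    obtain ⟨u₁', u₂', w', hu₁', hu₂', rfl⟩ := h₂
    obtain rfl := iha hu₁ hu₁'
    obtain rfl := ihb hu₂ hu₂'
    rfl

theorem composable_bdry {D : GlobSet.{u} M} {p k : ℕ} (hp : p ≠ k) {h : ((k + 1 : ℕ) : ℕ∞) ≤ M}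
    {u v : D.cell (k + 1) h} (w : D.Composable p u v) :
    D.Composable p (D.src u) (D.src v) ∧ D.Composable p (D.tgt u) (D.tgt v) := by
  rw [GlobSet.composable_low hp] at w
  cases k with
  | zero => exact absurd w (by simp [GlobSet.Composable])
  | succ k =>
    constructor
    · rwa [GlobSet.composable_congr (D.tgt_src u) rfl]
    · rwa [GlobSet.composable_congr rfl (D.src_src v).symm]

theorem Ev.bdry' : ∀ {k : ℕ} {h : ((k + 1 : ℕ) : ℕ∞) ≤ M} (t : Tm X (k + 1))
    (v : D.cell (k + 1) h), Ev f t v → Ev f t.src (D.src v) ∧ Ev f t.tgt (D.tgt v)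
  | k, h, of _ x, v, hv => by
    simp only [Ev] at hv
    subst hv
    rw [src_of, tgt_of]
    exact ⟨f.src_app _, f.tgt_app _⟩
  | k, h, one a, v, hv => by
    obtain ⟨u, hu, rfl⟩ := hv
    rw [D.src_one, D.tgt_one, src_one, tgt_one]
    exact ⟨hu, hu⟩
  | k, h, comp p a b, v, hv => by
    obtain ⟨u₁, u₂, w, hu₁, hu₂, rfl⟩ := hv
    have ha := Ev.bdry' a _ hu₁
    have hb := Ev.bdry' b _ hu₂
    by_cases hp : p = k
    · subst hp
      rw [D.src_comp_top, D.tgt_comp_top, src_top, tgt_top]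
      exact ⟨ha.1, hb.2⟩
    · have w' := composable_bdry hp w
      rw [D.src_comp_low _ _ _ w'.1, D.tgt_comp_low _ _ _ w'.2, src_low hp, tgt_low hp]
      exact ⟨⟨_, _, _, ha.1, hb.1, rfl⟩, ⟨_, _, _, ha.2, hb.2, rfl⟩⟩

theorem Ev.bdry {k : ℕ} {h : ((k + 1 : ℕ) : ℕ∞) ≤ M} {t : Tm X (k + 1)} {v : D.cell (k + 1) h}
    (hv : Ev f t v) : Ev f t.src (D.src v) ∧ Ev f t.tgt (D.tgt v) := Ev.bdry' t v hv

theorem Ev.srcUnit {p k : ℕ} {h : (k : ℕ∞) ≤ M} {t : Tm X k} {v : D.cell k h}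
    (hv : Ev f t v) : Ev f (t.srcUnit p) (D.srcUnit D.one p v) := by
  induction k with
  | zero => exact hv
  | succ k ih =>
    simp only [Tm.srcUnit, GlobSet.srcUnit]
    refine ⟨_, ?_, rfl⟩
    split_ifs
    · exact hv.bdry.1
    · exact ih hv.bdry.1

theorem Ev.tgtUnit {p k : ℕ} {h : (k : ℕ∞) ≤ M} {t : Tm X k} {v : D.cell k h}
    (hv : Ev f t v) : Ev f (t.tgtUnit p) (D.tgtUnit D.one p v) := by
  induction k with
  | zero => exact hv
  | succ k ih =>
    simp only [Tm.tgtUnit, GlobSet.tgtUnit]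
    refine ⟨_, ?_, rfl⟩
    split_ifs
    · exact hv.bdry.2
    · exact ih hv.bdry.2

end Ev

/-- Both formal composites have a value, and the same one, in every strict `M`-category under
the `M`-dimensional part of `X`. -/
def Sem {k : ℕ} (a b : Tm X k) : Prop :=
  ∀ (M : ℕ∞) (e : M ≤ N) (h : (k : ℕ∞) ≤ M) (D : StrictCat.{u} M)
    (f : (GlobSet.res e).obj X ⟶ D.toGlobSet), ∃ v : D.cell k h, Ev f a v ∧ Ev f b v

/-- Equality of formal composites (`Eqv a a` means that `a` is well-formed), and parallelism,
by recursion on the dimension. -/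
def EqvPar : (k : ℕ) → (Tm X k → Tm X k → Prop) × (Tm X k → Tm X k → Prop)
  | 0 => (Sem, fun _ _ => True)
  | k + 1 =>
    (fun a b => Sem a b ∧ (EqvPar k).1 a.src b.src ∧ (EqvPar k).1 a.tgt b.tgt ∧
      (EqvPar k).2 a.src a.tgt,
     fun a b => (EqvPar k).1 a.src b.src ∧ (EqvPar k).1 a.tgt b.tgt)

def Eqv {k : ℕ} (a b : Tm X k) : Prop := (EqvPar k).1 a b
def Par {k : ℕ} (a b : Tm X k) : Prop := (EqvPar k).2 a b

theorem eqv_succ {k : ℕ} {a b : Tm X (k + 1)} : Eqv a b ↔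
    Sem a b ∧ Eqv a.src b.src ∧ Eqv a.tgt b.tgt ∧ Par a.src a.tgt := Iff.rfl
theorem par_succ {k : ℕ} {a b : Tm X (k + 1)} : Par a b ↔
    Eqv a.src b.src ∧ Eqv a.tgt b.tgt := Iff.rfl

theorem Sem.symm {k : ℕ} {a b : Tm X k} (w : Sem a b) : Sem b a := fun M e h D f => by
  obtain ⟨v, h₁, h₂⟩ := w M e h D f
  exact ⟨v, h₂, h₁⟩

theorem Sem.trans {k : ℕ} {a b c : Tm X k} (w : Sem a b) (w' : Sem b c) : Sem a c :=
  fun M e h D f => by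
    obtain ⟨v, h₁, h₂⟩ := w M e h D f
    obtain ⟨v', h₁', h₂'⟩ := w' M e h D f
    obtain rfl := h₂.unique h₁'
    exact ⟨v, h₁, h₂'⟩

theorem Eqv.sem {k : ℕ} {a b : Tm X k} (w : Eqv a b) : Sem a b := by
  cases k with
  | zero => exact w
  | succ k => exact w.1

theorem Eqv.trans {k : ℕ} {a b c : Tm X k} (w : Eqv a b) (w' : Eqv b c) : Eqv a c := by
  induction k with
  | zero => exact Sem.trans w w'
  | succ k ih => exact ⟨w.1.trans w'.1, ih w.2.1 w'.2.1, ih w.2.2.1 w'.2.2.1, w.2.2.2⟩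

theorem Eqv.src {k : ℕ} {a b : Tm X (k + 1)} (w : Eqv a b) : Eqv a.src b.src := w.2.1
theorem Eqv.tgt {k : ℕ} {a b : Tm X (k + 1)} (w : Eqv a b) : Eqv a.tgt b.tgt := w.2.2.1
theorem Eqv.par {k : ℕ} {a b : Tm X (k + 1)} (w : Eqv a b) : Par a.src a.tgt := w.2.2.2

theorem Par.src {k : ℕ} {a b : Tm X (k + 1)} (w : Par a b) : Eqv a.src b.src := w.1
theorem Par.tgt {k : ℕ} {a b : Tm X (k + 1)} (w : Par a b) : Eqv a.tgt b.tgt := w.2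

theorem Eqv.symm {k : ℕ} {a b : Tm X k} (w : Eqv a b) : Eqv b a := by
  induction k with
  | zero => exact Sem.symm w
  | succ k ih =>
    refine ⟨w.1.symm, ih w.src, ih w.tgt, ?_⟩
    cases k with
    | zero => trivial
    | succ k =>
      exact ⟨((ih w.src).src.trans w.par.src).trans w.tgt.src,
        ((ih w.src).tgt.trans w.par.tgt).trans w.tgt.tgt⟩

theorem Eqv.left {k : ℕ} {a b : Tm X k} (w : Eqv a b) : Eqv a a := w.trans w.symm
theorem Eqv.right {k : ℕ} {a b : Tm X k} (w : Eqv a b) : Eqv b b := w.symm.trans w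

/-- Formal composability along `p`. -/
def Cmpb (p : ℕ) : ∀ {k : ℕ}, Tm X k → Tm X k → Prop
  | 0, _, _ => False
  | k + 1, a, b => if p = k then Eqv a.tgt b.src else Cmpb p a.tgt b.src

theorem cmpb_top {k : ℕ} {a b : Tm X (k + 1)} : Cmpb k a b ↔ Eqv a.tgt b.src := by
  simp [Cmpb]
theorem cmpb_low {p k : ℕ} (hp : p ≠ k) {a b : Tm X (k + 1)} :
    Cmpb p a b ↔ Cmpb p a.tgt b.src := by
  simp [Cmpb, hp]

theorem cmpb_congr {p k : ℕ} {a b a' b' : Tm X (k + 1)} (ha : Eqv a.tgt a'.tgt)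
    (hb : Eqv b.src b'.src) (w : Cmpb p a b) : Cmpb p a' b' := by
  induction k with
  | zero =>
    by_cases hp : p = 0
    · subst hp
      rw [cmpb_top] at w ⊢
      exact (ha.symm.trans w).trans hb
    · rw [cmpb_low hp] at w
      exact absurd w (by simp [Cmpb])
  | succ k ih =>
    by_cases hp : p = k + 1
    · subst hp
      rw [cmpb_top] at w ⊢
      exact (ha.symm.trans w).trans hb
    · rw [cmpb_low hp] at w ⊢
      exact ih ha.tgt hb.src w

theorem cmpb_bdry {p k : ℕ} (hp : p ≠ k) {a b : Tm X (k + 1)} (ha : Eqv a a) (hb : Eqv b b)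
    (w : Cmpb p a b) : Cmpb p a.src b.src ∧ Cmpb p a.tgt b.tgt := by
  rw [cmpb_low hp] at w
  cases k with
  | zero => exact absurd w (by simp [Cmpb])
  | succ k =>
    exact ⟨cmpb_congr ha.par.tgt.symm hb.src.src w, cmpb_congr ha.tgt.tgt hb.par.src w⟩

theorem Cmpb.eval {M : ℕ∞} {e : M ≤ N} {D : StrictCat.{u} M}
    {f : (GlobSet.res e).obj X ⟶ D.toGlobSet} {p k : ℕ} {h : (k : ℕ∞) ≤ M} {a b : Tm X k}
    {u v : D.cell k h} (w : Cmpb p a b) (hu : Ev f a u) (hv : Ev f b v) : D.Composable p u v := by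
  induction k with
  | zero => exact absurd w (by simp [Cmpb])
  | succ k ih =>
    by_cases hp : p = k
    · subst hp
      rw [cmpb_top] at w
      rw [GlobSet.composable_top]
      obtain ⟨x, h₁, h₂⟩ := w.sem M e _ D f
      rw [hu.bdry.2.unique h₁, hv.bdry.1.unique h₂]
    · rw [cmpb_low hp] at w
      rw [GlobSet.composable_low hp]
      exact ih w hu.bdry.2 hv.bdry.1

theorem eqv_intro {k : ℕ} {a b : Tm X (k + 1)} (ha : Eqv a a) (h : Sem a b)
    (hs : Eqv a.src b.src) (ht : Eqv a.tgt b.tgt) : Eqv a b := ⟨h, hs, ht, ha.par⟩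

theorem eqv_of {k : ℕ} (h : (k : ℕ∞) ≤ N) (x : X.cell k h) : Eqv (of h x) (of h x) := by
  have hs : ∀ {k : ℕ} (h : (k : ℕ∞) ≤ N) (x : X.cell k h), Sem (of h x) (of h x) :=
    fun h x M e h' D f => ⟨f.app x, rfl, rfl⟩
  induction k with
  | zero => exact hs h x
  | succ k ih =>
    rw [eqv_succ, src_of, tgt_of]
    refine ⟨hs h x, ih _ _, ih _ _, ?_⟩
    cases k with
    | zero => trivial
    | succ k =>
      rw [par_succ, src_of, src_of, tgt_of, tgt_of, ← X.src_src, ← X.tgt_src, ← src_of, ← tgt_of]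
      exact ⟨(ih _ (X.src x)).src, (ih _ (X.src x)).tgt⟩

theorem eqv_one {k : ℕ} {a b : Tm X k} (w : Eqv a b) : Eqv (one a) (one b) := by
  rw [eqv_succ, src_one, tgt_one, src_one, tgt_one]
  refine ⟨fun M e h D f => ?_, w, w, ?_⟩
  · obtain ⟨v, h₁, h₂⟩ := w.sem M e (dim_pred h) D f
    exact ⟨D.one v, ⟨v, h₁, rfl⟩, ⟨v, h₂, rfl⟩⟩
  · cases k with
    | zero => trivial
    | succ k => exact ⟨w.left.src, w.left.tgt⟩

theorem eqv_comp {p k : ℕ} {a b a' b' : Tm X k} (w : Cmpb p a b) (ha : Eqv a a')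
    (hb : Eqv b b') : Eqv (comp p a b) (comp p a' b') := by
  have hs : Sem (comp p a b) (comp p a' b') := fun M e h D f => by
    obtain ⟨u, h₁, h₂⟩ := ha.sem M e h D f
    obtain ⟨v, h₃, h₄⟩ := hb.sem M e h D f
    exact ⟨D.comp p u v (w.eval h₁ h₃), ⟨_, _, _, h₁, h₃, rfl⟩, ⟨_, _, _, h₂, h₄, rfl⟩⟩
  induction k using Nat.strong_induction_on with
  | _ k ih =>
    cases k with
    | zero => exact hs
    | succ k =>
      have sub : ∀ {j : ℕ}, j < k + 1 → ∀ {a b a' b' : Tm X j}, Cmpb p a b → Eqv a a' →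
          Eqv b b' → Eqv (comp p a b) (comp p a' b') := fun {j} hj {a b a' b'} w ha hb =>
        ih j hj w ha hb fun M e h D f => by
          obtain ⟨u, h₁, h₂⟩ := ha.sem M e h D f
          obtain ⟨v, h₃, h₄⟩ := hb.sem M e h D f
          exact ⟨D.comp p u v (w.eval h₁ h₃), ⟨_, _, _, h₁, h₃, rfl⟩, ⟨_, _, _, h₂, h₄, rfl⟩⟩
      by_cases hp : p = k
      · subst hp
        rw [eqv_succ, src_top, tgt_top, src_top, tgt_top]
        refine ⟨hs, ha.src, hb.tgt, ?_⟩
        rw [cmpb_top] at w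
        cases p with
        | zero => trivial
        | succ j => exact ⟨(ha.par.src.trans w.src).trans hb.par.src,
            (ha.par.tgt.trans w.tgt).trans hb.par.tgt⟩
      · have w' := cmpb_bdry hp ha.left hb.left w
        rw [eqv_succ, src_low hp, tgt_low hp, src_low hp, tgt_low hp]
        refine ⟨hs, sub (by omega) w'.1 ha.src hb.src, sub (by omega) w'.2 ha.tgt hb.tgt, ?_⟩
        cases k with
        | zero => trivial
        | succ j =>
          rw [par_succ]
          by_cases hp' : p = j
          · subst hp'
            simp only [src_top, tgt_top]
            exact ⟨ha.par.src, hb.par.tgt⟩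
          · have w'' := cmpb_bdry hp' ha.left.src hb.left.src w'.1
            simp only [src_low hp', tgt_low hp']
            exact ⟨sub (by omega) w''.1 ha.par.src hb.par.src,
              sub (by omega) w''.2 ha.par.tgt hb.par.tgt⟩

theorem cmpb_comp_left {p k : ℕ} {a b c : Tm X k} : Cmpb p (comp p a b) c ↔ Cmpb p b c := by
  induction k with
  | zero => simp [Cmpb]
  | succ k ih =>
    by_cases hp : p = k
    · subst hp
      rw [cmpb_top, cmpb_top, tgt_top]
    · rw [cmpb_low hp, cmpb_low hp, tgt_low hp, ih]

theorem eqv_assoc {p k : ℕ} {a b c : Tm X k} (ha : Eqv a a) (hb : Eqv b b) (hc : Eqv c c)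
    (w₁ : Cmpb p a b) (w₂ : Cmpb p (comp p a b) c) (w₃ : Cmpb p b c)
    (w₄ : Cmpb p a (comp p b c)) :
    Eqv (comp p (comp p a b) c) (comp p a (comp p b c)) := by
  induction k with
  | zero => exact absurd w₁ (by simp [Cmpb])
  | succ k ih =>
    have hab := eqv_comp w₁ ha hb
    have hbc := eqv_comp w₃ hb hc
    have hs : Sem (comp p (comp p a b) c) (comp p a (comp p b c)) := fun M e h D f => by
      obtain ⟨u, hu, -⟩ := ha.sem M e h D f
      obtain ⟨v, hv, -⟩ := hb.sem M e h D f
      obtain ⟨x, hx, -⟩ := hc.sem M e h D f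
      have e₁ : Ev f (comp p a b) _ := ⟨u, v, w₁.eval hu hv, hu, hv, rfl⟩
      have e₂ : Ev f (comp p b c) _ := ⟨v, x, w₃.eval hv hx, hv, hx, rfl⟩
      exact ⟨_, ⟨_, _, w₂.eval e₁ hx, e₁, hx, rfl⟩, ⟨_, _, w₄.eval hu e₂, hu, e₂,
        D.assoc _ _ _ _ _ _ _⟩⟩
    apply eqv_intro (eqv_comp w₂ hab hc) hs
    · by_cases hp : p = k
      · subst hp
        simpa only [src_top] using ha.src
      · have r₁ := cmpb_bdry hp ha hb w₁
        have r₂ := cmpb_bdry hp hab hc w₂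
        have r₃ := cmpb_bdry hp hb hc w₃
        have r₄ := cmpb_bdry hp ha hbc w₄
        simp only [src_low hp] at r₁ r₂ r₃ r₄ ⊢
        exact ih ha.src hb.src hc.src r₁.1 r₂.1 r₃.1 r₄.1
    · by_cases hp : p = k
      · subst hp
        simpa only [tgt_top] using hc.tgt
      · have r₁ := cmpb_bdry hp ha hb w₁
        have r₂ := cmpb_bdry hp hab hc w₂
        have r₃ := cmpb_bdry hp hb hc w₃
        have r₄ := cmpb_bdry hp ha hbc w₄
        simp only [tgt_low hp] at r₁ r₂ r₃ r₄ ⊢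
        exact ih ha.tgt hb.tgt hc.tgt r₁.2 r₂.2 r₃.2 r₄.2

theorem cmpb_lt {p k : ℕ} {a b : Tm X k} (w : Cmpb p a b) : p < k := by
  induction k with
  | zero => exact absurd w (by simp [Cmpb])
  | succ k ih =>
    by_cases hp : p = k
    · omega
    · rw [cmpb_low hp] at w
      have := ih w
      omega

theorem eqv_interchange {q p k : ℕ} {a b c d : Tm X k} (ha : Eqv a a) (hb : Eqv b b)
    (hc : Eqv c c) (hd : Eqv d d) (w₁ : Cmpb p a b) (w₂ : Cmpb p c d)
    (w₃ : Cmpb q (comp p a b) (comp p c d)) (w₄ : Cmpb q a c) (w₅ : Cmpb q b d)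
    (w₆ : Cmpb p (comp q a c) (comp q b d)) (hq : q < p) :
    Eqv (comp q (comp p a b) (comp p c d)) (comp p (comp q a c) (comp q b d)) := by
  induction k with
  | zero => exact absurd w₁ (by simp [Cmpb])
  | succ k ih =>
    have hab := eqv_comp w₁ ha hb
    have hcd := eqv_comp w₂ hc hd
    have hac := eqv_comp w₄ ha hc
    have hbd := eqv_comp w₅ hb hd
    have hqk : q ≠ k := by have := cmpb_lt w₁; omega
    have hs : Sem (comp q (comp p a b) (comp p c d)) (comp p (comp q a c) (comp q b d)) :=
      fun M e h D f => by
        obtain ⟨u, hu, -⟩ := ha.sem M e h D f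
        obtain ⟨v, hv, -⟩ := hb.sem M e h D f
        obtain ⟨x, hx, -⟩ := hc.sem M e h D f
        obtain ⟨y, hy, -⟩ := hd.sem M e h D f
        have e₁ : Ev f (comp p a b) _ := ⟨u, v, w₁.eval hu hv, hu, hv, rfl⟩
        have e₂ : Ev f (comp p c d) _ := ⟨x, y, w₂.eval hx hy, hx, hy, rfl⟩
        have e₃ : Ev f (comp q a c) _ := ⟨u, x, w₄.eval hu hx, hu, hx, rfl⟩
        have e₄ : Ev f (comp q b d) _ := ⟨v, y, w₅.eval hv hy, hv, hy, rfl⟩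
        exact ⟨_, ⟨_, _, w₃.eval e₁ e₂, e₁, e₂, rfl⟩, ⟨_, _, w₆.eval e₃ e₄, e₃, e₄,
          D.interchange _ _ _ _ _ _ _ _ _ _ hq⟩⟩
    have hL := eqv_comp w₃ hab hcd
    by_cases hp : p = k
    · subst hp
      apply eqv_intro hL hs
      · have := hL.src
        simp only [src_low hqk, src_top] at this ⊢
        exact this
      · have := hL.tgt
        simp only [tgt_low hqk, tgt_top] at this ⊢
        exact this
    · have r₁ := cmpb_bdry hp ha hb w₁
      have r₂ := cmpb_bdry hp hc hd w₂
      have r₃ := cmpb_bdry hqk hab hcd w₃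
      have r₄ := cmpb_bdry hqk ha hc w₄
      have r₅ := cmpb_bdry hqk hb hd w₅
      have r₆ := cmpb_bdry hp hac hbd w₆
      simp only [src_low hqk, tgt_low hqk, src_low hp, tgt_low hp] at r₁ r₂ r₃ r₄ r₅ r₆
      apply eqv_intro hL hs
      · simp only [src_low hqk, src_low hp]
        exact ih ha.src hb.src hc.src hd.src r₁.1 r₂.1 r₃.1 r₄.1 r₅.1 r₆.1
      · simp only [tgt_low hqk, tgt_low hp]
        exact ih ha.tgt hb.tgt hc.tgt hd.tgt r₁.2 r₂.2 r₃.2 r₄.2 r₅.2 r₆.2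

theorem eqv_one_comp {p k : ℕ} {a b : Tm X k} (ha : Eqv a a) (hb : Eqv b b) (w₁ : Cmpb p a b)
    (w₂ : Cmpb p (one a) (one b)) : Eqv (one (comp p a b)) (comp p (one a) (one b)) := by
  have hab := eqv_comp w₁ ha hb
  have hp : p ≠ k := by have := cmpb_lt w₁; omega
  refine eqv_intro (eqv_one hab) (fun M e h D f => ?_) ?_ ?_
  · obtain ⟨u, hu, -⟩ := ha.sem M e (dim_pred h) D f
    obtain ⟨v, hv, -⟩ := hb.sem M e (dim_pred h) D f
    have e₁ : Ev f (one a) (D.one (h := h) u) := ⟨u, hu, rfl⟩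
    have e₂ : Ev f (one b) (D.one (h := h) v) := ⟨v, hv, rfl⟩
    exact ⟨_, ⟨_, ⟨u, v, w₁.eval hu hv, hu, hv, rfl⟩, rfl⟩, ⟨_, _, w₂.eval e₁ e₂, e₁, e₂,
      D.one_comp_one _ _ _ _⟩⟩
  · simpa only [src_low hp, src_one] using hab
  · simpa only [tgt_low hp, tgt_one] using hab

theorem eqv_srcUnit (p : ℕ) {k : ℕ} {a b : Tm X k} (w : Eqv a b) :
    Eqv (a.srcUnit p) (b.srcUnit p) := by
  induction k with
  | zero => exact w
  | succ k ih =>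
    simp only [Tm.srcUnit]
    apply eqv_one
    split_ifs
    · exact w.src
    · exact ih w.src

theorem eqv_tgtUnit (p : ℕ) {k : ℕ} {a b : Tm X k} (w : Eqv a b) :
    Eqv (a.tgtUnit p) (b.tgtUnit p) := by
  induction k with
  | zero => exact w
  | succ k ih =>
    simp only [Tm.tgtUnit]
    apply eqv_one
    split_ifs
    · exact w.tgt
    · exact ih w.tgt

theorem eqv_unit_comp {p k : ℕ} {a : Tm X k} (ha : Eqv a a) (w : Cmpb p (a.srcUnit p) a) :
    Eqv (comp p (a.srcUnit p) a) a := by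
  induction k with
  | zero => exact absurd w (by simp [Cmpb])
  | succ k ih =>
    have hu := eqv_srcUnit p ha
    refine eqv_intro (eqv_comp w hu ha) (fun M e h D f => ?_) ?_ ?_
    · obtain ⟨u, hu, -⟩ := ha.sem M e h D f
      exact ⟨u, ⟨_, _, w.eval hu.srcUnit hu, hu.srcUnit, hu, (D.unit_comp _ _).symm⟩, hu⟩
    · by_cases hp : p = k
      · subst hp
        simpa only [src_top, Tm.srcUnit, if_true, src_one] using ha.src
      · have r := (cmpb_bdry hp hu ha w).1
        have e₁ : (a.srcUnit p).src = a.src.srcUnit p := by simp [Tm.srcUnit, hp]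
        rw [e₁] at r
        rw [src_low hp, e₁]
        exact ih ha.src r
    · by_cases hp : p = k
      · subst hp
        simpa only [tgt_top] using ha.tgt
      · have r := (cmpb_bdry hp hu ha w).2
        have e₁ : (a.srcUnit p).tgt = a.src.srcUnit p := by simp [Tm.srcUnit, hp]
        rw [e₁] at r
        rw [tgt_low hp, e₁]
        have e₂ : Eqv (a.src.srcUnit p) (a.tgt.srcUnit p) := by
          cases k with
          | zero => exact absurd r (by simp [Cmpb])
          | succ j =>
            simp only [Tm.srcUnit]
            apply eqv_one
            split_ifs
            · exact ha.par.src
            · exact eqv_srcUnit p ha.par.src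
        have r' : Cmpb p (a.tgt.srcUnit p) a.tgt := by
          cases k with
          | zero => exact absurd r (by simp [Cmpb])
          | succ j => exact cmpb_congr e₂.tgt ha.tgt.src r
        exact (eqv_comp r e₂ ha.tgt).trans (ih ha.tgt r')

theorem eqv_comp_unit {p k : ℕ} {a : Tm X k} (ha : Eqv a a) (w : Cmpb p a (a.tgtUnit p)) :
    Eqv (comp p a (a.tgtUnit p)) a := by
  induction k with
  | zero => exact absurd w (by simp [Cmpb])
  | succ k ih =>
    have hu := eqv_tgtUnit p ha
    refine eqv_intro (eqv_comp w ha hu) (fun M e h D f => ?_) ?_ ?_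
    · obtain ⟨u, hu, -⟩ := ha.sem M e h D f
      exact ⟨u, ⟨_, _, w.eval hu hu.tgtUnit, hu, hu.tgtUnit, (D.comp_unit _ _).symm⟩, hu⟩
    · by_cases hp : p = k
      · subst hp
        simpa only [src_top] using ha.src
      · have r := (cmpb_bdry hp ha hu w).1
        have e₁ : (a.tgtUnit p).src = a.tgt.tgtUnit p := by simp [Tm.tgtUnit, hp]
        rw [e₁] at r
        rw [src_low hp, e₁]
        have e₂ : Eqv (a.tgt.tgtUnit p) (a.src.tgtUnit p) := by
          cases k with
          | zero => exact absurd r (by simp [Cmpb])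
          | succ j =>
            simp only [Tm.tgtUnit]
            apply eqv_one
            split_ifs
            · exact ha.par.tgt.symm
            · exact eqv_tgtUnit p ha.par.tgt.symm
        have r' : Cmpb p a.src (a.src.tgtUnit p) := by
          cases k with
          | zero => exact absurd r (by simp [Cmpb])
          | succ j => exact cmpb_congr ha.src.tgt e₂.src r
        exact (eqv_comp r ha.src e₂).trans (ih ha.src r')
    · by_cases hp : p = k
      · subst hp
        simpa only [tgt_top, Tm.tgtUnit, if_true, tgt_one] using ha.tgt
      · have r := (cmpb_bdry hp ha hu w).2
        have e₁ : (a.tgtUnit p).tgt = a.tgt.tgtUnit p := by simp [Tm.tgtUnit, hp]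
        rw [e₁] at r
        rw [tgt_low hp, e₁]
        exact ih ha.tgt r

end Tm

namespace Tm

variable {N M : ℕ∞}

/-- Well-formed formal composites: only composable things are composed. -/
def Ok {X : GlobSet.{u} N} : ∀ {k : ℕ}, Tm X k → Prop
  | _, of _ _ => True
  | _, one a => Ok a
  | _, comp p a b => Ok a ∧ Ok b ∧ Cmpb p a b

theorem Ok.mkOne {X : GlobSet.{u} N} {k : ℕ} {a : Tm X k} (ha : Ok a) : Ok (one a) := ha

theorem Ok.mkComp {X : GlobSet.{u} N} {p k : ℕ} {a b : Tm X k} (ha : Ok a) (hb : Ok b)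
    (w : Cmpb p a b) : Ok (comp p a b) := ⟨ha, hb, w⟩

theorem Ok.eqv {X : GlobSet.{u} N} {k : ℕ} {a : Tm X k} (ha : Ok a) : Eqv a a := by
  induction a with
  | of h x => exact eqv_of h x
  | one a ih => exact eqv_one (ih ha)
  | comp p a b iha ihb => exact eqv_comp ha.2.2 (iha ha.1) (ihb ha.2.1)

theorem Ok.bdry {X : GlobSet.{u} N} : ∀ {k : ℕ} (a : Tm X (k + 1)), Ok a → Ok a.src ∧ Ok a.tgt
  | _, of _ _, _ => by rw [src_of, tgt_of]; exact ⟨trivial, trivial⟩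
  | _, one a, ha => by rw [src_one, tgt_one]; exact ⟨ha, ha⟩
  | k, comp p a b, ha => by
    have h₁ := Ok.bdry a ha.1
    have h₂ := Ok.bdry b ha.2.1
    by_cases hp : p = k
    · subst hp
      rw [src_top, tgt_top]
      exact ⟨h₁.1, h₂.2⟩
    · have w := cmpb_bdry hp ha.1.eqv ha.2.1.eqv ha.2.2
      rw [src_low hp, tgt_low hp]
      exact ⟨⟨h₁.1, h₂.1, w.1⟩, ⟨h₁.2, h₂.2, w.2⟩⟩

theorem Ok.src {X : GlobSet.{u} N} {k : ℕ} {a : Tm X (k + 1)} (ha : Ok a) : Ok a.src :=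
  (Ok.bdry a ha).1

theorem Ok.tgt {X : GlobSet.{u} N} {k : ℕ} {a : Tm X (k + 1)} (ha : Ok a) : Ok a.tgt :=
  (Ok.bdry a ha).2

theorem Ok.srcUnit {X : GlobSet.{u} N} (p : ℕ) {k : ℕ} {a : Tm X k} (ha : Ok a) :
    Ok (a.srcUnit p) := by
  induction k with
  | zero => exact ha
  | succ k ih =>
    simp only [Tm.srcUnit, Ok]
    split_ifs
    · exact ha.src
    · exact ih ha.src

theorem Ok.tgtUnit {X : GlobSet.{u} N} (p : ℕ) {k : ℕ} {a : Tm X k} (ha : Ok a) :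
    Ok (a.tgtUnit p) := by
  induction k with
  | zero => exact ha
  | succ k ih =>
    simp only [Tm.tgtUnit, Ok]
    split_ifs
    · exact ha.tgt
    · exact ih ha.tgt

instance setoid (X : GlobSet.{u} N) (k : ℕ) : Setoid {t : Tm X k // Ok t} where
  r a b := Eqv a.1 b.1
  iseqv := ⟨fun a => a.2.eqv, fun h => h.symm, fun h h' => h.trans h'⟩

/-- The globular set of well-formed formal composites modulo equality. -/
def freeGlob (X : GlobSet.{u} N) : GlobSet.{u} N where
  cell k _ := Quotient (setoid X k)
  src := Quotient.map (fun a => ⟨a.1.src, a.2.src⟩) fun _ _ w => Eqv.src w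
  tgt := Quotient.map (fun a => ⟨a.1.tgt, a.2.tgt⟩) fun _ _ w => Eqv.tgt w
  src_src x := by
    induction x using Quotient.inductionOn with
    | _ a => exact Quotient.sound a.2.eqv.par.src
  tgt_src x := by
    induction x using Quotient.inductionOn with
    | _ a => exact Quotient.sound a.2.eqv.par.tgt

variable {X : GlobSet.{u} N}

def cls {k : ℕ} {h : (k : ℕ∞) ≤ N} (a : Tm X k) (ha : Ok a) : (freeGlob X).cell k h :=
  Quotient.mk (setoid X k) ⟨a, ha⟩

theorem mk_eq {k : ℕ} {h : (k : ℕ∞) ≤ N} {a b : Tm X k} {ha : Ok a} {hb : Ok b} :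
    cls (h := h) a ha = cls b hb ↔ Eqv a b := Quotient.eq (r := setoid X k)

theorem mk_surj {k : ℕ} {h : (k : ℕ∞) ≤ N} (x : (freeGlob X).cell k h) :
    ∃ (a : Tm X k) (ha : Ok a), x = cls a ha := by
  induction x using Quotient.inductionOn with
  | _ a => exact ⟨a.1, a.2, rfl⟩

theorem src_mk {k : ℕ} {h : ((k + 1 : ℕ) : ℕ∞) ≤ N} {a : Tm X (k + 1)} (ha : Ok a) :
    (freeGlob X).src (cls (h := h) a ha) = cls a.src ha.src := rfl

theorem tgt_mk {k : ℕ} {h : ((k + 1 : ℕ) : ℕ∞) ≤ N} {a : Tm X (k + 1)} (ha : Ok a) :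
    (freeGlob X).tgt (cls (h := h) a ha) = cls a.tgt ha.tgt := rfl

theorem composable_mk {p k : ℕ} {h : (k : ℕ∞) ≤ N} {a b : Tm X k} {ha : Ok a} {hb : Ok b} :
    (freeGlob X).Composable p (cls (h := h) a ha) (cls b hb) ↔ Cmpb p a b := by
  induction k with
  | zero => simp [GlobSet.Composable, Cmpb]
  | succ k ih =>
    by_cases hp : p = k
    · subst hp
      rw [GlobSet.composable_top, cmpb_top, src_mk, tgt_mk, mk_eq]
    · rw [GlobSet.composable_low hp, cmpb_low hp, src_mk, tgt_mk, ih]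

noncomputable def rep {k : ℕ} {h : (k : ℕ∞) ≤ N} (x : (freeGlob X).cell k h) : Tm X k :=
  (Quotient.out (s := setoid X k) x).1

theorem rep_wf {k : ℕ} {h : (k : ℕ∞) ≤ N} (x : (freeGlob X).cell k h) : Ok (rep x) :=
  (Quotient.out (s := setoid X k) x).2

theorem mk_rep {k : ℕ} {h : (k : ℕ∞) ≤ N} (x : (freeGlob X).cell k h) :
    cls (rep x) (rep_wf x) = x := Quotient.out_eq (s := setoid X k) x

theorem rep_mk {k : ℕ} {h : (k : ℕ∞) ≤ N} {a : Tm X k} (ha : Ok a) :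
    Eqv (rep (cls (h := h) a ha)) a := mk_eq.1 (mk_rep (cls (h := h) a ha))

theorem cmpb_rep {p k : ℕ} {h : (k : ℕ∞) ≤ N} {x y : (freeGlob X).cell k h}
    (w : (freeGlob X).Composable p x y) : Cmpb p (rep x) (rep y) := by
  rw [← mk_rep x, ← mk_rep y] at w
  exact composable_mk.1 w

noncomputable def fone {k : ℕ} {h : ((k + 1 : ℕ) : ℕ∞) ≤ N} (x : (freeGlob X).cell k (dim_pred h)) :
    (freeGlob X).cell (k + 1) h := cls (one (rep x)) (rep_wf x).mkOne

noncomputable def fcomp (p : ℕ) {k : ℕ} {h : (k : ℕ∞) ≤ N} (x y : (freeGlob X).cell k h)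
    (w : (freeGlob X).Composable p x y) : (freeGlob X).cell k h :=
  cls (comp p (rep x) (rep y)) ((rep_wf x).mkComp (rep_wf y) (cmpb_rep w))

theorem fone_mk {k : ℕ} {h : ((k + 1 : ℕ) : ℕ∞) ≤ N} {a : Tm X k} (ha : Ok a) :
    fone (h := h) (cls a ha) = cls (one a) ha.mkOne := mk_eq.2 (eqv_one (rep_mk ha))

theorem fcomp_mk {p k : ℕ} {h : (k : ℕ∞) ≤ N} {a b : Tm X k} {ha : Ok a} {hb : Ok b}
    (w : (freeGlob X).Composable p (cls (h := h) a ha) (cls b hb)) :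
    fcomp p (cls a ha) (cls b hb) w = cls (comp p a b) (ha.mkComp hb (composable_mk.1 w)) :=
  mk_eq.2 (eqv_comp (cmpb_rep w) (rep_mk ha) (rep_mk hb))

theorem fsrcUnit_mk {p k : ℕ} {h : (k : ℕ∞) ≤ N} {a : Tm X k} (ha : Ok a) :
    (freeGlob X).srcUnit fone p (cls (h := h) a ha) = cls (a.srcUnit p) (ha.srcUnit p) := by
  induction k with
  | zero => rfl
  | succ k ih =>
    simp only [GlobSet.srcUnit, Tm.srcUnit]
    split_ifs
    · rw [src_mk, fone_mk]
    · rw [src_mk, ih, fone_mk]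

theorem ftgtUnit_mk {p k : ℕ} {h : (k : ℕ∞) ≤ N} {a : Tm X k} (ha : Ok a) :
    (freeGlob X).tgtUnit fone p (cls (h := h) a ha) = cls (a.tgtUnit p) (ha.tgtUnit p) := by
  induction k with
  | zero => rfl
  | succ k ih =>
    simp only [GlobSet.tgtUnit, Tm.tgtUnit]
    split_ifs
    · rw [tgt_mk, fone_mk]
    · rw [tgt_mk, ih, fone_mk]

end Tm

section Free

open Tm

/-- The free strict `N`-category on an `N`-globular set. -/
noncomputable abbrev StrictCat.free {N : ℕ∞} (X : GlobSet.{u} N) : StrictCat.{u} N where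
  toGlobSet := freeGlob X
  one := fone
  comp := fcomp
  src_one x := by
    obtain ⟨a, ha, rfl⟩ := mk_surj x
    rw [fone_mk, src_mk, mk_eq, Tm.src_one]
    exact ha.eqv
  tgt_one x := by
    obtain ⟨a, ha, rfl⟩ := mk_surj x
    rw [fone_mk, tgt_mk, mk_eq, Tm.tgt_one]
    exact ha.eqv
  src_comp_top x y w := by
    obtain ⟨a, ha, rfl⟩ := mk_surj x
    obtain ⟨b, hb, rfl⟩ := mk_surj y
    rw [fcomp_mk, src_mk, src_mk, mk_eq, src_top]
    exact ha.src.eqv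
  tgt_comp_top x y w := by
    obtain ⟨a, ha, rfl⟩ := mk_surj x
    obtain ⟨b, hb, rfl⟩ := mk_surj y
    rw [fcomp_mk, tgt_mk, tgt_mk, mk_eq, tgt_top]
    exact hb.tgt.eqv
  src_comp_low {p k h} x y w₁ w₂ := by
    obtain ⟨a, ha, rfl⟩ := mk_surj x
    obtain ⟨b, hb, rfl⟩ := mk_surj y
    have hp : p ≠ k := by have := GlobSet.composable_lt w₂; omega
    simp only [fcomp_mk, src_mk] at w₂ ⊢
    rw [mk_eq, src_low hp]
    exact eqv_comp (composable_mk.1 w₂) ha.src.eqv hb.src.eqv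
  tgt_comp_low {p k h} x y w₁ w₂ := by
    obtain ⟨a, ha, rfl⟩ := mk_surj x
    obtain ⟨b, hb, rfl⟩ := mk_surj y
    have hp : p ≠ k := by have := GlobSet.composable_lt w₂; omega
    simp only [fcomp_mk, tgt_mk] at w₂ ⊢
    rw [mk_eq, tgt_low hp]
    exact eqv_comp (composable_mk.1 w₂) ha.tgt.eqv hb.tgt.eqv
  assoc x y z w₁ w₂ w₃ w₄ := by
    obtain ⟨a, ha, rfl⟩ := mk_surj x
    obtain ⟨b, hb, rfl⟩ := mk_surj y
    obtain ⟨c, hc, rfl⟩ := mk_surj z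
    simp only [fcomp_mk] at w₂ w₄ ⊢
    rw [mk_eq]
    exact eqv_assoc ha.eqv hb.eqv hc.eqv (composable_mk.1 w₁) (composable_mk.1 w₂) (composable_mk.1 w₃)
      (composable_mk.1 w₄)
  interchange x y z z' w₁ w₂ w₃ w₄ w₅ w₆ hq := by
    obtain ⟨a, ha, rfl⟩ := mk_surj x
    obtain ⟨b, hb, rfl⟩ := mk_surj y
    obtain ⟨c, hc, rfl⟩ := mk_surj z
    obtain ⟨d, hd, rfl⟩ := mk_surj z'
    simp only [fcomp_mk] at w₃ w₆ ⊢
    rw [mk_eq]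
    exact eqv_interchange ha.eqv hb.eqv hc.eqv hd.eqv (composable_mk.1 w₁) (composable_mk.1 w₂)
      (composable_mk.1 w₃) (composable_mk.1 w₄) (composable_mk.1 w₅) (composable_mk.1 w₆) hq
  one_comp_one x y w₁ w₂ := by
    obtain ⟨a, ha, rfl⟩ := mk_surj x
    obtain ⟨b, hb, rfl⟩ := mk_surj y
    simp only [fone_mk] at w₂
    simp only [fone_mk, fcomp_mk]
    rw [mk_eq]
    exact eqv_one_comp ha.eqv hb.eqv (composable_mk.1 w₁) (composable_mk.1 w₂)
  unit_comp x w := by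
    obtain ⟨a, ha, rfl⟩ := mk_surj x
    simp only [fsrcUnit_mk] at w ⊢
    rw [fcomp_mk, mk_eq]
    exact eqv_unit_comp ha.eqv (composable_mk.1 w)
  comp_unit x w := by
    obtain ⟨a, ha, rfl⟩ := mk_surj x
    simp only [ftgtUnit_mk] at w ⊢
    rw [fcomp_mk, mk_eq]
    exact eqv_comp_unit ha.eqv (composable_mk.1 w)

namespace StrictCat

variable {N M : ℕ∞}

/-- The inclusion of generators. -/
def incl (X : GlobSet.{u} N) : X ⟶ (free X).toGlobSet where
  app x := cls (of _ x) trivial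
  src_app x := mk_eq.2 (by rw [src_of]; exact eqv_of _ _)
  tgt_app x := mk_eq.2 (by rw [tgt_of]; exact eqv_of _ _)

theorem exists_cls (e : M ≤ N) {X : GlobSet.{u} N} {k : ℕ} {h : (k : ℕ∞) ≤ M}
    (x : (trunc e (free X)).cell k h) :
    ∃ (a : Tm X k) (ha : Ok a), cls (h := h.trans e) a ha = x :=
  ⟨_, _, mk_rep (h := h.trans e) x⟩

theorem exists_eval (e : M ≤ N) {X : GlobSet.{u} N} {D : StrictCat.{u} M}
    (f : (GlobSet.res e).obj X ⟶ D.toGlobSet) {k : ℕ} {h : (k : ℕ∞) ≤ M}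
    (x : (freeGlob X).cell k (h.trans e)) : ∃ v : D.cell k h, Ev f (rep x) v := by
  obtain ⟨v, hv, -⟩ := (rep_wf x).eqv.sem M e h D f
  exact ⟨v, hv⟩

noncomputable def evalAt (e : M ≤ N) {X : GlobSet.{u} N} {D : StrictCat.{u} M}
    (f : (GlobSet.res e).obj X ⟶ D.toGlobSet) {k : ℕ} {h : (k : ℕ∞) ≤ M}
    (x : (freeGlob X).cell k (h.trans e)) : D.cell k h := (exists_eval e f x).choose

theorem evalAt_eq (e : M ≤ N) {X : GlobSet.{u} N} {D : StrictCat.{u} M}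
    (f : (GlobSet.res e).obj X ⟶ D.toGlobSet) {k : ℕ} {h : (k : ℕ∞) ≤ M}
    {a : Tm X k} {ha : Ok a} {v : D.cell k h} (hv : Ev f a v) :
    evalAt e f (cls (h := h.trans e) a ha) = v := by
  have h₁ := (exists_eval e f (h := h) (cls (h := h.trans e) a ha)).choose_spec
  obtain ⟨x, hx, hx'⟩ := (rep_mk (h := h.trans e) ha).sem M e h D f
  exact (h₁.unique hx).trans (hx'.unique hv)

/-- For `M ≤ N`, the truncation to dimension `M` of the free strict `N`-category on `X` is free
on the `M`-dimensional part of `X`: extension of maps to strict functors. -/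
noncomputable def extend (e : M ≤ N) {X : GlobSet.{u} N} {D : StrictCat.{u} M}
    (f : (GlobSet.res e).obj X ⟶ D.toGlobSet) : trunc e (free X) ⟶ D where
  map :=
    { app := fun x => evalAt e f x
      src_app := fun x => by
        obtain ⟨a, ha, rfl⟩ := exists_cls e x
        obtain ⟨v, hv, -⟩ := ha.eqv.sem M e _ D f
        rw [evalAt_eq e f hv]
        exact (evalAt_eq e f hv.bdry.1).symm
      tgt_app := fun x => by
        obtain ⟨a, ha, rfl⟩ := exists_cls e x
        obtain ⟨v, hv, -⟩ := ha.eqv.sem M e _ D f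
        rw [evalAt_eq e f hv]
        exact (evalAt_eq e f hv.bdry.2).symm }
  map_one {k h} x := by
    obtain ⟨a, ha, rfl⟩ := exists_cls e x
    obtain ⟨v, hv, -⟩ := ha.eqv.sem M e (dim_pred h) D f
    change evalAt e f (fone (cls a ha)) = D.one (evalAt e f (cls a ha))
    rw [fone_mk, evalAt_eq e f hv]
    exact evalAt_eq e f ⟨v, hv, rfl⟩
  map_comp {p k h} x y w w' := by
    obtain ⟨a, ha, rfl⟩ := exists_cls e x
    obtain ⟨b, hb, rfl⟩ := exists_cls e y
    obtain ⟨u, hu, -⟩ := ha.eqv.sem M e h D f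
    obtain ⟨v, hv, -⟩ := hb.eqv.sem M e h D f
    have w₀ := (composable_trunc e).1 w
    have e₁ : evalAt e f (h := h) (cls a ha) = u := evalAt_eq e f hu
    have e₂ : evalAt e f (h := h) (cls b hb) = v := evalAt_eq e f hv
    change D.Composable p (evalAt e f (cls a ha)) (evalAt e f (cls b hb)) at w'
    change evalAt e f (fcomp p (cls a ha) (cls b hb) w₀)
      = D.comp p (evalAt e f (cls a ha)) (evalAt e f (cls b hb)) w'
    rw [fcomp_mk]
    subst e₁ e₂
    exact evalAt_eq e f ⟨_, _, w', hu, hv, rfl⟩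

theorem incl_extend (e : M ≤ N) {X : GlobSet.{u} N} {D : StrictCat.{u} M}
    (f : (GlobSet.res e).obj X ⟶ D.toGlobSet) :
    (GlobSet.res e).map (incl X) ≫ (extend e f).map = f := by
  ext k h x
  exact evalAt_eq e f rfl

theorem free_hom_ext (e : M ≤ N) {X : GlobSet.{u} N} {D : StrictCat.{u} M}
    {g g' : trunc e (free X) ⟶ D}
    (w : (GlobSet.res e).map (incl X) ≫ g.map = (GlobSet.res e).map (incl X) ≫ g'.map) :
    g = g' := by
  apply Hom.ext
  ext k h x
  obtain ⟨a, ha, rfl⟩ := exists_cls e x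
  suffices H : ∀ (g : trunc e (free X) ⟶ D) {k : ℕ} {h : (k : ℕ∞) ≤ M} (a : Tm X k) (ha : Ok a)
      (v : D.cell k h), Ev ((GlobSet.res e).map (incl X) ≫ g.map) a v →
      g.map.app (k := k) (h := h) (cls (h := h.trans e) a ha) = v by
    obtain ⟨v, hv, -⟩ := ha.eqv.sem M e h D ((GlobSet.res e).map (incl X) ≫ g.map)
    rw [H g a ha v hv, H g' a ha v (w ▸ hv)]
  intro g k h a
  induction a with
  | of h' x =>
    intro ha v hv
    exact hv.symm
  | one a ih =>
    intro ha v hv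
    obtain ⟨u, hu, rfl⟩ := hv
    have e₁ := ih ha u hu
    rw [← e₁]
    refine Eq.trans ?_ (g.map_one _)
    exact congrArg g.map.app (fone_mk (h := h.trans e) (a := a) ha).symm
  | comp p a b iha ihb =>
    intro ha v hv
    obtain ⟨u₁, u₂, w', hu₁, hu₂, rfl⟩ := hv
    have w₁ : (freeGlob X).Composable p (cls (h := h.trans e) a ha.1) (cls b ha.2.1) :=
      composable_mk.2 ha.2.2
    have e₁ := iha ha.1 u₁ hu₁
    have e₂ := ihb ha.2.1 u₂ hu₂
    subst e₁ e₂
    rw [← g.map_comp _ _ ((composable_trunc e).2 w₁)]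
    exact congrArg g.map.app (fcomp_mk w₁).symm

/-- The universal property of the free strict `N`-category. -/
noncomputable def freeEquiv (X : GlobSet.{u} N) (D : StrictCat.{u} N) :
    (free X ⟶ D) ≃ (X ⟶ (forget N).obj D) where
  toFun g := incl X ≫ g.map
  invFun f := extend le_rfl f
  left_inv _ := free_hom_ext le_rfl (incl_extend le_rfl _)
  right_inv f := incl_extend le_rfl f

/-- The free strict `N`-category functor. -/
noncomputable def freeFunctor (N : ℕ∞) : GlobSet.{u} N ⥤ StrictCat.{u} N :=
  Adjunction.leftAdjointOfEquiv (G := forget N) freeEquiv fun _ _ _ _ _ => rfl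

/-- The free strict `N`-category functor is left adjoint to the forgetful functor. -/
noncomputable def adj (N : ℕ∞) : freeFunctor.{u} N ⊣ forget N :=
  Adjunction.adjunctionOfEquivLeft freeEquiv fun _ _ _ _ _ => rfl

end StrictCat

end Free

/-- The free strict `N`-category monad on `N`-globular sets. -/
noncomputable def T (N : ℕ∞) : Monad (GlobSet.{u} N) := (StrictCat.adj N).toMonad

namespace StrictCat

variable {N M : ℕ∞}

/-- Truncation of strict functors. -/
abbrev truncMap (e : M ≤ N) {C D : StrictCat.{u} N} (g : C ⟶ D) : trunc e C ⟶ trunc e D where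
  map := (GlobSet.res e).map g.map
  map_one a := g.map_one a
  map_comp a b _ w' := g.map_comp a b _ ((composable_trunc e).1 w')

theorem comp_map {C D E : StrictCat.{u} N} (f : C ⟶ D) (g : D ⟶ E) :
    (f ≫ g).map = f.map ≫ g.map := rfl

theorem unit_eq (X : GlobSet.{u} N) : (T N).η.app X = incl X := rfl

theorem incl_map {X Y : GlobSet.{u} N} (f : X ⟶ Y) :
    incl X ≫ ((freeFunctor N).map f).map = f ≫ incl Y := (T N).η.naturality f |>.symm

/-- The comparison `R T_N X ⟶ T_M R X`, where `R` is restriction from dimension `N` to dimension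
`M`; it is the unique strict functor which is the identity on generators. -/
noncomputable def down (e : M ≤ N) (X : GlobSet.{u} N) :
    (GlobSet.res e).obj ((T N).obj X) ⟶ (T M).obj ((GlobSet.res e).obj X) :=
  (extend e (incl ((GlobSet.res e).obj X))).map

/-- The comparison `T_M R X ⟶ R T_N X`, the inverse of `down`. -/
noncomputable def up (e : M ≤ N) (X : GlobSet.{u} N) :
    (T M).obj ((GlobSet.res e).obj X) ⟶ (GlobSet.res e).obj ((T N).obj X) :=
  (extend (D := trunc e (free X)) le_rfl ((GlobSet.res e).map (incl X))).map

theorem unit_down (e : M ≤ N) (X : GlobSet.{u} N) :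
    (GlobSet.res e).map ((T N).η.app X) ≫ down e X = (T M).η.app ((GlobSet.res e).obj X) :=
  incl_extend e _

theorem unit_up (e : M ≤ N) (X : GlobSet.{u} N) :
    (T M).η.app ((GlobSet.res e).obj X) ≫ up e X = (GlobSet.res e).map ((T N).η.app X) :=
  incl_extend (X := (GlobSet.res e).obj X) le_rfl _

/-- Maps out of `R T_N X` underlying strict functors are determined on generators. -/
theorem T_hom_ext (e : M ≤ N) {X : GlobSet.{u} N} {D : StrictCat.{u} M}
    (g g' : trunc e (free X) ⟶ D)
    (w : (GlobSet.res e).map ((T N).η.app X) ≫ g.map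
      = (GlobSet.res e).map ((T N).η.app X) ≫ g'.map) : g.map = g'.map := by
  rw [free_hom_ext e w]

theorem down_up (e : M ≤ N) (X : GlobSet.{u} N) : down e X ≫ up e X = 𝟙 _ := by
  refine T_hom_ext e (D := trunc e (free X))
    (extend e (incl ((GlobSet.res e).obj X)) ≫
      extend (D := trunc e (free X)) le_rfl ((GlobSet.res e).map (incl X))) (𝟙 _) ?_
  change (GlobSet.res e).map ((T N).η.app X) ≫ down e X ≫ up e X = _
  rw [← Category.assoc, unit_down, unit_up]
  rfl

theorem up_down (e : M ≤ N) (X : GlobSet.{u} N) : up e X ≫ down e X = 𝟙 _ := by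
  refine T_hom_ext (X := (GlobSet.res e).obj X) le_rfl (D := free ((GlobSet.res e).obj X))
    (extend (D := trunc e (free X)) le_rfl ((GlobSet.res e).map (incl X)) ≫
      extend e (incl ((GlobSet.res e).obj X))) (𝟙 _) ?_
  change (T M).η.app ((GlobSet.res e).obj X) ≫ up e X ≫ down e X = _
  rw [← Category.assoc, unit_up, unit_down]
  rfl

theorem down_naturality (e : M ≤ N) {X Y : GlobSet.{u} N} (f : X ⟶ Y) :
    (GlobSet.res e).map ((T N).map f) ≫ down e Y
      = down e X ≫ (T M).map ((GlobSet.res e).map f) := by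
  refine T_hom_ext e (X := X) (D := free ((GlobSet.res e).obj Y))
    (truncMap e ((freeFunctor N).map f) ≫ extend e (incl ((GlobSet.res e).obj Y)))
    (extend e (incl ((GlobSet.res e).obj X)) ≫ (freeFunctor M).map ((GlobSet.res e).map f)) ?_
  change (GlobSet.res e).map ((T N).η.app X) ≫ (GlobSet.res e).map ((T N).map f) ≫ down e Y
    = (GlobSet.res e).map ((T N).η.app X) ≫ down e X ≫ (T M).map ((GlobSet.res e).map f)
  rw [← Category.assoc, ← Category.assoc, unit_down, ← Functor.map_comp,
    ← (T N).η.naturality, ← (T M).η.naturality, Functor.map_comp, Category.assoc, unit_down]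
  rfl

theorem down_mul (e : M ≤ N) (X : GlobSet.{u} N) :
    (GlobSet.res e).map ((T N).μ.app X) ≫ down e X
      = down e ((T N).obj X) ≫ (T M).map (down e X) ≫ (T M).μ.app ((GlobSet.res e).obj X) := by
  refine T_hom_ext e (X := (T N).obj X) (D := free ((GlobSet.res e).obj X))
    (truncMap e ((adj N).counit.app ((freeFunctor N).obj X)) ≫
      extend e (incl ((GlobSet.res e).obj X)))
    (extend e (incl ((GlobSet.res e).obj ((T N).obj X))) ≫ (freeFunctor M).map (down e X) ≫
      (adj M).counit.app ((freeFunctor M).obj ((GlobSet.res e).obj X))) ?_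
  change (GlobSet.res e).map ((T N).η.app ((T N).obj X)) ≫ (GlobSet.res e).map ((T N).μ.app X) ≫
      down e X
    = (GlobSet.res e).map ((T N).η.app ((T N).obj X)) ≫ down e ((T N).obj X) ≫
      (T M).map (down e X) ≫ (T M).μ.app ((GlobSet.res e).obj X)
  rw [← Category.assoc, ← Functor.map_comp, (T N).left_unit,
    ← Category.assoc (GlobSet.res e |>.map _) (down e _), unit_down,
    ← Category.assoc _ ((T M).map _), ← (T M).η.naturality, Category.assoc, (T M).left_unit]
  rfl

theorem up_naturality (e : M ≤ N) {X Y : GlobSet.{u} N} (f : X ⟶ Y) :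
    up e X ≫ (GlobSet.res e).map ((T N).map f) = (T M).map ((GlobSet.res e).map f) ≫ up e Y := by
  rw [← Category.comp_id (up e X ≫ _), ← down_up, Category.assoc, ← Category.assoc _ (down e Y),
    down_naturality, ← Category.assoc (up e X), ← Category.assoc (up e X), up_down,
    Category.id_comp]

theorem up_mul (e : M ≤ N) (X : GlobSet.{u} N) :
    (T M).map (up e X) ≫ up e ((T N).obj X) ≫ (GlobSet.res e).map ((T N).μ.app X)
      = (T M).μ.app ((GlobSet.res e).obj X) ≫ up e X := by
  have h := down_mul e X
  calc _ = (T M).map (up e X) ≫ up e ((T N).obj X) ≫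
        ((GlobSet.res e).map ((T N).μ.app X) ≫ down e X) ≫ up e X := by
        rw [Category.assoc, down_up, Category.comp_id]
    _ = (T M).map (up e X) ≫ (up e ((T N).obj X) ≫ down e ((T N).obj X)) ≫
        (T M).map (down e X) ≫ (T M).μ.app ((GlobSet.res e).obj X) ≫ up e X := by
        rw [h]; simp only [Category.assoc]
    _ = (T M).map (up e X ≫ down e X) ≫ (T M).μ.app ((GlobSet.res e).obj X) ≫ up e X := by
        rw [up_down, Category.id_comp, Functor.map_comp, Category.assoc]
    _ = _ := by rw [up_down, CategoryTheory.Functor.map_id, Category.id_comp]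

end StrictCat

namespace GlobSet

variable {N M : ℕ∞}

/-- The terminal `N`-globular set. -/
abbrev pt (N : ℕ∞) : GlobSet.{u} N where
  cell _ _ := PUnit
  src _ := PUnit.unit
  tgt _ := PUnit.unit
  src_src _ := rfl
  tgt_src _ := rfl

/-- The unique map to the terminal `N`-globular set. -/
abbrev toPt (X : GlobSet.{u} N) : X ⟶ pt.{u} N :=
  Hom.mk (fun _ => PUnit.unit) (fun _ => rfl) (fun _ => rfl)

theorem pt_ext {X : GlobSet.{u} N} (f g : X ⟶ pt.{u} N) : f = g := by
  ext k h x

/-- The pullback of `f` and `g`. -/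
def pb {X Y Z : GlobSet.{u} N} (f : X ⟶ Z) (g : Y ⟶ Z) : GlobSet.{u} N where
  cell k h := {x : X.cell k h × Y.cell k h // f.app x.1 = g.app x.2}
  src x := ⟨(X.src x.1.1, Y.src x.1.2), by rw [← f.src_app, ← g.src_app, x.2]⟩
  tgt x := ⟨(X.tgt x.1.1, Y.tgt x.1.2), by rw [← f.tgt_app, ← g.tgt_app, x.2]⟩
  src_src x := Subtype.ext (Prod.ext (X.src_src x.1.1) (Y.src_src x.1.2))
  tgt_src x := Subtype.ext (Prod.ext (X.tgt_src x.1.1) (Y.tgt_src x.1.2))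

namespace pb

variable {X Y Z W : GlobSet.{u} N}

def fst (f : X ⟶ Z) (g : Y ⟶ Z) : pb f g ⟶ X :=
  Hom.mk (fun x => x.1.1) (fun _ => rfl) (fun _ => rfl)

def snd (f : X ⟶ Z) (g : Y ⟶ Z) : pb f g ⟶ Y :=
  Hom.mk (fun x => x.1.2) (fun _ => rfl) (fun _ => rfl)

theorem condition (f : X ⟶ Z) (g : Y ⟶ Z) : fst f g ≫ f = snd f g ≫ g := by
  ext k h x
  exact x.2

def lift {f : X ⟶ Z} {g : Y ⟶ Z} (a : W ⟶ X) (b : W ⟶ Y) (w : a ≫ f = b ≫ g) : W ⟶ pb f g :=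
  Hom.mk (fun x => ⟨(a.app x, b.app x), congrArg (fun r : W ⟶ Z => r.app x) w⟩)
    (fun x => Subtype.ext (Prod.ext (a.src_app x) (b.src_app x)))
    (fun x => Subtype.ext (Prod.ext (a.tgt_app x) (b.tgt_app x)))

theorem lift_fst {f : X ⟶ Z} {g : Y ⟶ Z} (a : W ⟶ X) (b : W ⟶ Y) (w : a ≫ f = b ≫ g) :
    lift a b w ≫ fst f g = a := rfl

theorem lift_snd {f : X ⟶ Z} {g : Y ⟶ Z} (a : W ⟶ X) (b : W ⟶ Y) (w : a ≫ f = b ≫ g) :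
    lift a b w ≫ snd f g = b := rfl

theorem lift_fst_assoc {V : GlobSet.{u} N} {f : X ⟶ Z} {g : Y ⟶ Z} (a : W ⟶ X) (b : W ⟶ Y)
    (w : a ≫ f = b ≫ g) (r : X ⟶ V) : lift a b w ≫ fst f g ≫ r = a ≫ r := rfl

theorem lift_snd_assoc {V : GlobSet.{u} N} {f : X ⟶ Z} {g : Y ⟶ Z} (a : W ⟶ X) (b : W ⟶ Y)
    (w : a ≫ f = b ≫ g) (r : Y ⟶ V) : lift a b w ≫ snd f g ≫ r = b ≫ r := rfl

theorem hom_ext {f : X ⟶ Z} {g : Y ⟶ Z} {a b : W ⟶ pb f g} (h₁ : a ≫ fst f g = b ≫ fst f g)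
    (h₂ : a ≫ snd f g = b ≫ snd f g) : a = b := by
  refine GlobSet.hom_ext fun k h x => ?_
  exact Subtype.ext (Prod.ext (congrArg (fun r : W ⟶ X => r.app x) h₁)
    (congrArg (fun r : W ⟶ Y => r.app x) h₂))

theorem comp_lift {V : GlobSet.{u} N} {f : X ⟶ Z} {g : Y ⟶ Z} (v : V ⟶ W) (a : W ⟶ X) (b : W ⟶ Y)
    (w : a ≫ f = b ≫ g) :
    v ≫ lift a b w = lift (v ≫ a) (v ≫ b) (by rw [Category.assoc, w, Category.assoc]) := rfl

theorem lift_congr {f : X ⟶ Z} {g : Y ⟶ Z} {a a' : W ⟶ X} {b b' : W ⟶ Y} (h₁ : a = a')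
    (h₂ : b = b') (w : a ≫ f = b ≫ g) :
    lift a b w = lift a' b' (by rw [← h₁, ← h₂, w]) := by
  subst h₁ h₂
  rfl

end pb

end GlobSet

section Operads

open GlobSet

/-- A `T_N`-operad: a collection `d : C ⟶ T_N 1` with identities `1 ⟶ C` and composition
`C ∘ C ⟶ C` over `T_N 1`, where `C ∘ C` is the pullback of `T_N C ⟶ T_N 1` and `d`, satisfying
the identity and associativity laws (the hypotheses `w₁, w₂, …` only say that the displayed maps
into a pullback exist, and follow from the other axioms). -/
structure Operad (N : ℕ∞) where
  C : GlobSet.{u} N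
  d : C ⟶ (T N).obj (pt N)
  ids : pt N ⟶ C
  comp : pb ((T N).map (toPt C)) d ⟶ C
  ids_d : ids ≫ d = (T N).η.app (pt N)
  comp_d : comp ≫ d = pb.fst _ _ ≫ (T N).map d ≫ (T N).μ.app (pt N)
  ids_comp : ∀ w₁, pb.lift ((T N).η.app C) (toPt C ≫ ids) w₁ ≫ comp = 𝟙 C
  comp_ids : ∀ w₁, pb.lift (d ≫ (T N).map ids) (𝟙 C) w₁ ≫ comp = 𝟙 C
  assoc : ∀ w₁ w₂ w₃,
    pb.lift (f := (T N).map (toPt C)) (g := d)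
      (pb.fst ((T N).map (toPt (pb ((T N).map (toPt C)) d))) d ≫ (T N).map comp)
      (pb.snd _ _) w₁ ≫ comp
    = pb.lift (f := (T N).map (toPt C)) (g := d)
      (pb.fst ((T N).map (toPt (pb ((T N).map (toPt C)) d))) d ≫
        (T N).map (pb.fst _ _) ≫ (T N).μ.app C)
      (pb.lift (f := (T N).map (toPt C)) (g := d)
        (pb.fst ((T N).map (toPt (pb ((T N).map (toPt C)) d))) d ≫ (T N).map (pb.snd _ _))
        (pb.snd _ _) w₂ ≫ comp) w₃ ≫ comp

namespace Operad

variable {N M : ℕ∞}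

@[ext]
structure Hom (O P : Operad.{u} N) where
  map : O.C ⟶ P.C
  map_d : map ≫ P.d = O.d
  map_ids : O.ids ≫ map = P.ids
  map_comp : ∀ w, O.comp ≫ map =
    pb.lift (f := (T N).map (toPt P.C)) (g := P.d)
      (pb.fst _ _ ≫ (T N).map map) (pb.snd _ _ ≫ map) w ≫ P.comp

theorem Hom.w {O P : Operad.{u} N} (map : O.C ⟶ P.C) (map_d : map ≫ P.d = O.d) :
    (pb.fst ((T N).map (toPt O.C)) O.d ≫ (T N).map map) ≫ (T N).map (toPt P.C)
      = (pb.snd ((T N).map (toPt O.C)) O.d ≫ map) ≫ P.d := by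
  rw [Category.assoc, ← Functor.map_comp, Category.assoc, map_d]
  exact pb.condition _ _

instance : Category (Operad.{u} N) where
  Hom := Hom
  id O := ⟨𝟙 _, rfl, rfl, fun w => by
    rw [Category.comp_id]
    have : pb.lift (f := (T N).map (toPt O.C)) (g := O.d)
      (pb.fst _ _ ≫ (T N).map (𝟙 O.C)) (pb.snd _ _ ≫ 𝟙 O.C) w = 𝟙 _ :=
      pb.hom_ext (by rw [pb.lift_fst, CategoryTheory.Functor.map_id]; rfl) rfl
    rw [this, Category.id_comp]⟩
  comp {O P Q} f g := ⟨f.map ≫ g.map, by rw [Category.assoc, g.map_d, f.map_d],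
    by rw [← Category.assoc, f.map_ids, g.map_ids], fun w => by
      rw [← Category.assoc, f.map_comp (Hom.w _ f.map_d), Category.assoc,
        g.map_comp (Hom.w _ g.map_d), ← Category.assoc, pb.comp_lift]
      congr 1
      exact pb.hom_ext (by
        rw [pb.lift_fst, pb.lift_fst, Functor.map_comp, ← Category.assoc, pb.lift_fst,
          Category.assoc]) rfl⟩

section Monad

variable (O : Operad.{u} N)

/-- `T_C X`, for the operad `C` and a globular set `X`: the pullback of `T X ⟶ T 1` and `d`. -/
noncomputable abbrev act (X : GlobSet.{u} N) : GlobSet.{u} N := pb ((T N).map (toPt X)) O.d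

theorem w_map {X Y : GlobSet.{u} N} (f : X ⟶ Y) :
    (pb.fst ((T N).map (toPt X)) O.d ≫ (T N).map f) ≫ (T N).map (toPt Y)
      = pb.snd ((T N).map (toPt X)) O.d ≫ O.d := by
  rw [Category.assoc, ← Functor.map_comp]
  exact pb.condition _ _

theorem w_unit (X : GlobSet.{u} N) :
    (T N).η.app X ≫ (T N).map (toPt X) = (toPt X ≫ O.ids) ≫ O.d := by
  rw [Category.assoc, O.ids_d, ← (T N).η.naturality]
  rfl

theorem w_sub (X : GlobSet.{u} N) :
    (pb.fst ((T N).map (toPt (O.act X))) O.d ≫ (T N).map (pb.snd _ _)) ≫ (T N).map (toPt O.C)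
      = pb.snd ((T N).map (toPt (O.act X))) O.d ≫ O.d := by
  rw [Category.assoc, ← Functor.map_comp]
  exact pb.condition _ _

/-- The composite `T_C T_C X ⟶ C ∘ C ⟶ C`. -/
noncomputable def sub (X : GlobSet.{u} N) : O.act (O.act X) ⟶ O.C :=
  pb.lift (pb.fst ((T N).map (toPt (O.act X))) O.d ≫ (T N).map (pb.snd _ _)) (pb.snd _ _)
    (O.w_sub X) ≫ O.comp

theorem mul_nat {X Y : GlobSet.{u} N} (f : X ⟶ Y) :
    (T N).map ((T N).map f) ≫ (T N).μ.app Y = (T N).μ.app X ≫ (T N).map f :=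
  (T N).μ.naturality f

theorem unit_nat {X Y : GlobSet.{u} N} (f : X ⟶ Y) :
    f ≫ (T N).η.app Y = (T N).η.app X ≫ (T N).map f :=
  (T N).η.naturality f

theorem w_mul (X : GlobSet.{u} N) :
    (pb.fst ((T N).map (toPt (O.act X))) O.d ≫ (T N).map (pb.fst _ _) ≫ (T N).μ.app X) ≫
      (T N).map (toPt X) = O.sub X ≫ O.d := by
  rw [sub, Category.assoc, Category.assoc, ← mul_nat, ← Category.assoc ((T N).map _),
    ← Functor.map_comp, pb.condition, Category.assoc, O.comp_d, pb.lift_fst_assoc,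
    Functor.map_comp]
  simp only [Category.assoc]

theorem w_ids : (O.d ≫ (T N).map O.ids) ≫ (T N).map (toPt O.C) = 𝟙 O.C ≫ O.d := by
  rw [Category.assoc, ← Functor.map_comp, pt_ext (O.ids ≫ toPt O.C) (𝟙 _),
    CategoryTheory.Functor.map_id, Category.comp_id, Category.id_comp]

noncomputable def actMap {X Y : GlobSet.{u} N} (f : X ⟶ Y) : O.act X ⟶ O.act Y :=
  pb.lift (pb.fst _ _ ≫ (T N).map f) (pb.snd _ _) (O.w_map f)

noncomputable def actUnit (X : GlobSet.{u} N) : X ⟶ O.act X :=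
  pb.lift ((T N).η.app X) (toPt X ≫ O.ids) (O.w_unit X)

noncomputable def actMul (X : GlobSet.{u} N) : O.act (O.act X) ⟶ O.act X :=
  pb.lift (pb.fst _ _ ≫ (T N).map (pb.fst _ _) ≫ (T N).μ.app X) (O.sub X) (O.w_mul X)

theorem actMap_fst {X Y : GlobSet.{u} N} (f : X ⟶ Y) :
    O.actMap f ≫ pb.fst _ _ = pb.fst _ _ ≫ (T N).map f := rfl
theorem actMap_snd {X Y : GlobSet.{u} N} (f : X ⟶ Y) :
    O.actMap f ≫ pb.snd _ _ = pb.snd _ _ := rfl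
theorem actMap_fst_assoc {X Y Z : GlobSet.{u} N} (f : X ⟶ Y) (r : (T N).obj Y ⟶ Z) :
    O.actMap f ≫ pb.fst _ _ ≫ r = pb.fst _ _ ≫ (T N).map f ≫ r := rfl
theorem actMap_snd_assoc {X Y Z : GlobSet.{u} N} (f : X ⟶ Y) (r : O.C ⟶ Z) :
    O.actMap f ≫ pb.snd _ _ ≫ r = pb.snd _ _ ≫ r := rfl
theorem actUnit_fst (X : GlobSet.{u} N) : O.actUnit X ≫ pb.fst _ _ = (T N).η.app X := rfl
theorem actUnit_snd (X : GlobSet.{u} N) : O.actUnit X ≫ pb.snd _ _ = toPt X ≫ O.ids := rfl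
theorem actUnit_fst_assoc {X Z : GlobSet.{u} N} (r : (T N).obj X ⟶ Z) :
    O.actUnit X ≫ pb.fst _ _ ≫ r = (T N).η.app X ≫ r := rfl
theorem actMul_fst (X : GlobSet.{u} N) : O.actMul X ≫ pb.fst _ _ =
    pb.fst _ _ ≫ (T N).map (pb.fst _ _) ≫ (T N).μ.app X := rfl
theorem actMul_snd (X : GlobSet.{u} N) : O.actMul X ≫ pb.snd _ _ = O.sub X := rfl
theorem actMul_fst_assoc {X Z : GlobSet.{u} N} (r : (T N).obj X ⟶ Z) :
    O.actMul X ≫ pb.fst _ _ ≫ r = pb.fst _ _ ≫ (T N).map (pb.fst _ _) ≫ (T N).μ.app X ≫ r := rfl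

/-- Equality of maps into `C` given by composition. -/
theorem comp_congr {W : GlobSet.{u} N} {a a' : W ⟶ (T N).obj O.C} {b b' : W ⟶ O.C} (h₁ : a = a')
    (h₂ : b = b') (w : a ≫ (T N).map (toPt O.C) = b ≫ O.d) (w') :
    pb.lift (g := O.d) a b w ≫ O.comp = pb.lift a' b' w' ≫ O.comp := by
  subst h₁ h₂
  rfl

theorem pre_comp {V W : GlobSet.{u} N} (v : V ⟶ W) {a : W ⟶ (T N).obj O.C} {b : W ⟶ O.C}
    (w : a ≫ (T N).map (toPt O.C) = b ≫ O.d) : v ≫ pb.lift a b w ≫ O.comp =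
      pb.lift (v ≫ a) (v ≫ b) (by rw [Category.assoc, w, Category.assoc]) ≫ O.comp := rfl

theorem comp_sub {W X : GlobSet.{u} N} (v : W ⟶ O.act (O.act X)) : v ≫ O.sub X =
    pb.lift (v ≫ pb.fst _ _ ≫ (T N).map (pb.snd _ _)) (v ≫ pb.snd _ _)
      (by rw [Category.assoc, O.w_sub X, Category.assoc]) ≫ O.comp := rfl

theorem act_left_unit (X : GlobSet.{u} N) : O.actUnit (O.act X) ≫ O.actMul X = 𝟙 _ := by
  apply pb.hom_ext
  · rw [Category.assoc, actMul_fst, actUnit_fst_assoc, ← Category.assoc, ← unit_nat,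
      Category.assoc, (T N).left_unit X]
    rfl
  · rw [Category.assoc, actMul_snd, comp_sub]
    have k := congrArg (fun r => pb.snd ((T N).map (toPt X)) O.d ≫ r) (O.ids_comp (O.w_unit _))
    simp only [pre_comp] at k
    refine Eq.trans ?_ k
    refine O.comp_congr ?_ rfl _ _
    rw [actUnit_fst_assoc, unit_nat]

theorem act_right_unit (X : GlobSet.{u} N) : O.actMap (O.actUnit X) ≫ O.actMul X = 𝟙 _ := by
  apply pb.hom_ext
  · rw [Category.assoc, actMul_fst, actMap_fst_assoc, ← Category.assoc ((T N).map _),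
      ← Functor.map_comp, actUnit_fst, (T N).right_unit X]
    rfl
  · rw [Category.assoc, actMul_snd, comp_sub]
    have k := congrArg (fun r => pb.snd ((T N).map (toPt X)) O.d ≫ r) (O.comp_ids O.w_ids)
    simp only [pre_comp] at k
    refine Eq.trans ?_ k
    refine O.comp_congr ?_ rfl _ _
    rw [actMap_fst_assoc, ← Functor.map_comp, actUnit_snd, Functor.map_comp,
      ← Category.assoc, pb.condition, Category.assoc]

/-- The canonical map `T_C T_C X ⟶ C ∘ C`. -/
noncomputable def subPair (X : GlobSet.{u} N) : O.act (O.act X) ⟶ O.act O.C :=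
  pb.lift (pb.fst _ _ ≫ (T N).map (pb.snd _ _)) (pb.snd _ _) (O.w_sub X)

theorem subPair_fst (X : GlobSet.{u} N) :
    O.subPair X ≫ pb.fst _ _ = pb.fst _ _ ≫ (T N).map (pb.snd _ _) := rfl

theorem act_assoc (X : GlobSet.{u} N) :
    O.actMap (O.actMul X) ≫ O.actMul X = O.actMul (O.act X) ≫ O.actMul X := by
  apply pb.hom_ext
  · rw [Category.assoc, Category.assoc, actMul_fst, actMap_fst_assoc, actMul_fst_assoc,
      ← Category.assoc ((T N).map (O.actMul X)), ← Functor.map_comp, actMul_fst,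
      ← Category.assoc ((T N).μ.app _), ← mul_nat]
    simp only [Functor.map_comp, Category.assoc]
    rw [(T N).assoc X]
  · rw [Category.assoc, Category.assoc, actMul_snd, comp_sub, comp_sub]
    have k := congrArg (fun r => O.actMap (O.subPair X) ≫ r)
      (O.assoc (O.w_map _) (O.w_sub _) (O.w_mul _))
    simp only [pre_comp] at k
    refine Eq.trans ?_ (k.trans ?_)
    · refine O.comp_congr ?_ rfl _ _
      rw [actMap_fst_assoc, actMap_fst_assoc, ← Functor.map_comp, ← Functor.map_comp]
      rfl
    · refine Eq.trans (O.pre_comp _ _) ?_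
      refine O.comp_congr ?_ ?_ _ _
      · rw [actMap_fst_assoc, actMul_fst_assoc, ← Category.assoc ((T N).map _),
          ← Functor.map_comp, subPair_fst, Functor.map_comp, Category.assoc, mul_nat]
      · refine Eq.trans (O.pre_comp _ _) ?_
        refine O.comp_congr ?_ rfl _ _
        rw [actMap_fst_assoc, ← Functor.map_comp]
        rfl

/-- The monad `T_C` on globular sets induced by the operad `C`. -/
noncomputable def monad : Monad (GlobSet.{u} N) where
  obj X := O.act X
  map f := O.actMap f
  map_id X := pb.hom_ext (by rw [actMap_fst, CategoryTheory.Functor.map_id]; rfl) rfl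
  map_comp f g := pb.hom_ext (by
    rw [actMap_fst, Functor.map_comp, Category.assoc, actMap_fst, actMap_fst_assoc]) rfl
  η :=
    { app := O.actUnit
      naturality := fun X Y f => pb.hom_ext (unit_nat f) rfl }
  μ :=
    { app := O.actMul
      naturality := fun X Y f => pb.hom_ext (by
        simp only [Functor.comp_map, Category.assoc]
        rw [actMul_fst, actMap_fst, actMul_fst_assoc, actMap_fst_assoc,
          ← Category.assoc ((T N).map _), ← Functor.map_comp, actMap_fst, Functor.map_comp,
          Category.assoc, mul_nat]) (by
        simp only [Functor.comp_map, Category.assoc]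
        rw [actMul_snd, actMap_snd, actMul_snd, comp_sub]
        refine O.comp_congr ?_ rfl _ _
        rw [actMap_fst_assoc, ← Functor.map_comp, actMap_snd]) }
  left_unit := O.act_left_unit
  right_unit := O.act_right_unit
  assoc := O.act_assoc

end Monad

end Operad

namespace GlobSet

variable {N M : ℕ∞}

/-- The map into the restriction of a pullback with given components. -/
def pb.resLift (e : M ≤ N) {X Y Z : GlobSet.{u} N} {W : GlobSet.{u} M} {f : X ⟶ Z} {g : Y ⟶ Z}
    (a : W ⟶ (res e).obj X) (b : W ⟶ (res e).obj Y) (w : a ≫ (res e).map f = b ≫ (res e).map g) :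
    W ⟶ (res e).obj (pb f g) :=
  Hom.mk (fun x => ⟨(a.app x, b.app x), congrArg (fun r : W ⟶ (res e).obj Z => r.app x) w⟩)
    (fun x => Subtype.ext (Prod.ext (a.src_app x) (b.src_app x)))
    (fun x => Subtype.ext (Prod.ext (a.tgt_app x) (b.tgt_app x)))

theorem pb.resLift_fst (e : M ≤ N) {X Y Z : GlobSet.{u} N} {W : GlobSet.{u} M} {f : X ⟶ Z}
    {g : Y ⟶ Z} (a : W ⟶ (res e).obj X) (b : W ⟶ (res e).obj Y)
    (w : a ≫ (res e).map f = b ≫ (res e).map g) :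
    pb.resLift e a b w ≫ (res e).map (pb.fst f g) = a := rfl

theorem pb.resLift_snd (e : M ≤ N) {X Y Z : GlobSet.{u} N} {W : GlobSet.{u} M} {f : X ⟶ Z}
    {g : Y ⟶ Z} (a : W ⟶ (res e).obj X) (b : W ⟶ (res e).obj Y)
    (w : a ≫ (res e).map f = b ≫ (res e).map g) :
    pb.resLift e a b w ≫ (res e).map (pb.snd f g) = b := rfl

theorem pb.resLift_fst_assoc (e : M ≤ N) {X Y Z : GlobSet.{u} N} {W V : GlobSet.{u} M} {f : X ⟶ Z}
    {g : Y ⟶ Z} (a : W ⟶ (res e).obj X) (b : W ⟶ (res e).obj Y)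
    (w : a ≫ (res e).map f = b ≫ (res e).map g) (r : (res e).obj X ⟶ V) :
    pb.resLift e a b w ≫ (res e).map (pb.fst f g) ≫ r = a ≫ r := rfl

end GlobSet

open StrictCat

namespace Operad

variable {N M : ℕ∞}

section Res

variable (e : M ≤ N) (O : Operad.{u} N)

noncomputable abbrev resD : (GlobSet.res e).obj O.C ⟶ (T M).obj (pt M) :=
  (GlobSet.res e).map O.d ≫ down e (pt N)

theorem w_res {W : GlobSet.{u} M} {a : W ⟶ (T M).obj ((GlobSet.res e).obj O.C)}
    {b : W ⟶ (GlobSet.res e).obj O.C}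
    (w : a ≫ (T M).map (toPt ((GlobSet.res e).obj O.C)) = b ≫ O.resD e) :
    (a ≫ up e O.C) ≫ (GlobSet.res e).map ((T N).map (toPt O.C))
      = b ≫ (GlobSet.res e).map O.d := by
  rw [Category.assoc, up_naturality, ← Category.assoc]
  refine Eq.trans (congrArg (· ≫ up e (pt N)) w) ?_
  rw [resD, Category.assoc, Category.assoc, down_up, Category.comp_id]

/-- The comparison between `C ∘ C` computed before and after restriction. -/
noncomputable def resPair : pb ((T M).map (toPt ((GlobSet.res e).obj O.C))) (O.resD e) ⟶
    (GlobSet.res e).obj (pb ((T N).map (toPt O.C)) O.d) :=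
  pb.resLift e (pb.fst _ _ ≫ up e O.C) (pb.snd _ _) (O.w_res e (pb.condition _ _))

noncomputable def resComp : pb ((T M).map (toPt ((GlobSet.res e).obj O.C))) (O.resD e) ⟶
    (GlobSet.res e).obj O.C := O.resPair e ≫ (GlobSet.res e).map O.comp

theorem resPair_fst : O.resPair e ≫ (GlobSet.res e).map (pb.fst _ _)
    = pb.fst _ _ ≫ up e O.C := rfl

theorem resPair_snd : O.resPair e ≫ (GlobSet.res e).map (pb.snd _ _) = pb.snd _ _ := rfl

theorem resPair_fst_assoc {V : GlobSet.{u} M} (r : (GlobSet.res e).obj ((T N).obj O.C) ⟶ V) :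
    O.resPair e ≫ (GlobSet.res e).map (pb.fst _ _) ≫ r = pb.fst _ _ ≫ up e O.C ≫ r := rfl

/-- Two ways to compute composites in the restricted operad agree. -/
theorem lift_resComp {W : GlobSet.{u} M} {V : GlobSet.{u} N} (v : W ⟶ (GlobSet.res e).obj V)
    {a : W ⟶ (T M).obj ((GlobSet.res e).obj O.C)} {b : W ⟶ (GlobSet.res e).obj O.C}
    (w : a ≫ (T M).map (toPt ((GlobSet.res e).obj O.C)) = b ≫ O.resD e)
    {a' : V ⟶ (T N).obj O.C} {b' : V ⟶ O.C} (w' : a' ≫ (T N).map (toPt O.C) = b' ≫ O.d)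
    (h₁ : a ≫ up e O.C = v ≫ (GlobSet.res e).map a') (h₂ : b = v ≫ (GlobSet.res e).map b') :
    pb.lift a b w ≫ O.resComp e = v ≫ (GlobSet.res e).map (pb.lift a' b' w' ≫ O.comp) := by
  have : pb.lift a b w ≫ O.resPair e = v ≫ (GlobSet.res e).map (pb.lift a' b' w') := by
    subst h₂
    refine GlobSet.hom_ext fun k h x => Subtype.ext (Prod.ext ?_ rfl)
    exact congrArg (fun r : W ⟶ (GlobSet.res e).obj ((T N).obj O.C) => r.app x) h₁
  rw [resComp, ← Category.assoc, this, Category.assoc, Functor.map_comp]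

/-- The restriction of a `T_N`-operad to a `T_M`-operad, `M ≤ N`. -/
noncomputable def res : Operad.{u} M where
  C := (GlobSet.res e).obj O.C
  d := O.resD e
  ids := (GlobSet.res e).map O.ids
  comp := O.resComp e
  ids_d := by
    rw [resD, ← Category.assoc, ← Functor.map_comp, O.ids_d]
    exact unit_down e (pt N)
  comp_d := by
    change (O.resPair e ≫ (GlobSet.res e).map O.comp) ≫ (GlobSet.res e).map O.d ≫ down e (pt N) =
      pb.fst _ _ ≫ (T M).map ((GlobSet.res e).map O.d ≫ down e (pt N)) ≫ (T M).μ.app _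
    rw [Category.assoc, ← Category.assoc ((GlobSet.res e).map O.comp),
      ← Functor.map_comp, O.comp_d, Functor.map_comp, Functor.map_comp, Functor.map_comp,
      Category.assoc, Category.assoc, Category.assoc, down_mul, resPair_fst_assoc, ← Category.assoc (up e O.C), up_naturality, Category.assoc,
      ← Category.assoc (up e _) (down e _), up_down, Category.id_comp]
  ids_comp w := by
    refine Eq.trans (O.lift_resComp e (V := O.C) (𝟙 _) w (O.w_unit O.C) ?_ ?_) ?_
    · rw [unit_up, Category.id_comp]
    · rfl
    · rw [O.ids_comp]; rfl
  comp_ids w := by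
    refine Eq.trans (O.lift_resComp e (V := O.C) (𝟙 _) w O.w_ids ?_ ?_) ?_
    · rw [Category.id_comp, resD, Category.assoc, Functor.map_comp]
      refine Eq.trans (congrArg (((GlobSet.res e).map O.d ≫ down e (pt N)) ≫ ·)
        (up_naturality e O.ids).symm) ?_
      rw [Category.assoc, ← Category.assoc (down e _), down_up, Category.id_comp]
    · rfl
    · rw [O.comp_ids]; rfl
  assoc w₁ w₂ w₃ := by
    have hv : (pb.fst ((T M).map (toPt (pb ((T M).map (toPt ((GlobSet.res e).obj O.C)))
        (O.resD e)))) (O.resD e) ≫ (T M).map (O.resPair e) ≫ up e _) ≫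
          (GlobSet.res e).map ((T N).map (toPt (pb ((T N).map (toPt O.C)) O.d)))
        = pb.snd _ _ ≫ (GlobSet.res e).map O.d := by
      rw [Category.assoc, Category.assoc, up_naturality, ← Category.assoc ((T M).map _),
        ← Functor.map_comp, ← Category.assoc]
      refine Eq.trans (congrArg (· ≫ up e (pt N)) (pb.condition _ _)) ?_
      rw [resD, Category.assoc, Category.assoc, down_up, Category.comp_id]
    refine Eq.trans (O.lift_resComp e (pb.resLift e _ _ hv) w₁ (O.w_map O.comp) ?_ ?_) ?_
    · rw [Functor.map_comp, pb.resLift_fst_assoc, Category.assoc, Category.assoc, Category.assoc,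
        up_naturality, resComp, Functor.map_comp, Category.assoc]
    · rfl
    · rw [O.assoc _ (O.w_sub _) (O.w_mul _)]
      refine (O.lift_resComp e (pb.resLift e _ _ hv) w₃ (O.w_mul O.C) ?_ ?_).symm
      · rw [Functor.map_comp, Functor.map_comp, pb.resLift_fst_assoc, Category.assoc,
          Category.assoc, Category.assoc, Category.assoc, ← Category.assoc (up e _) ((GlobSet.res e).map ((T N).map _)), up_naturality,
          Category.assoc, ← Category.assoc ((T M).map (O.resPair e)), ← Functor.map_comp,
          resPair_fst, Functor.map_comp, Category.assoc, up_mul]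
      · refine O.lift_resComp e (pb.resLift e _ _ hv) w₂ (O.w_sub O.C) ?_ rfl
        rw [Functor.map_comp, pb.resLift_fst_assoc, Category.assoc, Category.assoc, Category.assoc,
          up_naturality, ← Category.assoc ((T M).map (O.resPair e)), ← Functor.map_comp,
          resPair_snd]

end Res

end Operad

theorem dim_le_succ (n : ℕ) : (n : ℕ∞) ≤ ((n + 1 : ℕ) : ℕ∞) := by exact_mod_cast Nat.le_succ n

theorem dim_zero (N : ℕ∞) : ((0 : ℕ) : ℕ∞) ≤ N := by simp

namespace GlobSet

variable {n : ℕ}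

/-- The cells of the `(n+1)`-globular set `S X` associated to an `n`-globular set `X`: those of
`X`, and in dimension `n + 1` all pairs of parallel `n`-cells of `X`. -/
inductive SCell (X : GlobSet.{u} n) : ℕ → Type u
  | low {k : ℕ} (h : (k : ℕ∞) ≤ n) (x : X.cell k h) : SCell X k
  | pair (x y : X.cell n le_rfl) (w : X.Parallel x y) : SCell X (n + 1)

namespace SCell

variable {X : GlobSet.{u} n}

def src : ∀ {k : ℕ}, SCell X (k + 1) → SCell X k
  | _, low h x => low (dim_pred h) (X.src x)
  | _, pair x _ _ => low le_rfl x

def tgt : ∀ {k : ℕ}, SCell X (k + 1) → SCell X k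
  | _, low h x => low (dim_pred h) (X.tgt x)
  | _, pair _ y _ => low le_rfl y

theorem src_src {k : ℕ} (x : SCell X (k + 2)) : src (src x) = src (tgt x) := by
  cases x with
  | low h x => exact congrArg (low _) (X.src_src x)
  | pair _ _ w => exact congrArg (low _) w.1

theorem tgt_src {k : ℕ} (x : SCell X (k + 2)) : tgt (src x) = tgt (tgt x) := by
  cases x with
  | low h x => exact congrArg (low _) (X.tgt_src x)
  | pair _ _ w => exact congrArg (low _) w.2

theorem not_dim : ¬ ((n + 1 : ℕ) : ℕ∞) ≤ n := by
  intro h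
  have : n + 1 ≤ n := by exact_mod_cast h
  omega

/-- The cell of `X` given by a low-dimensional cell of `S X`. -/
def toCell : ∀ {k : ℕ}, SCell X k → (h : (k : ℕ∞) ≤ n) → X.cell k h
  | _, low _ x, _ => x
  | _, pair _ _ _, h => absurd h not_dim

theorem low_toCell {k : ℕ} (x : SCell X k) (h : (k : ℕ∞) ≤ n) : low h (x.toCell h) = x := by
  cases x with
  | low => rfl
  | pair => exact absurd h not_dim

def mkPair : ∀ {k : ℕ} (_ : k = n) {h : (k : ℕ∞) ≤ n} (x y : X.cell k h), X.Parallel x y →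
    SCell X (k + 1)
  | _, rfl, _, x, y, w => pair x y w

theorem src_mkPair {k : ℕ} (e : k = n) {h : (k : ℕ∞) ≤ n} (x y : X.cell k h) (w) :
    src (mkPair e x y w) = low h x := by
  subst e
  rfl

theorem tgt_mkPair {k : ℕ} (e : k = n) {h : (k : ℕ∞) ≤ n} (x y : X.cell k h) (w) :
    tgt (mkPair e x y w) = low h y := by
  subst e
  rfl

theorem ext_high {k : ℕ} {x y : SCell X (k + 1)} (hk : ¬ ((k + 1 : ℕ) : ℕ∞) ≤ n)
    (h₁ : src x = src y) (h₂ : tgt x = tgt y) : x = y := by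
  cases x with
  | low h => exact absurd h hk
  | pair a b w =>
    cases y with
    | low h => exact absurd h hk
    | pair c d w' =>
      simp only [src, tgt, low.injEq] at h₁ h₂
      subst h₁ h₂
      rfl

theorem eq_of_not {k : ℕ} (h : ((k + 1 : ℕ) : ℕ∞) ≤ (n + 1 : ℕ))
    (h' : ¬ ((k + 1 : ℕ) : ℕ∞) ≤ n) : k = n := by
  have h₁ : k + 1 ≤ n + 1 := by exact_mod_cast h
  have h₂ : ¬ k + 1 ≤ n := by exact_mod_cast h'
  omega

end SCell

theorem parallel_map {N : ℕ∞} {X Y : GlobSet.{u} N} (f : X ⟶ Y) : ∀ {k : ℕ} {h : (k : ℕ∞) ≤ N}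
    {x y : X.cell k h} (_ : X.Parallel x y), Y.Parallel (f.app x) (f.app y)
  | 0, _, _, _, _ => trivial
  | _ + 1, _, _, _, w => ⟨by rw [f.src_app, f.src_app, w.1], by rw [f.tgt_app, f.tgt_app, w.2]⟩

/-- The right adjoint `S` to restriction of globular sets from dimension `n + 1` to `n`. -/
def coskel (X : GlobSet.{u} n) : GlobSet.{u} (n + 1 : ℕ) where
  cell k _ := SCell X k
  src := SCell.src
  tgt := SCell.tgt
  src_src := SCell.src_src
  tgt_src := SCell.tgt_src

namespace coskel

/-- The counit `R S X ⟶ X`. -/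
def counit (X : GlobSet.{u} n) : (res (dim_le_succ n)).obj (coskel X) ⟶ X :=
  Hom.mk (fun {_ h} x => SCell.toCell x h)
    (fun {k h} x => by
      change SCell X (k + 1) at x
      cases x with
      | low => rfl
      | pair => exact absurd h SCell.not_dim)
    (fun {k h} x => by
      change SCell X (k + 1) at x
      cases x with
      | low => rfl
      | pair => exact absurd h SCell.not_dim)

variable {X : GlobSet.{u} n} {Y : GlobSet.{u} (n + 1 : ℕ)}

theorem par_aux (f : (res (dim_le_succ n)).obj Y ⟶ X) : ∀ {k : ℕ} (h₀ : (k : ℕ∞) ≤ n)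
    {h : ((k + 1 : ℕ) : ℕ∞) ≤ (n + 1 : ℕ)} (y : Y.cell (k + 1) h),
    X.Parallel (f.app (h := h₀) (Y.src y)) (f.app (h := h₀) (Y.tgt y))
  | 0, _, _, _ => trivial
  | k + 1, h₀, _, y => by
    refine ⟨(f.src_app (h := h₀) (Y.src y)).trans (Eq.trans ?_ (f.src_app (h := h₀) _).symm),
      (f.tgt_app (h := h₀) (Y.src y)).trans (Eq.trans ?_ (f.tgt_app (h := h₀) _).symm)⟩
    · exact congrArg f.app (Y.src_src y)
    · exact congrArg f.app (Y.tgt_src y)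

open Classical in
/-- The cell of `S X` corresponding to a cell of `Y`, for a map `R Y ⟶ X`. -/
noncomputable def liftFun (f : (res (dim_le_succ n)).obj Y ⟶ X) :
    ∀ {k : ℕ} {h : (k : ℕ∞) ≤ (n + 1 : ℕ)}, Y.cell k h → SCell X k
  | 0, _, y => SCell.low (dim_zero _) (f.app (h := dim_zero _) y)
  | k + 1, h, y =>
    if h' : ((k + 1 : ℕ) : ℕ∞) ≤ n then SCell.low h' (f.app (h := h') y)
    else SCell.mkPair (SCell.eq_of_not h h')
      (f.app (h := by rw [SCell.eq_of_not h h']) (Y.src y)) (f.app (Y.tgt y)) (par_aux f _ y)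

theorem liftFun_low (f : (res (dim_le_succ n)).obj Y ⟶ X) {k : ℕ} {h : (k : ℕ∞) ≤ (n + 1 : ℕ)}
    (y : Y.cell k h) (h' : (k : ℕ∞) ≤ n) : liftFun f y = SCell.low h' (f.app (h := h') y) := by
  cases k with
  | zero => rfl
  | succ k => simp only [liftFun, h', dite_true]

theorem liftFun_src (f : (res (dim_le_succ n)).obj Y ⟶ X) {k : ℕ}
    {h : ((k + 1 : ℕ) : ℕ∞) ≤ (n + 1 : ℕ)} (y : Y.cell (k + 1) h) :
    SCell.src (liftFun f y) = liftFun f (Y.src y) := by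
  by_cases h' : ((k + 1 : ℕ) : ℕ∞) ≤ n
  · rw [liftFun_low f y h', liftFun_low f (Y.src y) (dim_pred h')]
    exact congrArg (SCell.low _) (f.src_app (h := h') y)
  · have e := SCell.eq_of_not h h'
    rw [liftFun_low f (Y.src y) (by rw [e])]
    simp only [liftFun, h', dite_false]
    rw [SCell.src_mkPair]

theorem liftFun_tgt (f : (res (dim_le_succ n)).obj Y ⟶ X) {k : ℕ}
    {h : ((k + 1 : ℕ) : ℕ∞) ≤ (n + 1 : ℕ)} (y : Y.cell (k + 1) h) :
    SCell.tgt (liftFun f y) = liftFun f (Y.tgt y) := by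
  by_cases h' : ((k + 1 : ℕ) : ℕ∞) ≤ n
  · rw [liftFun_low f y h', liftFun_low f (Y.tgt y) (dim_pred h')]
    exact congrArg (SCell.low _) (f.tgt_app (h := h') y)
  · have e := SCell.eq_of_not h h'
    rw [liftFun_low f (Y.tgt y) (by rw [e])]
    simp only [liftFun, h', dite_false]
    rw [SCell.tgt_mkPair]

/-- The map `Y ⟶ S X` corresponding to a map `R Y ⟶ X`. -/
noncomputable def lift (f : (res (dim_le_succ n)).obj Y ⟶ X) : Y ⟶ coskel X :=
  Hom.mk (fun y => liftFun f y) (fun y => liftFun_src f y) (fun y => liftFun_tgt f y)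

theorem lift_counit (f : (res (dim_le_succ n)).obj Y ⟶ X) :
    (res (dim_le_succ n)).map (lift f) ≫ counit X = f := by
  refine GlobSet.hom_ext fun k h y => ?_
  change SCell.toCell (liftFun f _) h = _
  rw [liftFun_low f _ h]
  rfl

theorem hom_ext {a b : Y ⟶ coskel X}
    (w : (res (dim_le_succ n)).map a ≫ counit X = (res (dim_le_succ n)).map b ≫ counit X) :
    a = b := by
  have low : ∀ {k : ℕ} {h : (k : ℕ∞) ≤ (n + 1 : ℕ)} (y : Y.cell k h), (k : ℕ∞) ≤ n →
      a.app y = b.app y := fun {k h} y h' => by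
    have := congrArg (fun r : (res (dim_le_succ n)).obj Y ⟶ X => r.app (h := h') y) w
    change SCell.toCell (a.app y) h' = SCell.toCell (b.app y) h' at this
    exact (SCell.low_toCell (a.app y) h').symm.trans
      ((congrArg (SCell.low h') this).trans (SCell.low_toCell (b.app y) h'))
  refine GlobSet.hom_ext fun k h y => ?_
  by_cases h' : (k : ℕ∞) ≤ n
  · exact low y h'
  · cases k with
    | zero => exact absurd (dim_zero _) h'
    | succ k =>
      have e := SCell.eq_of_not h h'
      refine SCell.ext_high h' ?_ ?_
      · exact (a.src_app y).trans ((low _ (by rw [e])).trans (b.src_app y).symm)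
      · exact (a.tgt_app y).trans ((low _ (by rw [e])).trans (b.tgt_app y).symm)

end coskel

end GlobSet

theorem StrictCat.down_naturality_assoc {N M : ℕ∞} (e : M ≤ N) {X Y : GlobSet.{u} N} (f : X ⟶ Y)
    {Z : GlobSet.{u} M} (r : (T M).obj ((GlobSet.res e).obj Y) ⟶ Z) :
    (GlobSet.res e).map ((T N).map f) ≫ down e Y ≫ r
      = down e X ≫ (T M).map ((GlobSet.res e).map f) ≫ r := by
  rw [← Category.assoc, down_naturality, Category.assoc]

theorem GlobSet.res_comp_assoc {N M : ℕ∞} (e : M ≤ N) {X Y Z : GlobSet.{u} N} (f : X ⟶ Y)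
    (g : Y ⟶ Z) {W : GlobSet.{u} M} (r : (GlobSet.res e).obj Z ⟶ W) :
    (GlobSet.res e).map f ≫ (GlobSet.res e).map g ≫ r = (GlobSet.res e).map (f ≫ g) ≫ r := rfl

namespace Operad

variable {n : ℕ} (D : Operad.{u} n)

/-- The underlying globular set of `S D`: the pullback of `S D ⟶ S T_n 1 ⟵ T_{n+1} 1`. -/
noncomputable abbrev susC : GlobSet.{u} (n + 1 : ℕ) :=
  pb (coskel.lift (coskel.counit D.C ≫ D.d)) (coskel.lift (down (dim_le_succ n) (pt (n + 1 : ℕ))))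

noncomputable abbrev susD : D.susC ⟶ (T (n + 1 : ℕ)).obj (pt (n + 1 : ℕ)) := pb.snd _ _

/-- The canonical map `R S D ⟶ D`. -/
noncomputable def susCounit : (GlobSet.res (dim_le_succ n)).obj D.susC ⟶ D.C :=
  (GlobSet.res (dim_le_succ n)).map (pb.fst _ _) ≫ coskel.counit D.C

theorem susCounit_d : D.susCounit ≫ D.d =
    (GlobSet.res (dim_le_succ n)).map D.susD ≫ down (dim_le_succ n) (pt (n + 1 : ℕ)) := by
  rw [susCounit, Category.assoc]
  refine Eq.trans (congrArg ((GlobSet.res (dim_le_succ n)).map (pb.fst _ _) ≫ ·)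
    (coskel.lift_counit (coskel.counit D.C ≫ D.d)).symm) ?_
  rw [res_comp_assoc, pb.condition, ← res_comp_assoc, coskel.lift_counit]

variable {D}

theorem sus_w {Y : GlobSet.{u} (n + 1 : ℕ)} (a : Y ⟶ (T (n + 1 : ℕ)).obj (pt (n + 1 : ℕ)))
    (b : (GlobSet.res (dim_le_succ n)).obj Y ⟶ D.C)
    (w : b ≫ D.d = (GlobSet.res (dim_le_succ n)).map a ≫ down (dim_le_succ n) (pt (n + 1 : ℕ))) :
    coskel.lift b ≫ coskel.lift (coskel.counit D.C ≫ D.d)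
      = a ≫ coskel.lift (down (dim_le_succ n) (pt (n + 1 : ℕ))) := by
  apply coskel.hom_ext
  rw [Functor.map_comp, Functor.map_comp, Category.assoc, Category.assoc, coskel.lift_counit,
    coskel.lift_counit, ← Category.assoc, coskel.lift_counit, w]

/-- Maps into `S D`. -/
noncomputable def susLift {Y : GlobSet.{u} (n + 1 : ℕ)}
    (a : Y ⟶ (T (n + 1 : ℕ)).obj (pt (n + 1 : ℕ)))
    (b : (GlobSet.res (dim_le_succ n)).obj Y ⟶ D.C)
    (w : b ≫ D.d = (GlobSet.res (dim_le_succ n)).map a ≫ down (dim_le_succ n) (pt (n + 1 : ℕ))) :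
    Y ⟶ D.susC := pb.lift (coskel.lift b) a (sus_w a b w)

theorem susLift_d {Y : GlobSet.{u} (n + 1 : ℕ)}
    (a : Y ⟶ (T (n + 1 : ℕ)).obj (pt (n + 1 : ℕ)))
    (b : (GlobSet.res (dim_le_succ n)).obj Y ⟶ D.C) (w) : susLift a b w ≫ D.susD = a := rfl

theorem susLift_counit {Y : GlobSet.{u} (n + 1 : ℕ)}
    (a : Y ⟶ (T (n + 1 : ℕ)).obj (pt (n + 1 : ℕ)))
    (b : (GlobSet.res (dim_le_succ n)).obj Y ⟶ D.C) (w) :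
    (GlobSet.res (dim_le_succ n)).map (susLift a b w) ≫ D.susCounit = b :=
  coskel.lift_counit b

theorem sus_ext {Y : GlobSet.{u} (n + 1 : ℕ)} {a b : Y ⟶ D.susC} (h₁ : a ≫ D.susD = b ≫ D.susD)
    (h₂ : (GlobSet.res (dim_le_succ n)).map a ≫ D.susCounit =
      (GlobSet.res (dim_le_succ n)).map b ≫ D.susCounit) : a = b := by
  refine pb.hom_ext (coskel.hom_ext ?_) h₁
  rw [Functor.map_comp, Functor.map_comp, Category.assoc, Category.assoc]
  exact h₂

variable (D)

theorem sus_w_pair {Y : GlobSet.{u} (n + 1 : ℕ)} {a : Y ⟶ (T (n + 1 : ℕ)).obj D.susC}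
    {b : Y ⟶ D.susC} (w : a ≫ (T (n + 1 : ℕ)).map (toPt D.susC) = b ≫ D.susD) :
    ((GlobSet.res (dim_le_succ n)).map a ≫ down (dim_le_succ n) D.susC ≫ (T n).map D.susCounit) ≫
      (T n).map (toPt D.C) = ((GlobSet.res (dim_le_succ n)).map b ≫ D.susCounit) ≫ D.d := by
  rw [Category.assoc, Category.assoc, ← Functor.map_comp, Category.assoc, susCounit_d,
    res_comp_assoc, ← w, ← res_comp_assoc, down_naturality]
  rfl

/-- The canonical map `R (S D ∘ S D) ⟶ D ∘ D`. -/
noncomputable def susPair : (GlobSet.res (dim_le_succ n)).obj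
      (pb ((T (n + 1 : ℕ)).map (toPt D.susC)) D.susD) ⟶ pb ((T n).map (toPt D.C)) D.d :=
  pb.lift _ _ (D.sus_w_pair (pb.condition _ _))

theorem susPair_fst : D.susPair ≫ pb.fst _ _ = (GlobSet.res (dim_le_succ n)).map (pb.fst _ _) ≫
    down (dim_le_succ n) D.susC ≫ (T n).map D.susCounit := rfl

theorem susPair_snd : D.susPair ≫ pb.snd _ _ =
    (GlobSet.res (dim_le_succ n)).map (pb.snd _ _) ≫ D.susCounit := rfl

theorem susComp_w : (D.susPair ≫ D.comp) ≫ D.d = (GlobSet.res (dim_le_succ n)).map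
    (pb.fst _ _ ≫ (T (n + 1 : ℕ)).map D.susD ≫ (T (n + 1 : ℕ)).μ.app _) ≫
      down (dim_le_succ n) (pt (n + 1 : ℕ)) := by
  rw [Category.assoc, D.comp_d, ← Category.assoc, susPair_fst, Functor.map_comp,
    Functor.map_comp, Category.assoc, Category.assoc, Category.assoc, Category.assoc, down_mul,
    down_naturality_assoc, ← Category.assoc ((T n).map D.susCounit), ← Functor.map_comp, susCounit_d, Functor.map_comp,
    Category.assoc]

noncomputable def susComp : pb ((T (n + 1 : ℕ)).map (toPt D.susC)) D.susD ⟶ D.susC :=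
  susLift (pb.fst _ _ ≫ (T (n + 1 : ℕ)).map D.susD ≫ (T (n + 1 : ℕ)).μ.app _)
    (D.susPair ≫ D.comp) D.susComp_w

noncomputable def susIds : pt (n + 1 : ℕ) ⟶ D.susC :=
  susLift ((T (n + 1 : ℕ)).η.app (pt (n + 1 : ℕ))) D.ids
    (D.ids_d.trans (unit_down (dim_le_succ n) (pt (n + 1 : ℕ))).symm)

theorem susComp_d : D.susComp ≫ D.susD =
    pb.fst _ _ ≫ (T (n + 1 : ℕ)).map D.susD ≫ (T (n + 1 : ℕ)).μ.app _ := rfl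

theorem susComp_counit : (GlobSet.res (dim_le_succ n)).map D.susComp ≫ D.susCounit =
    D.susPair ≫ D.comp := susLift_counit _ _ _

theorem susIds_d : D.susIds ≫ D.susD = (T (n + 1 : ℕ)).η.app (pt (n + 1 : ℕ)) := rfl

theorem susIds_counit : (GlobSet.res (dim_le_succ n)).map D.susIds ≫ D.susCounit = D.ids :=
  susLift_counit _ _ _

theorem lift_susComp_d {Y : GlobSet.{u} (n + 1 : ℕ)} {a : Y ⟶ (T (n + 1 : ℕ)).obj D.susC}
    {b : Y ⟶ D.susC} (w : a ≫ (T (n + 1 : ℕ)).map (toPt D.susC) = b ≫ D.susD) :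
    (pb.lift a b w ≫ D.susComp) ≫ D.susD =
      a ≫ (T (n + 1 : ℕ)).map D.susD ≫ (T (n + 1 : ℕ)).μ.app _ := rfl

theorem lift_susComp_counit {Y : GlobSet.{u} (n + 1 : ℕ)} {a : Y ⟶ (T (n + 1 : ℕ)).obj D.susC}
    {b : Y ⟶ D.susC} (w : a ≫ (T (n + 1 : ℕ)).map (toPt D.susC) = b ≫ D.susD) :
    (GlobSet.res (dim_le_succ n)).map (pb.lift a b w ≫ D.susComp) ≫ D.susCounit =
      pb.lift _ _ (D.sus_w_pair w) ≫ D.comp := by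
  rw [Functor.map_comp, Category.assoc, susComp_counit]
  rfl

/-- The `T_{n+1}`-operad `S D` associated to a `T_n`-operad `D`.  For a `k`-dimensional pasting
diagram `π`, its operations of shape `π` are those of `D` if `k ≤ n`; if `k = n + 1`, they are the
pairs of parallel operations of `D` whose shapes are the source and the target of `π`. -/
noncomputable def sus : Operad.{u} (n + 1 : ℕ) where
  C := D.susC
  d := D.susD
  ids := D.susIds
  comp := D.susComp
  ids_d := D.susIds_d
  comp_d := D.susComp_d
  ids_comp w := by
    apply sus_ext
    · rw [lift_susComp_d, ← Category.assoc, ← unit_nat, Category.assoc, (T _).left_unit]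
      rfl
    · rw [lift_susComp_counit]
      have k := congrArg (fun r => D.susCounit ≫ r) (D.ids_comp (D.w_unit _))
      refine Eq.trans (Eq.trans ?_ (D.pre_comp D.susCounit (D.w_unit _)).symm) k
      refine D.comp_congr ?_ ?_ _ _
      · rw [← Category.assoc, unit_down, unit_nat]
      · rw [Functor.map_comp, Category.assoc, susIds_counit]
        rfl
  comp_ids w := by
    apply sus_ext
    · rw [lift_susComp_d, Category.assoc, ← Category.assoc ((T _).map _), ← Functor.map_comp,
        susIds_d, (T _).right_unit]
      rfl
    · rw [lift_susComp_counit]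
      have k := congrArg (fun r => D.susCounit ≫ r) (D.comp_ids D.w_ids)
      refine Eq.trans (Eq.trans ?_ (D.pre_comp D.susCounit D.w_ids).symm) k
      refine D.comp_congr ?_ rfl _ _
      rw [Functor.map_comp, Category.assoc, down_naturality_assoc, ← Functor.map_comp, susIds_counit, ← Category.assoc, ← Category.assoc,
        susCounit_d]
  assoc w₁ w₂ w₃ := by
    apply sus_ext
    · rw [lift_susComp_d, lift_susComp_d, Category.assoc, Category.assoc, Category.assoc,
        ← Category.assoc ((T _).μ.app _), ← mul_nat, Category.assoc, ← (T _).assoc,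
        ← Category.assoc ((T _).map D.susComp), ← Functor.map_comp, susComp_d,
        Functor.map_comp, Functor.map_comp, Category.assoc, Category.assoc]
    · rw [lift_susComp_counit, lift_susComp_counit]
      have hv : ((GlobSet.res (dim_le_succ n)).map
          (pb.fst ((T (n + 1 : ℕ)).map (toPt (pb ((T (n + 1 : ℕ)).map (toPt D.susC)) D.susD)))
            D.susD) ≫ down _ _ ≫ (T n).map D.susPair) ≫
            (T n).map (toPt (pb ((T n).map (toPt D.C)) D.d)) =
          ((GlobSet.res (dim_le_succ n)).map (pb.snd _ _) ≫ D.susCounit) ≫ D.d := by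
        rw [Category.assoc, Category.assoc, ← Functor.map_comp, Category.assoc, susCounit_d,
          res_comp_assoc, ← pb.condition, ← res_comp_assoc, down_naturality]
        rfl
      have k := congrArg (fun r => pb.lift _ _ hv ≫ r)
        (D.assoc (D.w_map _) (D.w_sub _) (D.w_mul _))
      refine Eq.trans (Eq.trans ?_ (D.pre_comp (pb.lift _ _ hv) (D.w_map _)).symm)
        (k.trans (Eq.trans (D.pre_comp (pb.lift _ _ hv) (D.w_mul _)) ?_))
      · refine D.comp_congr ?_ rfl _ _
        rw [pb.lift_fst_assoc, Functor.map_comp, Category.assoc, Category.assoc, Category.assoc,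
          ← Functor.map_comp, ← susComp_counit, down_naturality_assoc, ← Functor.map_comp]
      · refine D.comp_congr ?_ ?_ _ _
        · rw [pb.lift_fst_assoc, Functor.map_comp, Functor.map_comp, Category.assoc,
            Category.assoc, Category.assoc, Category.assoc,
            ← Category.assoc ((GlobSet.res _).map ((T _).μ.app _)), down_mul,
            ← Category.assoc ((T n).map D.susPair), ← Functor.map_comp, susPair_fst,
            Category.assoc, Category.assoc, ← mul_nat,
            down_naturality_assoc, Functor.map_comp, Functor.map_comp, Category.assoc, Category.assoc]
        · rw [lift_susComp_counit]
          refine Eq.trans (D.pre_comp (pb.lift _ _ hv) (D.w_sub _)) ?_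
          refine D.comp_congr ?_ rfl _ _
          rw [pb.lift_fst_assoc, Functor.map_comp, Category.assoc, Category.assoc, Category.assoc,
            ← Functor.map_comp, susPair_snd, down_naturality_assoc, ← Functor.map_comp]

end Operad

theorem GlobSet.parallel_res {N M : ℕ∞} (e : M ≤ N) {X : GlobSet.{u} N} :
    ∀ {k : ℕ} {h : (k : ℕ∞) ≤ M} {x y : X.cell k (h.trans e)},
    ((GlobSet.res e).obj X).Parallel (h := h) x y → X.Parallel x y
  | 0, _, _, _, _ => trivial
  | _ + 1, _, _, _, w => w

/-- A `T_N`-operad with a precontraction: for every pasting diagram `π` of dimension `k + 1 ≤ N`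
and all parallel operations `θ₀, θ₁` whose shapes are the source and the target of `π`, an
operation `κ_π(θ₀, θ₁)` of shape `π` with source `θ₀` and target `θ₁`.  For `N = ∞`, this is an
operad with a contraction. -/
structure OWP (N : ℕ∞) extends Operad.{u} N where
  κ : ∀ {k : ℕ} {h : ((k + 1 : ℕ) : ℕ∞) ≤ N} (π : ((T.{u} N).obj (pt N)).cell (k + 1) h)
    (θ₀ θ₁ : C.cell k (dim_pred h)), d.app θ₀ = ((T N).obj (pt N)).src π →
    d.app θ₁ = ((T N).obj (pt N)).tgt π → C.Parallel θ₀ θ₁ → C.cell (k + 1) h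
  d_κ : ∀ {k : ℕ} {h : ((k + 1 : ℕ) : ℕ∞) ≤ N} (π : ((T.{u} N).obj (pt N)).cell (k + 1) h)
    (θ₀ θ₁ : C.cell k (dim_pred h)) (w₀ w₁ w), d.app (κ π θ₀ θ₁ w₀ w₁ w) = π
  src_κ : ∀ {k : ℕ} {h : ((k + 1 : ℕ) : ℕ∞) ≤ N} (π : ((T.{u} N).obj (pt N)).cell (k + 1) h)
    (θ₀ θ₁ : C.cell k (dim_pred h)) (w₀ w₁ w), C.src (κ π θ₀ θ₁ w₀ w₁ w) = θ₀
  tgt_κ : ∀ {k : ℕ} {h : ((k + 1 : ℕ) : ℕ∞) ≤ N} (π : ((T.{u} N).obj (pt N)).cell (k + 1) h)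
    (θ₀ θ₁ : C.cell k (dim_pred h)) (w₀ w₁ w), C.tgt (κ π θ₀ θ₁ w₀ w₁ w) = θ₁

namespace OWP

variable {N M : ℕ∞}

/-- Maps of operads preserving the precontractions. -/
@[ext]
structure Hom (P Q : OWP.{u} N) where
  hom : P.toOperad ⟶ Q.toOperad
  map_κ : ∀ {k : ℕ} {h : ((k + 1 : ℕ) : ℕ∞) ≤ N} (π : ((T.{u} N).obj (pt N)).cell (k + 1) h)
    (θ₀ θ₁ : P.C.cell k (dim_pred h)) (w₀ w₁ w w₀' w₁' w'),
    hom.map.app (P.κ π θ₀ θ₁ w₀ w₁ w) = Q.κ π (hom.map.app θ₀) (hom.map.app θ₁) w₀' w₁' w'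

instance : Category (OWP.{u} N) where
  Hom := Hom
  id P := ⟨𝟙 _, fun _ _ _ _ _ _ _ _ _ => rfl⟩
  comp {P Q S} f g := ⟨f.hom ≫ g.hom, fun π θ₀ θ₁ w₀ w₁ w w₀' w₁' w' => by
    change g.hom.map.app (f.hom.map.app _) = _
    rw [f.map_κ π θ₀ θ₁ w₀ w₁ w
      ((congrArg (fun r : P.C ⟶ (T N).obj (pt N) => r.app θ₀) f.hom.map_d).trans w₀)
      ((congrArg (fun r : P.C ⟶ (T N).obj (pt N) => r.app θ₁) f.hom.map_d).trans w₁)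
      (parallel_map f.hom.map w), g.map_κ]
    rfl⟩

set_option linter.unusedVariables false in
/-- Restriction of operads with precontraction from dimension `N` to dimension `M ≤ N`. -/
noncomputable def res (e : M ≤ N) (P : OWP.{u} N) : OWP.{u} M :=
  have key : ∀ {k : ℕ} {h : (k : ℕ∞) ≤ M} {θ : P.C.cell k (h.trans e)}
      {ρ : ((T.{u} M).obj (pt M)).cell k h},
      (P.resD e).app (h := h) θ = ρ → P.d.app θ = (up e (pt N)).app ρ := fun {k h θ ρ} w =>
    (congrArg (fun r : (GlobSet.res e).obj ((T N).obj (pt N)) ⟶ _ => r.app (h := h) (P.d.app θ))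
      (down_up e (pt N))).symm.trans (congrArg (fun z => (up e (pt N)).app z) w)
  { toOperad := P.toOperad.res e
    κ := fun {k h} π θ₀ θ₁ w₀ w₁ w => P.κ (h := h.trans e) ((up e (pt N)).app (h := h) π) θ₀ θ₁
      ((key (h := dim_pred h) w₀).trans ((up e (pt N)).src_app (h := h) π).symm)
      ((key (h := dim_pred h) w₁).trans ((up e (pt N)).tgt_app (h := h) π).symm)
      (parallel_res e (h := dim_pred h) w)
    d_κ := fun {k h} π θ₀ θ₁ w₀ w₁ w =>
      (congrArg (fun z => (down e (pt N)).app (h := h) z) (P.d_κ _ _ _ _ _ _)).trans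
        (congrArg (fun r : (T M).obj (pt M) ⟶ (T M).obj (pt M) => r.app (h := h) π)
          (up_down e (pt N)))
    src_κ := fun π θ₀ θ₁ w₀ w₁ w => P.src_κ _ _ _ _ _ _
    tgt_κ := fun π θ₀ θ₁ w₀ w₁ w => P.tgt_κ _ _ _ _ _ _ }

end OWP

namespace OWP

variable {n : ℕ} (D : OWP.{u} n)

theorem sus_key {k : ℕ} {h : (k : ℕ∞) ≤ (n + 1 : ℕ)} (h₀ : (k : ℕ∞) ≤ n)
    {θ : D.susC.cell k h} {ρ : ((T.{u} (n + 1 : ℕ)).obj (pt (n + 1 : ℕ))).cell k h}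
    (w : D.susD.app θ = ρ) :
    D.d.app (D.susCounit.app (h := h₀) θ) = (down (dim_le_succ n) (pt (n + 1 : ℕ))).app (h := h₀) ρ :=
  (congrArg (fun r : (GlobSet.res (dim_le_succ n)).obj D.susC ⟶ (T n).obj (pt n) =>
    r.app (h := h₀) θ) D.susCounit_d).trans (congrArg (fun z =>
      (down (dim_le_succ n) (pt (n + 1 : ℕ))).app (h := h₀) z) w)

theorem sus_parallel {k : ℕ} {h : (k : ℕ∞) ≤ (n + 1 : ℕ)} (h₀ : (k : ℕ∞) ≤ n)
    {θ₀ θ₁ : D.susC.cell k h} (w : D.susC.Parallel θ₀ θ₁) :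
    D.C.Parallel (D.susCounit.app (h := h₀) θ₀) (D.susCounit.app (h := h₀) θ₁) :=
  parallel_map D.susCounit (h := h₀) (by
    cases k with
    | zero => trivial
    | succ k => exact w)

theorem low_susCounit {k : ℕ} {h : (k : ℕ∞) ≤ (n + 1 : ℕ)} (h₀ : (k : ℕ∞) ≤ n)
    (θ : D.susC.cell k h) : SCell.low h₀ (D.susCounit.app (h := h₀) θ) = θ.1.1 :=
  SCell.low_toCell θ.1.1 h₀

theorem dim_pred_succ {k : ℕ} (h : ((k + 1 : ℕ) : ℕ∞) ≤ (n + 1 : ℕ)) : (k : ℕ∞) ≤ n := by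
  have : k + 1 ≤ n + 1 := by exact_mod_cast h
  exact_mod_cast Nat.le_of_succ_le_succ this

open Classical in
/-- The cell of `S D` underlying the value of the precontraction on `S D`: given by that of `D` in
dimensions at most `n`, and the pair `(θ₀, θ₁)` in dimension `n + 1`. -/
noncomputable def susκ {k : ℕ} {h : ((k + 1 : ℕ) : ℕ∞) ≤ (n + 1 : ℕ)}
    (π : ((T.{u} (n + 1 : ℕ)).obj (pt (n + 1 : ℕ))).cell (k + 1) h)
    (θ₀ θ₁ : D.susC.cell k (dim_pred h)) (w₀ : D.susD.app θ₀ = ((T _).obj (pt _)).src π)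
    (w₁ : D.susD.app θ₁ = ((T _).obj (pt _)).tgt π) (w : D.susC.Parallel θ₀ θ₁) :
    SCell D.C (k + 1) :=
  if h' : ((k + 1 : ℕ) : ℕ∞) ≤ n then
    SCell.low h' (D.κ (h := h') ((down (dim_le_succ n) (pt (n + 1 : ℕ))).app (h := h') π)
      (D.susCounit.app (h := dim_pred h') θ₀) (D.susCounit.app (h := dim_pred h') θ₁)
      ((D.sus_key _ w₀).trans ((down (dim_le_succ n) (pt (n + 1 : ℕ))).src_app (h := h') π).symm)
      ((D.sus_key _ w₁).trans ((down (dim_le_succ n) (pt (n + 1 : ℕ))).tgt_app (h := h') π).symm)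
      (D.sus_parallel _ w))
  else SCell.mkPair (SCell.eq_of_not h h') (D.susCounit.app (h := dim_pred_succ h) θ₀)
    (D.susCounit.app (h := dim_pred_succ h) θ₁) (D.sus_parallel _ w)

section

variable {k : ℕ} {h : ((k + 1 : ℕ) : ℕ∞) ≤ (n + 1 : ℕ)}
    (π : ((T.{u} (n + 1 : ℕ)).obj (pt (n + 1 : ℕ))).cell (k + 1) h)
    (θ₀ θ₁ : D.susC.cell k (dim_pred h)) (w₀ : D.susD.app θ₀ = ((T _).obj (pt _)).src π)
    (w₁ : D.susD.app θ₁ = ((T _).obj (pt _)).tgt π) (w : D.susC.Parallel θ₀ θ₁)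

theorem src_susκ : SCell.src (D.susκ π θ₀ θ₁ w₀ w₁ w) = θ₀.1.1 := by
  rw [susκ]
  split_ifs with h'
  · exact (congrArg (SCell.low _) (D.src_κ _ _ _ _ _ _)).trans (D.low_susCounit _ θ₀)
  · exact (SCell.src_mkPair _ _ _ _).trans (D.low_susCounit _ θ₀)

theorem tgt_susκ : SCell.tgt (D.susκ π θ₀ θ₁ w₀ w₁ w) = θ₁.1.1 := by
  rw [susκ]
  split_ifs with h'
  · exact (congrArg (SCell.low _) (D.tgt_κ _ _ _ _ _ _)).trans (D.low_susCounit _ θ₁)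
  · exact (SCell.tgt_mkPair _ _ _ _).trans (D.low_susCounit _ θ₁)

theorem susκ_condition :
    (coskel.lift (coskel.counit D.C ≫ D.d)).app (h := h) (D.susκ π θ₀ θ₁ w₀ w₁ w) =
      (coskel.lift (down (dim_le_succ n) (pt (n + 1 : ℕ)))).app π := by
  by_cases h' : ((k + 1 : ℕ) : ℕ∞) ≤ n
  · refine (coskel.liftFun_low _ (Y := coskel D.C) _ h').trans
      (Eq.trans ?_ (coskel.liftFun_low _ _ h').symm)
    refine congrArg (SCell.low h') ?_
    simp only [susκ, h', dite_true]
    exact D.d_κ _ _ _ _ _ _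
  · refine SCell.ext_high h' ?_ ?_
    · refine ((coskel.lift (coskel.counit D.C ≫ D.d)).src_app (h := h) _).trans
        (Eq.trans ?_ ((coskel.lift _).src_app π).symm)
      refine (congrArg (coskel.lift (coskel.counit D.C ≫ D.d)).app
        (D.src_susκ π θ₀ θ₁ w₀ w₁ w)).trans (θ₀.2.trans ?_)
      exact congrArg (coskel.lift _).app w₀
    · refine ((coskel.lift (coskel.counit D.C ≫ D.d)).tgt_app (h := h) _).trans
        (Eq.trans ?_ ((coskel.lift _).tgt_app π).symm)
      refine (congrArg (coskel.lift (coskel.counit D.C ≫ D.d)).app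
        (D.tgt_susκ π θ₀ θ₁ w₀ w₁ w)).trans (θ₁.2.trans ?_)
      exact congrArg (coskel.lift _).app w₁

end

/-- The operad `S D` with the precontraction extending that of `D`. -/
noncomputable def sus : OWP.{u} (n + 1 : ℕ) where
  toOperad := D.toOperad.sus
  κ π θ₀ θ₁ w₀ w₁ w := ⟨(D.susκ π θ₀ θ₁ w₀ w₁ w, π), D.susκ_condition π θ₀ θ₁ w₀ w₁ w⟩
  d_κ _ _ _ _ _ _ := rfl
  src_κ π θ₀ θ₁ w₀ w₁ w := Subtype.ext (Prod.ext (D.src_susκ π θ₀ θ₁ w₀ w₁ w) w₀.symm)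
  tgt_κ π θ₀ θ₁ w₀ w₁ w := Subtype.ext (Prod.ext (D.tgt_susκ π θ₀ θ₁ w₀ w₁ w) w₁.symm)

/-- A precontraction on a `T_n`-operad is a contraction if any two `n`-dimensional operations of
the same shape, with the same source and the same target, are equal; for `n = 0` there is no
condition. -/
def IsContraction : (n : ℕ) → OWP.{u} n → Prop
  | 0, _ => True
  | n + 1, P => ∀ θ₀ θ₁ : P.C.cell (n + 1) le_rfl, P.d.app θ₀ = P.d.app θ₁ →
      P.C.src θ₀ = P.C.src θ₁ → P.C.tgt θ₀ = P.C.tgt θ₁ → θ₀ = θ₁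

theorem sus_isContraction : IsContraction (n + 1) D.sus := fun θ₀ θ₁ hd hs ht => by
  refine Subtype.ext (Prod.ext (SCell.ext_high SCell.not_dim ?_ ?_) hd)
  · exact congrArg (fun z : D.susC.cell n (dim_pred le_rfl) => z.1.1) hs
  · exact congrArg (fun z : D.susC.cell n (dim_pred le_rfl) => z.1.1) ht

end OWP

/-- The category of `T`-operads with a contraction, `T` the free strict `ω`-category monad. -/
abbrev OWC := OWP.{u} ⊤

/-- The category of `T_n`-operads with a contraction. -/
abbrev OWCn (n : ℕ) := ObjectProperty.FullSubcategory (OWP.IsContraction.{u} n)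

/-- The object `S D` of `OWC_{n+1}`, for `D` in `OWP_n`. -/
noncomputable def OWCn.sus {n : ℕ} (D : OWP.{u} n) : OWCn.{u} (n + 1) := ⟨D.sus, D.sus_isContraction⟩

/-- The category of algebras for a `T_N`-operad. -/
abbrev Operad.Alg {N : ℕ∞} (O : Operad.{u} N) := O.monad.Algebra

/-- A globular set is `n`-dimensional if, for all `m ≥ n`, the source and target maps from
`(m+1)`-cells to `m`-cells are equal and bijective. -/
def GlobSet.IsDim (n : ℕ) (X : GlobSet.{u} ⊤) : Prop :=
  ∀ m : ℕ, n ≤ m → (∀ x : X.cell (m + 1) le_top, X.src x = X.tgt x) ∧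
    Function.Bijective (fun x : X.cell (m + 1) le_top => X.src x)

/-- The full subcategory of the algebras for an operad on the `n`-dimensional ones. For the initial
operad with contraction, these are the weak `n`-categories. -/
abbrev WkCat (n : ℕ) (O : Operad.{u} ⊤) :=
  ObjectProperty.FullSubcategory (fun A : O.Alg => A.A.IsDim n)

end Operads

/-! Three constructions carry the proof.

Initial objects. The operads with precontraction are the models of an essentially algebraic theory,
so an initial one exists. It is built here from generic operations: families choosing one operation
in every `P`, such that a single raw term names all members of the family. There is only a set of
raw terms, so there is only a set of such families. All structure is computed componentwise, and
evaluation at `P` is the unique map to `P` because operad maps preserve the values of raw terms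
(`Generic.isInitial`).

Cofree operads. Restriction to dimension `n` has a right adjoint, the coskeleton, which adds nothing
but pairs of parallel operations above dimension `n`. Hence restriction preserves initial objects
(`ResHom.unique_of_isInitial`). The operad `S D` is cofree on `D` in the same sense, one dimension
up, and an operad with contraction in dimension `m + 1` is cofree on its own restriction
(`unit_isCofree`). So maps from `S R L` to such an operad `P` are the maps from `R L` to `R P`, of
which there is exactly one. This is `OWCn.isInitial_sus`.

The equivalence. The resulting map `r` from the restriction of `L` to `L_n` is surjective, injective
below dimension `n`, and its target has at most one `n`-dimensional operation with given shape and
boundary (`ResHom.IsQuotient`). Let `Z` be an `n`-dimensional globular set. If two `n`-dimensional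
operations `θ, θ'` of `L` have the same image under `r`, the contraction of `L` contains an
operation from `θ` to `θ'` whose shape is the identity on their common shape. In an `L`-algebra on
`Z` this operation, applied to an identity, gives an `(n+1)`-cell from the value of `θ` to the value
of `θ'`; cells of that dimension have equal source and target, so the two values agree
(`app_congr`). Thus the action of `L` in dimensions up to `n` factors through `L_n`. Conversely an
action of `L_n` on the restriction of `Z` extends uniquely to an action of `L` on `Z`, since source
and target of an `(n+1)`-cell of `T_L Z` have the same image in `T_{L_n} R Z` (`act_src_eq_tgt`).
Restriction identifies `n`-dimensional globular sets with `n`-globular sets, and a formal argument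
about monads (`MonadComparison`) turns these facts into an equivalence of categories of algebras. -/

open GlobSet StrictCat Tm

/-! ### Free strict categories: functoriality on cells and induction. -/

section FreeMap

variable {N : ℕ∞} {X Y : GlobSet.{u} N}

theorem T_map_fone (f : X ⟶ Y) {k : ℕ} {h : ((k + 1 : ℕ) : ℕ∞) ≤ N}
    (x : ((T N).obj X).cell k (dim_pred h)) :
    ((T N).map f).app (fone (X := X) (h := h) x) = fone (X := Y) (((T N).map f).app x) :=
  ((freeFunctor N).map f).map_one x

theorem T_map_fcomp (f : X ⟶ Y) {p k : ℕ} {h : (k : ℕ∞) ≤ N} (x y : ((T N).obj X).cell k h)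
    (w : ((T N).obj X).Composable p x y) :
    ((T N).map f).app (fcomp (X := X) p x y w) =
      fcomp (X := Y) p (((T N).map f).app x) (((T N).map f).app y)
        (composable_map ((T N).map f) w) :=
  ((freeFunctor N).map f).map_comp x y w (composable_map ((T N).map f) w)

theorem T_map_unit (f : X ⟶ Y) {k : ℕ} {h : (k : ℕ∞) ≤ N} (x : X.cell k h) :
    ((T N).map f).app (((T N).η.app X).app x) = ((T N).η.app Y).app (f.app x) :=
  congrArg (fun r : X ⟶ (T N).obj Y => r.app x) (Operad.unit_nat f).symm

/-- Induction on the cells of the free strict category. -/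
theorem T_induction {motive : ∀ {k : ℕ} {h : (k : ℕ∞) ≤ N}, ((T N).obj X).cell k h → Prop}
    (of : ∀ {k : ℕ} {h : (k : ℕ∞) ≤ N} (x : X.cell k h), motive (((T N).η.app X).app x))
    (one : ∀ {k : ℕ} {h : ((k + 1 : ℕ) : ℕ∞) ≤ N} (x : ((T N).obj X).cell k (dim_pred h)),
      motive x → motive (fone (X := X) (h := h) x))
    (comp : ∀ {p k : ℕ} {h : (k : ℕ∞) ≤ N} (x y : ((T N).obj X).cell k h)
      (w : ((T N).obj X).Composable p x y), motive x → motive y →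
        motive (fcomp (X := X) p x y w))
    {k : ℕ} {h : (k : ℕ∞) ≤ N} (x : ((T N).obj X).cell k h) : motive x := by
  -- Cells are classes of well-formed terms, so the induction runs over representatives; the bound
  -- and the well-formedness are generalised because subterms need their own.
  suffices H : ∀ {k : ℕ} (a : Tm X k) (h : (k : ℕ∞) ≤ N) (ha : Ok a),
      motive (h := h) (cls (h := h) a ha) by
    obtain ⟨a, ha, rfl⟩ := mk_surj (X := X) x
    exact H a h ha
  intro k a
  induction a with
  | of h' x => exact fun h ha => of x
  | one a ih =>
    intro h ha
    exact (congrArg (motive (h := h)) (fone_mk (h := h) (a := a) ha)).mp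
      (one (h := h) _ (ih (dim_pred h) ha))
  | comp p a b iha ihb =>
    intro h ha
    have w : (freeGlob X).Composable p (cls (h := h) a ha.1) (cls b ha.2.1) :=
      composable_mk.2 ha.2.2
    exact (congrArg (motive (h := h)) (fcomp_mk w)).mp
      (comp _ _ w (iha h ha.1) (ihb h ha.2.1))

end FreeMap

/-! ### The terminal operad with precontraction. -/

namespace OWP

variable {N : ℕ∞}

/-- The terminal operad with precontraction, whose operations are the pasting diagrams. -/
noncomputable def terminal (N : ℕ∞) : OWP.{u} N where
  C := (T N).obj (pt N)
  d := 𝟙 _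
  ids := (T N).η.app (pt N)
  comp := pb.fst _ _ ≫ (T N).μ.app (pt N)
  ids_d := Category.comp_id _
  comp_d := by rw [Category.comp_id, CategoryTheory.Functor.map_id, Category.id_comp]
  ids_comp w := by
    rw [← Category.assoc, pb.lift_fst]
    exact (T N).left_unit _
  comp_ids w := by
    rw [← Category.assoc, pb.lift_fst, Category.id_comp]
    exact (T N).right_unit _
  assoc w₁ w₂ w₃ := by
    rw [pb.lift_fst_assoc, pb.lift_fst_assoc, Functor.map_comp, Category.assoc, Category.assoc,
      Category.assoc, Category.assoc, (T N).assoc]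
  κ π _ _ _ _ _ := π
  d_κ _ _ _ _ _ _ := rfl
  src_κ _ _ _ w₀ _ _ := w₀.symm
  tgt_κ _ _ _ _ w₁ _ := w₁.symm

/-- The unique map to the terminal operad with precontraction. -/
noncomputable def toTerminal (P : OWP.{u} N) : P ⟶ terminal N where
  hom :=
    { map := P.d
      map_d := Category.comp_id _
      map_ids := P.ids_d
      map_comp := fun _ => P.comp_d }
  map_κ π θ₀ θ₁ w₀ w₁ w _ _ _ := P.d_κ π θ₀ θ₁ w₀ w₁ w

theorem hom_d {P Q : OWP.{u} N} (f : P ⟶ Q) {k : ℕ} {h : (k : ℕ∞) ≤ N} (θ : P.C.cell k h) :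
    Q.d.app (f.hom.map.app θ) = P.d.app θ :=
  congrArg (fun r : P.C ⟶ (T N).obj (pt N) => r.app θ) f.hom.map_d

theorem κ_congr (P : OWP.{u} N) {k : ℕ} {h : ((k + 1 : ℕ) : ℕ∞) ≤ N}
    {π π' : ((T.{u} N).obj (pt N)).cell (k + 1) h} {θ₀ θ₀' θ₁ θ₁' : P.C.cell k (dim_pred h)}
    (e : π = π') (e₀ : θ₀ = θ₀') (e₁ : θ₁ = θ₁') (w₀ w₁ w w₀' w₁' w') :
    P.κ π θ₀ θ₁ w₀ w₁ w = P.κ π' θ₀' θ₁' w₀' w₁' w' := by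
  subst e e₀ e₁
  rfl

end OWP

theorem Operad.comp_app_congr {N : ℕ∞} (O : Operad.{u} N) {k : ℕ} {h : (k : ℕ∞) ≤ N}
    {x y : (pb ((T N).map (toPt O.C)) O.d).cell k h} (h₁ : x.1.1 = y.1.1) (h₂ : x.1.2 = y.1.2) :
    O.comp.app x = O.comp.app y :=
  congrArg O.comp.app (Subtype.ext (Prod.ext h₁ h₂))

/-! ### Raw terms for operations and their values. -/

/-- Raw terms for the operations of the initial operad with precontraction (index `true`) and for
pasting diagrams of such operations (index `false`). -/
inductive Raw (N : ℕ∞) : Bool → ℕ → Type u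
  | ids (k : ℕ) : Raw N true k
  | comp {k : ℕ} (t : Raw N false k) (a : Raw N true k) : Raw N true k
  | contr {k : ℕ} (h : ((k + 1 : ℕ) : ℕ∞) ≤ N) (π : ((T.{u} N).obj (pt N)).cell (k + 1) h)
      (a b : Raw N true k) : Raw N true (k + 1)
  | of {k : ℕ} (a : Raw N true k) : Raw N false k
  | one {k : ℕ} (a : Raw N false k) : Raw N false (k + 1)
  | paste {k : ℕ} (p : ℕ) (a b : Raw N false k) : Raw N false k

namespace Raw

variable {N : ℕ∞}

/-- Formal boundaries, arranged so that a term with a value in `P` has boundary terms whose values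
are the boundaries of that value (`Ev.bdry`). On ill-formed terms the result carries no meaning. -/
def src : ∀ {b : Bool} {k : ℕ}, Raw.{u} N b (k + 1) → Raw.{u} N b k
  | _, k, ids _ => ids k
  | _, _, comp t a => comp t.src a.src
  | _, _, contr _ _ a _ => a
  | _, _, of a => of a.src
  | _, _, one a => a
  | _, k, paste p a b => if p = k then a.src else paste p a.src b.src

def tgt : ∀ {b : Bool} {k : ℕ}, Raw.{u} N b (k + 1) → Raw.{u} N b k
  | _, k, ids _ => ids k
  | _, _, comp t a => comp t.tgt a.tgt
  | _, _, contr _ _ _ b => b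
  | _, _, of a => of a.tgt
  | _, _, one a => a
  | _, k, paste p a b => if p = k then b.tgt else paste p a.tgt b.tgt

/-- The globular set in which raw terms take their values. -/
noncomputable abbrev val (P : OWP.{u} N) : Bool → GlobSet.{u} N
  | true => P.C
  | false => (T N).obj P.C

/-- `Ev P t v`: the raw term `t` has the value `v` in `P`. -/
def Ev (P : OWP.{u} N) : ∀ {b : Bool} {k : ℕ} {h : (k : ℕ∞) ≤ N}, Raw.{u} N b k →
    (val P b).cell k h → Prop
  | _, _, _, ids k, v => v = P.ids.app PUnit.unit
  | _, _, h, comp t a, v => ∃ x : (pb ((T N).map (toPt P.C)) P.d).cell _ h,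
      Ev P (h := h) t x.1.1 ∧ Ev P (h := h) a x.1.2 ∧ v = P.comp.app x
  | _, _, h, contr _ π a b, v => ∃ (x y : P.C.cell _ (dim_pred h)) (w₀ : _) (w₁ : _) (w : _),
      Ev P (h := dim_pred h) a x ∧ Ev P (h := dim_pred h) b y ∧ v = P.κ (h := h) π x y w₀ w₁ w
  | _, _, h, of a, v => ∃ x : P.C.cell _ h, Ev P (h := h) a x ∧ v = ((T N).η.app P.C).app x
  | _, _, h, one a, v => ∃ x : ((T N).obj P.C).cell _ (dim_pred h),
      Ev P (h := dim_pred h) a x ∧ v = fone (X := P.C) (h := h) x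
  | _, _, h, paste p a b, v => ∃ (x y : ((T N).obj P.C).cell _ h)
      (w : ((T N).obj P.C).Composable p x y),
      Ev P (h := h) a x ∧ Ev P (h := h) b y ∧ v = fcomp (X := P.C) p x y w

variable {P Q : OWP.{u} N}

theorem ev_ids {k : ℕ} {h : (k : ℕ∞) ≤ N} (P : OWP.{u} N) :
    Ev P (h := h) (ids k) (P.ids.app PUnit.unit) := by
  simp only [Ev]

/-- Evaluation is a relation, since a raw term may fail to be composable or parallel where it should
be. It is still a partial function: the side conditions are propositions, so the values of the
subterms determine the value of the term. -/
theorem Ev.unique {b : Bool} {k : ℕ} {h : (k : ℕ∞) ≤ N} {t : Raw.{u} N b k}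
    {v v' : (val P b).cell k h} (h₁ : Ev P t v) (h₂ : Ev P t v') : v = v' := by
  induction t with
  | ids k => exact Eq.trans h₁ (Eq.symm h₂)
  | comp t a iht iha =>
    obtain ⟨x, hx, hx', rfl⟩ := h₁
    obtain ⟨y, hy, hy', rfl⟩ := h₂
    exact P.comp_app_congr (iht hx hy) (iha hx' hy')
  | contr h' π a b iha ihb =>
    obtain ⟨x, y, w₀, w₁, w, hx, hy, rfl⟩ := h₁
    obtain ⟨x', y', w₀', w₁', w', hx', hy', rfl⟩ := h₂
    exact P.κ_congr rfl (iha hx hx') (ihb hy hy') _ _ _ _ _ _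
  | of a ih =>
    obtain ⟨x, hx, rfl⟩ := h₁
    obtain ⟨y, hy, rfl⟩ := h₂
    rw [ih hx hy]
  | one a ih =>
    obtain ⟨x, hx, rfl⟩ := h₁
    obtain ⟨y, hy, rfl⟩ := h₂
    rw [ih hx hy]
  | paste p a b iha ihb =>
    obtain ⟨x, y, w, hx, hy, rfl⟩ := h₁
    obtain ⟨x', y', w', hx', hy', rfl⟩ := h₂
    obtain rfl := iha hx hx'
    obtain rfl := ihb hy hy'
    rfl

theorem Ev.bdry' : ∀ {b : Bool} {k : ℕ} {h : ((k + 1 : ℕ) : ℕ∞) ≤ N} (t : Raw.{u} N b (k + 1))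
    (v : (val P b).cell (k + 1) h), Ev P t v →
      Ev P t.src ((val P b).src v) ∧ Ev P t.tgt ((val P b).tgt v)
  | _, k, h, ids _, v, hv => by
    obtain rfl : v = _ := hv
    rw [src, tgt]
    exact ⟨P.ids.src_app _, P.ids.tgt_app _⟩
  | _, k, h, comp t a, v, hv => by
    obtain ⟨x, hx, hx', rfl⟩ := hv
    have ht := Ev.bdry' t _ hx
    have ha := Ev.bdry' a _ hx'
    rw [src, tgt]
    exact ⟨⟨(pb _ _).src x, ht.1, ha.1, P.comp.src_app x⟩,
      ⟨(pb _ _).tgt x, ht.2, ha.2, P.comp.tgt_app x⟩⟩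
  | _, k, h, contr h' π a b, v, hv => by
    obtain ⟨x, y, w₀, w₁, w, hx, hy, rfl⟩ := hv
    rw [src, tgt]
    exact ⟨(P.src_κ π x y w₀ w₁ w).symm ▸ hx, (P.tgt_κ π x y w₀ w₁ w).symm ▸ hy⟩
  | _, k, h, of a, v, hv => by
    obtain ⟨x, hx, rfl⟩ := hv
    have ha := Ev.bdry' a _ hx
    rw [src, tgt]
    exact ⟨⟨_, ha.1, ((T N).η.app P.C).src_app x⟩, ⟨_, ha.2, ((T N).η.app P.C).tgt_app x⟩⟩
  | _, k, h, one a, v, hv => by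
    obtain ⟨x, hx, rfl⟩ := hv
    rw [src, tgt]
    exact ⟨((free P.C).src_one x).symm ▸ hx, ((free P.C).tgt_one x).symm ▸ hx⟩
  | _, k, h, paste p a b, v, hv => by
    obtain ⟨x, y, w, hx, hy, rfl⟩ := hv
    have ha := Ev.bdry' a _ hx
    have hb := Ev.bdry' b _ hy
    rw [src, tgt]
    by_cases hp : p = k
    · subst hp
      rw [if_pos rfl, if_pos rfl]
      exact ⟨((free P.C).src_comp_top x y w).symm ▸ ha.1,
        ((free P.C).tgt_comp_top x y w).symm ▸ hb.2⟩
    · rw [if_neg hp, if_neg hp]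
      have w' := composable_bdry hp w
      exact ⟨⟨_, _, w'.1, ha.1, hb.1, (free P.C).src_comp_low x y w w'.1⟩,
        ⟨_, _, w'.2, ha.2, hb.2, (free P.C).tgt_comp_low x y w w'.2⟩⟩

theorem Ev.bdry {b : Bool} {k : ℕ} {h : ((k + 1 : ℕ) : ℕ∞) ≤ N} {t : Raw.{u} N b (k + 1)}
    {v : (val P b).cell (k + 1) h} (hv : Ev P t v) :
    Ev P t.src ((val P b).src v) ∧ Ev P t.tgt ((val P b).tgt v) := Ev.bdry' t v hv

/-- The map on values induced by a map of operads with precontraction. -/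
noncomputable abbrev valMap (f : P ⟶ Q) : ∀ b : Bool, val P b ⟶ val Q b
  | true => f.hom.map
  | false => (T N).map f.hom.map

/-- Each constructor of raw terms names a piece of structure preserved by maps of operads with
precontraction or, for pasting, by the strict functors that `T` induces from them. -/
theorem Ev.map (f : P ⟶ Q) {b : Bool} {k : ℕ} {h : (k : ℕ∞) ≤ N} {t : Raw.{u} N b k}
    {v : (val P b).cell k h} (hv : Ev P t v) : Ev Q t ((valMap f b).app v) := by
  induction t with
  | ids k =>
    obtain rfl : v = _ := hv
    exact congrArg (fun r : pt N ⟶ Q.C => r.app PUnit.unit) f.hom.map_ids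
  | comp t a iht iha =>
    obtain ⟨x, hx, hx', rfl⟩ := hv
    exact ⟨_, iht hx, iha hx', congrArg (fun r : _ ⟶ Q.C => r.app x)
      (f.hom.map_comp (Operad.Hom.w _ f.hom.map_d))⟩
  | contr h' π a b iha ihb =>
    obtain ⟨x, y, w₀, w₁, w, hx, hy, rfl⟩ := hv
    exact ⟨_, _, (OWP.hom_d f x).trans w₀, (OWP.hom_d f y).trans w₁, parallel_map f.hom.map w,
      iha hx, ihb hy, f.map_κ π x y w₀ w₁ w _ _ _⟩
  | of a ih =>
    obtain ⟨x, hx, rfl⟩ := hv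
    exact ⟨_, ih hx, T_map_unit _ x⟩
  | one a ih =>
    obtain ⟨x, hx, rfl⟩ := hv
    exact ⟨_, ih hx, T_map_fone _ x⟩
  | paste p a b iha ihb =>
    obtain ⟨x, y, w, hx, hy, rfl⟩ := hv
    exact ⟨_, _, _, iha hx, ihb hy, T_map_fcomp _ x y w⟩

end Raw

/-! ### The initial operad with precontraction, made of generic operations. -/

section Generic

variable {N : ℕ∞}

/-- Families of operations, one in each operad with precontraction, denoted by a raw term. -/
abbrev GenericCell (N : ℕ∞) (k : ℕ) (h : (k : ℕ∞) ≤ N) : Type (u + 1) :=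
  {v : ∀ P : OWP.{u} N, P.C.cell k h // ∃ t : Raw.{u} N true k, ∀ P, Raw.Ev P t (v P)}

/-- A family indexed by all operads lives one universe too high, but it is recovered from any raw
term naming it, by uniqueness of values, and raw terms form a type in `Type u`. -/
instance (k : ℕ) (h : (k : ℕ∞) ≤ N) : Small.{u} (GenericCell.{u} N k h) :=
  small_of_injective (f := fun x => x.2.choose) fun x y e => Subtype.ext (funext fun P =>
    (x.2.choose_spec P).unique ((show x.2.choose = y.2.choose from e) ▸ y.2.choose_spec P))

namespace Generic

/-- The value of a generic cell in an operad with precontraction. -/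
noncomputable def ev (P : OWP.{u} N) {k : ℕ} {h : (k : ℕ∞) ≤ N}
    (x : Shrink.{u} (GenericCell.{u} N k h)) : P.C.cell k h := ((equivShrink _).symm x).1 P

noncomputable def mk {k : ℕ} {h : (k : ℕ∞) ≤ N} (v : ∀ P : OWP.{u} N, P.C.cell k h)
    (w : ∃ t : Raw.{u} N true k, ∀ P, Raw.Ev P t (v P)) : Shrink.{u} (GenericCell.{u} N k h) :=
  equivShrink _ ⟨v, w⟩

theorem ev_mk {k : ℕ} {h : (k : ℕ∞) ≤ N} (v : ∀ P : OWP.{u} N, P.C.cell k h) (w) (P : OWP.{u} N) :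
    ev P (mk v w) = v P := by
  rw [ev, mk, Equiv.symm_apply_apply]

theorem ext {k : ℕ} {h : (k : ℕ∞) ≤ N} {x y : Shrink.{u} (GenericCell.{u} N k h)}
    (w : ∀ P, ev P x = ev P y) : x = y :=
  (equivShrink _).symm.injective (Subtype.ext (funext w))

theorem exists_raw {k : ℕ} {h : (k : ℕ∞) ≤ N} (x : Shrink.{u} (GenericCell.{u} N k h)) :
    ∃ t : Raw.{u} N true k, ∀ P, Raw.Ev P t (ev P x) := ((equivShrink _).symm x).2

/-- The globular set of generic cells. -/
noncomputable def glob (N : ℕ∞) : GlobSet.{u} N where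
  cell k h := Shrink.{u} (GenericCell.{u} N k h)
  src x := mk (fun P => P.C.src (ev P x))
    ((exists_raw x).elim fun t ht => ⟨t.src, fun P => (ht P).bdry.1⟩)
  tgt x := mk (fun P => P.C.tgt (ev P x))
    ((exists_raw x).elim fun t ht => ⟨t.tgt, fun P => (ht P).bdry.2⟩)
  src_src x := ext fun P => by simp only [ev_mk, P.C.src_src]
  tgt_src x := ext fun P => by simp only [ev_mk, P.C.tgt_src]

theorem ev_src (P : OWP.{u} N) {k : ℕ} {h : ((k + 1 : ℕ) : ℕ∞) ≤ N}
    (x : (glob.{u} N).cell (k + 1) h) : ev P ((glob N).src x) = P.C.src (ev P x) :=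
  ev_mk (fun P => P.C.src (ev P x)) _ P

theorem ev_tgt (P : OWP.{u} N) {k : ℕ} {h : ((k + 1 : ℕ) : ℕ∞) ≤ N}
    (x : (glob.{u} N).cell (k + 1) h) : ev P ((glob N).tgt x) = P.C.tgt (ev P x) :=
  ev_mk (fun P => P.C.tgt (ev P x)) _ P

noncomputable def evHom (P : OWP.{u} N) : glob N ⟶ P.C :=
  GlobSet.Hom.mk (fun x => ev P x) (fun x => (ev_src P x).symm) (fun x => (ev_tgt P x).symm)

theorem hom_ext {X : GlobSet.{u} N} {a b : X ⟶ glob N} (w : ∀ P, a ≫ evHom P = b ≫ evHom P) :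
    a = b :=
  GlobSet.hom_ext fun _ _ x => ext fun P => congrArg (fun r : X ⟶ P.C => r.app x) (w P)

/-- On a generic cell both sides are the value in `Q` of the raw term naming that cell. Generic
families are thereby natural in the operad, although naturality is not part of their definition. -/
theorem evHom_map {P Q : OWP.{u} N} (f : P ⟶ Q) : evHom P ≫ f.hom.map = evHom Q := by
  refine GlobSet.hom_ext fun k h x => ?_
  obtain ⟨t, ht⟩ := exists_raw (h := h) x
  exact ((ht P).map f).unique (ht Q)

/-- The operations of the terminal operad are the pasting diagrams, so evaluation there reads off a
shape. By naturality along `toTerminal`, all members of a generic family have this shape. -/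
noncomputable def shape (N : ℕ∞) : glob.{u} N ⟶ (T N).obj (pt N) := evHom (OWP.terminal N)

theorem evHom_d (P : OWP.{u} N) : evHom P ≫ P.d = shape N := evHom_map P.toTerminal

theorem w_ev (P : OWP.{u} N) : (pb.fst ((T N).map (toPt (glob N))) (shape N) ≫
    (T N).map (evHom P)) ≫ (T N).map (toPt P.C) = (pb.snd _ _ ≫ evHom P) ≫ P.d := by
  rw [Category.assoc, ← Functor.map_comp, Category.assoc, evHom_d]
  exact pb.condition _ _

/-- The values of formal composites of generic cells. -/
noncomputable def evPair (P : OWP.{u} N) : pb ((T N).map (toPt (glob N))) (shape N) ⟶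
    pb ((T N).map (toPt P.C)) P.d := pb.lift _ _ (w_ev P)

/-- A pasting of generic cells involves finitely many of them. Replacing each by a term naming it
yields one term that works in all operads at once, which is what makes composites of generic cells
generic. -/
theorem exists_raw_paste {k : ℕ} {h : (k : ℕ∞) ≤ N} (x : ((T N).obj (glob.{u} N)).cell k h) :
    ∃ t : Raw.{u} N false k, ∀ P, Raw.Ev P (h := h) t (((T N).map (evHom P)).app x) := by
  induction x using T_induction with
  | of x =>
    obtain ⟨t, ht⟩ := exists_raw x
    exact ⟨.of t, fun P => ⟨_, ht P, T_map_unit _ x⟩⟩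
  | one x ih =>
    obtain ⟨t, ht⟩ := ih
    exact ⟨.one t, fun P => ⟨_, ht P, T_map_fone _ x⟩⟩
  | @comp p _ _ x y w ihx ihy =>
    obtain ⟨t, ht⟩ := ihx
    obtain ⟨t', ht'⟩ := ihy
    exact ⟨.paste p t t', fun P => ⟨_, _, _, ht P, ht' P, T_map_fcomp _ x y w⟩⟩

/-- The map into generic cells with given values. -/
noncomputable def lift {X : GlobSet.{u} N} (v : ∀ P : OWP.{u} N, X ⟶ P.C)
    (w : ∀ {k : ℕ} {h : (k : ℕ∞) ≤ N} (x : X.cell k h), ∃ t : Raw.{u} N true k,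
      ∀ P, Raw.Ev P t ((v P).app x)) : X ⟶ glob N :=
  GlobSet.Hom.mk (fun x => mk (fun P => (v P).app x) (w x))
    (fun x => ext fun P => (ev_src P _).trans ((congrArg P.C.src (ev_mk _ _ P)).trans
      (((v P).src_app x).trans (ev_mk (fun P => (v P).app (X.src x)) _ P).symm)))
    (fun x => ext fun P => (ev_tgt P _).trans ((congrArg P.C.tgt (ev_mk _ _ P)).trans
      (((v P).tgt_app x).trans (ev_mk (fun P => (v P).app (X.tgt x)) _ P).symm)))

theorem lift_ev {X : GlobSet.{u} N} (v : ∀ P : OWP.{u} N, X ⟶ P.C) (w) (P : OWP.{u} N) :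
    lift v w ≫ evHom P = v P :=
  GlobSet.hom_ext fun _ _ x => ev_mk (fun P => (v P).app x) _ P

noncomputable def ids (N : ℕ∞) : pt N ⟶ glob.{u} N :=
  lift (fun P => P.ids) fun {k _} _ => ⟨.ids k, Raw.ev_ids⟩

theorem ids_ev (P : OWP.{u} N) : ids N ≫ evHom P = P.ids := lift_ev _ _ _

noncomputable def comp (N : ℕ∞) : pb ((T N).map (toPt (glob.{u} N))) (shape N) ⟶ glob.{u} N :=
  lift (fun P => evPair P ≫ P.comp) fun {k h} x => by
    obtain ⟨t, ht⟩ := exists_raw_paste x.1.1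
    obtain ⟨t', ht'⟩ := exists_raw (h := h) x.1.2
    exact ⟨.comp t t', fun P => ⟨(evPair P).app x, ht P, ht' P, rfl⟩⟩

theorem comp_ev (P : OWP.{u} N) : comp N ≫ evHom P = evPair P ≫ P.comp := lift_ev _ _ _

theorem w_lift (P : OWP.{u} N) {X : GlobSet.{u} N} {a : X ⟶ (T N).obj (glob N)} {b : X ⟶ glob N}
    (w : a ≫ (T N).map (toPt (glob N)) = b ≫ shape N) :
    (a ≫ (T N).map (evHom P)) ≫ (T N).map (toPt P.C) = (b ≫ evHom P) ≫ P.d := by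
  rw [Category.assoc, ← Functor.map_comp, Category.assoc, evHom_d, ← w]
  rfl

theorem lift_comp_ev (P : OWP.{u} N) {X : GlobSet.{u} N} {a : X ⟶ (T N).obj (glob N)}
    {b : X ⟶ glob N} (w : a ≫ (T N).map (toPt (glob N)) = b ≫ shape N) :
    (pb.lift a b w ≫ comp N) ≫ evHom P = pb.lift _ _ (w_lift P w) ≫ P.comp := by
  rw [Category.assoc, comp_ev]
  rfl

/-- The operad of generic cells. -/
noncomputable def operad (N : ℕ∞) : Operad.{u} N where
  C := glob N
  d := shape N
  ids := ids N
  comp := comp N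
  ids_d := ids_ev _
  comp_d := comp_ev _
  ids_comp w := hom_ext fun P => by
    rw [lift_comp_ev]
    have k := congrArg (fun r => evHom P ≫ r) (P.ids_comp (P.w_unit _))
    refine Eq.trans (P.comp_congr ?_ ?_ _ _) ((P.pre_comp (evHom P) (P.w_unit _)).symm.trans k)
    · exact (Operad.unit_nat _).symm
    · rw [Category.assoc, ids_ev]
      rfl
  comp_ids w := hom_ext fun P => by
    rw [lift_comp_ev]
    have k := congrArg (fun r => evHom P ≫ r) (P.comp_ids P.w_ids)
    refine Eq.trans (P.comp_congr ?_ rfl _ _) ((P.pre_comp (evHom P) P.w_ids).symm.trans k)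
    rw [Category.assoc, ← Functor.map_comp, ids_ev, ← evHom_d P, Category.assoc]
  assoc w₁ w₂ w₃ := hom_ext fun P => by
    rw [lift_comp_ev, lift_comp_ev]
    -- This makes evaluation at `P` a map on threefold composites; associativity of `P`, pulled back
    -- along that map, is the `P`-component of the required equation.
    have hv : (pb.fst ((T N).map (toPt (pb ((T N).map (toPt (glob N))) (shape N)))) (shape N) ≫
        (T N).map (evPair P)) ≫ (T N).map (toPt (pb ((T N).map (toPt P.C)) P.d)) =
          (pb.snd _ _ ≫ evHom P) ≫ P.d := by
      rw [Category.assoc, ← Functor.map_comp, Category.assoc, evHom_d]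
      exact pb.condition _ _
    have k := congrArg (fun r => pb.lift _ _ hv ≫ r) (P.assoc (P.w_map _) (P.w_sub _) (P.w_mul _))
    refine Eq.trans (Eq.trans ?_ (P.pre_comp (pb.lift _ _ hv) (P.w_map _)).symm)
      (k.trans (Eq.trans (P.pre_comp (pb.lift _ _ hv) (P.w_mul _)) ?_))
    · refine P.comp_congr ?_ rfl _ _
      rw [pb.lift_fst_assoc, Category.assoc, Category.assoc, ← Functor.map_comp,
        ← Functor.map_comp, comp_ev]
    · refine P.comp_congr ?_ ?_ _ _
      · rw [pb.lift_fst_assoc, Category.assoc, Category.assoc, Category.assoc,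
          ← Operad.mul_nat, ← Functor.map_comp_assoc, ← Functor.map_comp_assoc]
        rfl
      · rw [lift_comp_ev]
        refine Eq.trans (P.pre_comp (pb.lift _ _ hv) (P.w_sub _)) (P.comp_congr ?_ rfl _ _)
        rw [pb.lift_fst_assoc, Category.assoc, Category.assoc, ← Functor.map_comp,
          ← Functor.map_comp]
        rfl

theorem d_ev (P : OWP.{u} N) {k : ℕ} {h : (k : ℕ∞) ≤ N} (x : (glob.{u} N).cell k h) :
    P.d.app (ev P x) = (shape N).app x :=
  congrArg (fun r : glob N ⟶ (T N).obj (pt N) => r.app x) (evHom_d P)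

/-- The initial operad with precontraction. -/
noncomputable def owp (N : ℕ∞) : OWP.{u} N where
  toOperad := operad N
  κ π x y w₀ w₁ w := mk (fun P => P.κ π (ev P x) (ev P y) ((d_ev P x).trans w₀)
      ((d_ev P y).trans w₁) (parallel_map (evHom P) w)) (by
    obtain ⟨t, ht⟩ := exists_raw x
    obtain ⟨t', ht'⟩ := exists_raw y
    exact ⟨.contr _ π t t', fun P => ⟨_, _, _, _, _, ht P, ht' P, rfl⟩⟩)
  d_κ π x y w₀ w₁ w := ev_mk _ _ _
  src_κ π x y w₀ w₁ w := ext fun P => by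
    refine (ev_src P _).trans ?_
    rw [ev_mk]
    exact P.src_κ _ _ _ _ _ _
  tgt_κ π x y w₀ w₁ w := ext fun P => by
    refine (ev_tgt P _).trans ?_
    rw [ev_mk]
    exact P.tgt_κ _ _ _ _ _ _

noncomputable def toOWP (P : OWP.{u} N) : owp N ⟶ P where
  hom :=
    { map := evHom P
      map_d := evHom_d P
      map_ids := ids_ev P
      map_comp := fun _ => comp_ev P }
  map_κ _ _ _ _ _ _ _ _ _ := ev_mk _ _ _

/-- Evaluating at `owp N` and then at `P` is the same as evaluating at `P`, and evaluations are
jointly injective. For a map `f` from `owp N` to `P`, `evHom_map f` now says that `f` is evaluation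
at `P`, which is uniqueness in `isInitial`. -/
theorem evHom_self : evHom (owp.{u} N) = 𝟙 _ :=
  hom_ext fun P => (evHom_map (toOWP P)).trans (Category.id_comp _).symm

noncomputable def isInitial (N : ℕ∞) : Limits.IsInitial (owp.{u} N) :=
  Limits.IsInitial.ofUniqueHom toOWP fun P f => OWP.Hom.ext (Operad.Hom.ext (by
    have := evHom_map f
    rw [evHom_self] at this
    exact this))

end Generic

end Generic

/-! ### Compatibility of the comparison maps with restriction in two steps. -/

namespace StrictCat

variable {N M K : ℕ∞}

/-- Both sides underlie strict functors out of a truncated free strict category, and they agree on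
generators. -/
theorem down_trans (e : M ≤ N) (e' : K ≤ M) (X : GlobSet.{u} N) :
    down (e'.trans e) X = (GlobSet.res e').map (down e X) ≫ down e' ((GlobSet.res e).obj X) := by
  refine T_hom_ext (e'.trans e) (X := X) (D := free ((GlobSet.res (e'.trans e)).obj X))
    (extend (e'.trans e) (incl ((GlobSet.res (e'.trans e)).obj X)))
    (truncMap (C := trunc e (free X)) e' (extend e (incl ((GlobSet.res e).obj X))) ≫
      extend e' (incl ((GlobSet.res e').obj ((GlobSet.res e).obj X)))) ?_
  refine (unit_down (e'.trans e) X).trans (Eq.trans ?_ (Category.assoc _ _ _))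
  refine Eq.trans ?_ (congrArg (fun r => (GlobSet.res e').map r ≫ down e' _) (unit_down e X)).symm
  exact (unit_down e' ((GlobSet.res e).obj X)).symm

theorem up_trans (e : M ≤ N) (e' : K ≤ M) (X : GlobSet.{u} N) :
    up (e'.trans e) X = up e' ((GlobSet.res e).obj X) ≫ (GlobSet.res e').map (up e X) := by
  have h : down (e'.trans e) X ≫ up e' ((GlobSet.res e).obj X) ≫ (GlobSet.res e').map (up e X)
      = 𝟙 _ := by
    rw [down_trans e e']
    refine Eq.trans (congrArg (fun r => (GlobSet.res e').map (down e X) ≫ r ≫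
      (GlobSet.res e').map (up e X)) (down_up e' _)) ?_
    exact congrArg (GlobSet.res e').map (down_up e X)
  have h' := congrArg (fun r => up (e'.trans e) X ≫ r) h
  refine (h'.symm.trans ?_).trans rfl
  refine (Category.assoc _ _ _).symm.trans ?_
  rw [up_down]
  rfl

end StrictCat

/-! ### Restricted maps between operads of different dimensions, and cofreeness. -/

namespace OWP

variable {N M K : ℕ∞}

/-- A map from an operad with precontraction `P`, restricted to dimension `M`, to one in dimension
`M`; the restriction of the composition of `P` is expressed through the comparison map `down`. -/
structure ResHom (e : M ≤ N) (P : OWP.{u} N) (D : OWP.{u} M) where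
  map : (GlobSet.res e).obj P.C ⟶ D.C
  map_d : map ≫ D.d = (GlobSet.res e).map P.d ≫ down e (pt N)
  map_ids : (GlobSet.res e).map P.ids ≫ map = D.ids
  map_comp : ∀ w, (GlobSet.res e).map P.comp ≫ map = pb.lift (f := (T M).map (toPt D.C)) (g := D.d)
    ((GlobSet.res e).map (pb.fst _ _) ≫ down e P.C ≫ (T M).map map)
    ((GlobSet.res e).map (pb.snd _ _) ≫ map) w ≫ D.comp
  map_κ : ∀ {k : ℕ} {h : ((k + 1 : ℕ) : ℕ∞) ≤ M}
    (π : ((T.{u} N).obj (pt N)).cell (k + 1) (h.trans e))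
    (θ₀ θ₁ : P.C.cell k (dim_pred (h.trans e))) (w₀ w₁ w w₀' w₁' w'),
    map.app (h := h) (P.κ π θ₀ θ₁ w₀ w₁ w) = D.κ (h := h) ((down e (pt N)).app (h := h) π)
      (map.app (h := dim_pred h) θ₀) (map.app (h := dim_pred h) θ₁) w₀' w₁' w'

namespace ResHom

variable {e : M ≤ N} {P : OWP.{u} N} {D : OWP.{u} M}

theorem w_lift {f : (GlobSet.res e).obj P.C ⟶ D.C}
    (hf : f ≫ D.d = (GlobSet.res e).map P.d ≫ down e (pt N)) {Y : GlobSet.{u} N}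
    {a : Y ⟶ (T N).obj P.C} {b : Y ⟶ P.C} (w : a ≫ (T N).map (toPt P.C) = b ≫ P.d) :
    ((GlobSet.res e).map a ≫ down e P.C ≫ (T M).map f) ≫ (T M).map (toPt D.C) =
      ((GlobSet.res e).map b ≫ f) ≫ D.d := by
  rw [Category.assoc, Category.assoc, ← Functor.map_comp, Category.assoc, hf, res_comp_assoc, ← w,
    ← res_comp_assoc, down_naturality]
  rfl

theorem lift_comp (f : ResHom e P D) {Y : GlobSet.{u} N} {a : Y ⟶ (T N).obj P.C} {b : Y ⟶ P.C}
    (w : a ≫ (T N).map (toPt P.C) = b ≫ P.d) :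
    (GlobSet.res e).map (pb.lift a b w ≫ P.comp) ≫ f.map =
      pb.lift _ _ (w_lift f.map_d w) ≫ D.comp := by
  rw [Functor.map_comp, Category.assoc, f.map_comp (w_lift f.map_d (pb.condition _ _))]
  rfl

theorem d_app (f : ResHom e P D) {k : ℕ} {h : (k : ℕ∞) ≤ M} (θ : P.C.cell k (h.trans e)) :
    D.d.app (f.map.app (h := h) θ) = (down e (pt N)).app (h := h) (P.d.app θ) :=
  congrArg (fun r : (GlobSet.res e).obj P.C ⟶ (T M).obj (pt M) => r.app (h := h) θ) f.map_d

theorem parallel (f : ResHom e P D) {k : ℕ} {h : (k : ℕ∞) ≤ M} {x y : P.C.cell k (h.trans e)}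
    (w : P.C.Parallel x y) : D.C.Parallel (f.map.app (h := h) x) (f.map.app (h := h) y) :=
  parallel_map f.map (by
    cases k with
    | zero => trivial
    | succ k => exact w)

/-- The map of operads out of the restriction. -/
noncomputable def toRes (f : ResHom e P D) : P.res e ⟶ D where
  hom :=
    { map := f.map
      map_d := f.map_d
      map_ids := f.map_ids
      map_comp := fun w => by
        change (P.resPair e ≫ (GlobSet.res e).map P.comp) ≫ f.map = _
        rw [Category.assoc, f.map_comp (w_lift f.map_d (pb.condition _ _))]
        refine (D.pre_comp _ _).trans (D.comp_congr ?_ rfl _ _)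
        -- Composition in `P.res e` is defined through `up`, while `map_comp` is stated through
        -- `down`; the two cancel.
        rw [Operad.resPair_fst_assoc, ← Category.assoc (up e _), up_down, Category.id_comp]
        rfl }
  map_κ {k h} π θ₀ θ₁ w₀ w₁ w w₀' w₁' w' := by
    have e₀ : (down e (pt N)).app (h := h) ((up e (pt N)).app (h := h) π) = π :=
      congrArg (fun r : (T M).obj (pt M) ⟶ (T M).obj (pt M) => r.app (h := h) π)
        (up_down e (pt N))
    exact (f.map_κ _ _ _ _ _ _ (e₀.symm ▸ w₀') (e₀.symm ▸ w₁') w').trans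
      (D.κ_congr e₀ rfl rfl _ _ _ _ _ _)

/-- Composition of restricted maps. -/
noncomputable def trans {Q : OWP.{u} K} {e' : K ≤ M} (f : ResHom e P D) (g : ResHom e' D Q) :
    ResHom (e'.trans e) P Q where
  map := (GlobSet.res e').map f.map ≫ g.map
  map_d := by
    rw [Category.assoc, g.map_d, down_trans e e']
    exact congrArg (fun r => (GlobSet.res e').map r ≫ down e' (pt M)) f.map_d
  map_ids := (congrArg (fun r => (GlobSet.res e').map r ≫ g.map) f.map_ids).trans g.map_ids
  map_comp w := by
    refine (congrArg (fun r => (GlobSet.res e').map r ≫ g.map)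
      (f.map_comp (w_lift f.map_d (pb.condition _ _)))).trans ((g.lift_comp _).trans ?_)
    refine Q.comp_congr ?_ rfl _ _
    rw [Functor.map_comp, Functor.map_comp, Category.assoc, Category.assoc,
      down_naturality_assoc, ← Functor.map_comp, down_trans e e']
    rfl
  map_κ {k h} π θ₀ θ₁ w₀ w₁ w w₀' w₁' w' := by
    have e₀ : (down (e'.trans e) (pt N)).app (h := h) π =
        (down e' (pt M)).app (h := h) ((down e (pt N)).app (h := h.trans e') π) :=
      congrArg (fun r : _ ⟶ (T K).obj (pt K) => r.app (h := h) π) (down_trans e e' (pt N))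
    refine (congrArg (g.map.app (h := h)) (f.map_κ (h := h.trans e') π θ₀ θ₁ w₀ w₁ w
      ((f.d_app _).trans ((congrArg _ w₀).trans ((down e (pt N)).src_app (h := h.trans e') π).symm))
      ((f.d_app _).trans ((congrArg _ w₁).trans ((down e (pt N)).tgt_app (h := h.trans e') π).symm))
      (f.parallel w))).trans ?_
    exact (g.map_κ _ _ _ _ _ _ (e₀ ▸ w₀') (e₀ ▸ w₁') w').trans
      (Q.κ_congr e₀.symm rfl rfl _ _ _ _ _ _)

/-- Composition of a restricted map with a map of operads. -/
noncomputable def postcomp {Q : OWP.{u} M} (f : ResHom e P D) (g : D ⟶ Q) : ResHom e P Q where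
  map := f.map ≫ g.hom.map
  map_d := by rw [Category.assoc, g.hom.map_d, f.map_d]
  map_ids := by rw [← Category.assoc, f.map_ids, g.hom.map_ids]
  map_comp w := by
    rw [← Category.assoc, f.map_comp (w_lift f.map_d (pb.condition _ _)), Category.assoc,
      g.hom.map_comp (Operad.Hom.w _ g.hom.map_d)]
    refine (Q.pre_comp _ _).trans (Q.comp_congr ?_ rfl _ _)
    rw [pb.lift_fst_assoc, Category.assoc, Category.assoc, ← Functor.map_comp]
  map_κ {k h} π θ₀ θ₁ w₀ w₁ w w₀' w₁' w' := by
    refine (congrArg (g.hom.map.app (h := h)) (f.map_κ π θ₀ θ₁ w₀ w₁ w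
      ((f.d_app _).trans ((congrArg _ w₀).trans ((down e (pt N)).src_app (h := h) π).symm))
      ((f.d_app _).trans ((congrArg _ w₁).trans ((down e (pt N)).tgt_app (h := h) π).symm))
      (f.parallel w))).trans ?_
    exact g.map_κ _ _ _ _ _ _ _ _ _

/-- Composition of a map of operads with a restricted map. -/
noncomputable def precomp {Q : OWP.{u} N} (g : Q ⟶ P) (f : ResHom e P D) : ResHom e Q D where
  map := (GlobSet.res e).map g.hom.map ≫ f.map
  map_d := by
    rw [Category.assoc, f.map_d, res_comp_assoc, g.hom.map_d]
  map_ids := by rw [res_comp_assoc, g.hom.map_ids, f.map_ids]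
  map_comp w := by
    rw [res_comp_assoc, g.hom.map_comp (Operad.Hom.w _ g.hom.map_d), f.lift_comp]
    refine D.comp_congr ?_ rfl _ _
    rw [Functor.map_comp, Category.assoc, down_naturality_assoc, ← Functor.map_comp]
  map_κ {k h} π θ₀ θ₁ w₀ w₁ w w₀' w₁' w' :=
    (congrArg (f.map.app (h := h)) (g.map_κ π θ₀ θ₁ w₀ w₁ w ((hom_d g _).trans w₀)
      ((hom_d g _).trans w₁) (parallel_map g.hom.map w))).trans (f.map_κ _ _ _ _ _ _ _ _ _)

/-- Restricting in two steps. -/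
noncomputable def resRes (P : OWP.{u} N) (e : M ≤ N) (e' : K ≤ M) :
    ResHom e' (P.res e) (P.res (e'.trans e)) where
  map := 𝟙 _
  map_d := (Category.id_comp _).trans
    ((congrArg ((GlobSet.res (e'.trans e)).map P.d ≫ ·) (down_trans e e' (pt N))).trans
      (Category.assoc _ _ _).symm)
  map_ids := rfl
  map_comp w := by
    refine Eq.trans (Category.comp_id _) ?_
    change (GlobSet.res e').map (P.resPair e) ≫ (GlobSet.res (e'.trans e)).map P.comp =
      _ ≫ P.resPair (e'.trans e) ≫ (GlobSet.res (e'.trans e)).map P.comp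
    refine Eq.trans ?_ (Category.assoc _ (P.resPair (e'.trans e)) _)
    refine congrArg (· ≫ (GlobSet.res (e'.trans e)).map P.comp) ?_
    refine GlobSet.hom_ext fun k h x => Subtype.ext (Prod.ext ?_ rfl)
    refine congrArg (fun r : (GlobSet.res e').obj (pb ((T M).map (toPt ((GlobSet.res e).obj P.C)))
      (P.resD e)) ⟶ _ => r.app (h := h) x)
      (?_ : (GlobSet.res e').map (pb.fst _ _ ≫ up e P.C) =
      ((GlobSet.res e').map (pb.fst _ _) ≫ down e' ((GlobSet.res e).obj P.C) ≫ (T K).map (𝟙 _)) ≫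
        up (e'.trans e) P.C)
    rw [CategoryTheory.Functor.map_id, up_trans e e']
    refine Eq.trans ?_ (congrArg (fun r => (GlobSet.res e').map (pb.fst _ _) ≫ r ≫
      (GlobSet.res e').map (up e P.C)) (down_up e' _).symm)
    rfl
  map_κ {k h} π θ₀ θ₁ w₀ w₁ w w₀' w₁' w' := by
    refine P.κ_congr ?_ rfl rfl _ _ _ _ _ _
    refine congrArg (fun r : (GlobSet.res e').obj ((T M).obj (pt M)) ⟶
      (GlobSet.res (e'.trans e)).obj ((T N).obj (pt N)) => r.app (h := h) π)
      (?_ : (GlobSet.res e').map (up e (pt N)) = down e' _ ≫ up (e'.trans e) (pt N))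
    rw [up_trans e e']
    exact (congrArg (· ≫ (GlobSet.res e').map (up e (pt N))) (down_up e' ((GlobSet.res e).obj (pt N)))).symm

/-- The identity of the restriction, as a restricted map. -/
noncomputable def unit (P : OWP.{u} N) (e : M ≤ N) : ResHom e P (P.res e) where
  map := 𝟙 _
  map_d := rfl
  map_ids := rfl
  map_comp w := by
    refine Eq.trans (Category.comp_id _) ?_
    refine Eq.trans ?_ (Category.assoc _ (P.resPair e) ((GlobSet.res e).map P.comp))
    refine congrArg (· ≫ (GlobSet.res e).map P.comp) (?_ : 𝟙 _ = _)
    refine GlobSet.hom_ext fun k h x => Subtype.ext (Prod.ext ?_ rfl)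
    refine congrArg (fun r : (GlobSet.res e).obj (pb ((T N).map (toPt P.C)) P.d) ⟶ _ =>
      r.app (h := h) x) (?_ : (GlobSet.res e).map (pb.fst _ _) =
      ((GlobSet.res e).map (pb.fst _ _) ≫ down e P.C ≫ (T M).map (𝟙 _)) ≫ up e P.C)
    rw [CategoryTheory.Functor.map_id, Category.comp_id, Category.assoc, down_up]
    rfl
  map_κ {k h} π θ₀ θ₁ w₀ w₁ w w₀' w₁' w' := by
    refine P.κ_congr ?_ rfl rfl _ _ _ _ _ _
    exact congrArg (fun r : (GlobSet.res e).obj ((T N).obj (pt N)) ⟶ _ => r.app (h := h) π)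
      (down_up e (pt N)).symm

end ResHom

/-- The property of `ε : Q ⟶ D`, restricted to dimension `M`, to exhibit `Q` as the cofree operad
with precontraction on `D`. -/
structure ResHom.IsCofree {e : M ≤ N} {Q : OWP.{u} N} {D : OWP.{u} M} (ε : ResHom e Q D) :
    Prop where
  exists_lift : ∀ {Y : GlobSet.{u} N} (a : Y ⟶ (T N).obj (pt N)) (b : (GlobSet.res e).obj Y ⟶ D.C),
    b ≫ D.d = (GlobSet.res e).map a ≫ down e (pt N) →
      ∃ c : Y ⟶ Q.C, c ≫ Q.d = a ∧ (GlobSet.res e).map c ≫ ε.map = b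
  hom_ext : ∀ {Y : GlobSet.{u} N} {a b : Y ⟶ Q.C}, a ≫ Q.d = b ≫ Q.d →
    (GlobSet.res e).map a ≫ ε.map = (GlobSet.res e).map b ≫ ε.map → a = b
  low_ext : ∀ {k : ℕ} (h : (k : ℕ∞) ≤ M) {x y : Q.C.cell k (h.trans e)},
    Q.d.app x = Q.d.app y → ε.map.app (h := h) x = ε.map.app (h := h) y → x = y
  high_ext : ∀ {k : ℕ} (h : ((k + 1 : ℕ) : ℕ∞) ≤ N) (_ : ¬ ((k + 1 : ℕ) : ℕ∞) ≤ M)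
    {x y : Q.C.cell (k + 1) h}, Q.d.app x = Q.d.app y → Q.C.src x = Q.C.src y →
      Q.C.tgt x = Q.C.tgt y → x = y

/-- The universal property is assumed only for globular maps over the shapes. The lift respects
identities and composition because maps into `Q` are detected by their shape and by their composite
with `ε`. Preservation of the precontraction is a cellwise statement, and `low_ext` and `high_ext`
are there for it. -/
theorem ResHom.IsCofree.lift {e : M ≤ N} {P Q : OWP.{u} N} {D : OWP.{u} M} {ε : ResHom e Q D}
    (hε : ε.IsCofree) (f : ResHom e P D) :
    ∃ g : P ⟶ Q, (GlobSet.res e).map g.hom.map ≫ ε.map = f.map := by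
  obtain ⟨c, hd, hc⟩ := hε.exists_lift P.d f.map f.map_d
  refine ⟨⟨⟨c, hd, ?_, fun w => ?_⟩, fun {k h} π θ₀ θ₁ w₀ w₁ w w₀' w₁' w' => ?_⟩, hc⟩
  · refine hε.hom_ext ?_ ?_
    · rw [Category.assoc, hd, P.ids_d, Q.ids_d]
    · rw [← res_comp_assoc, hc, f.map_ids, ε.map_ids]
  · refine hε.hom_ext ?_ ?_
    · rw [Category.assoc, hd, P.comp_d, Category.assoc, Q.comp_d, pb.lift_fst_assoc,
        Category.assoc, ← Functor.map_comp_assoc, hd]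
    · rw [← res_comp_assoc, hc, f.map_comp (w_lift f.map_d (pb.condition _ _)), ε.lift_comp]
      refine D.comp_congr ?_ ?_ _ _
      · rw [Functor.map_comp, Category.assoc, down_naturality_assoc, ← Functor.map_comp, hc]
      · rw [Functor.map_comp, Category.assoc, hc]
  · have hκ : Q.d.app (c.app (P.κ π θ₀ θ₁ w₀ w₁ w)) = Q.d.app (Q.κ π _ _ w₀' w₁' w') := by
      rw [Q.d_κ]
      exact (congrArg (fun r : P.C ⟶ (T N).obj (pt N) => r.app _) hd).trans (P.d_κ _ _ _ _ _ _)
    by_cases h' : ((k + 1 : ℕ) : ℕ∞) ≤ M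
    · refine hε.low_ext h' hκ ?_
      have hc' : ∀ {j : ℕ} (h : (j : ℕ∞) ≤ M) (x : P.C.cell j (h.trans e)),
          ε.map.app (h := h) (c.app x) = f.map.app (h := h) x := fun h x =>
        congrArg (fun r : (GlobSet.res e).obj P.C ⟶ D.C => r.app (h := h) x) hc
      refine (hc' h' _).trans ?_
      have v₀ := (ε.d_app (h := dim_pred h') (c.app θ₀)).trans ((congrArg _ w₀').trans
        ((down e (pt N)).src_app (h := h') π).symm)
      have v₁ := (ε.d_app (h := dim_pred h') (c.app θ₁)).trans ((congrArg _ w₁').trans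
        ((down e (pt N)).tgt_app (h := h') π).symm)
      refine Eq.trans ?_ (ε.map_κ (h := h') π _ _ w₀' w₁' w' v₀ v₁ (ε.parallel w')).symm
      refine (f.map_κ (h := h') π θ₀ θ₁ w₀ w₁ w (hc' (dim_pred h') θ₀ ▸ v₀)
        (hc' (dim_pred h') θ₁ ▸ v₁) (f.parallel w)).trans ?_
      exact D.κ_congr rfl (hc' _ _).symm (hc' _ _).symm _ _ _ _ _ _
    -- Above dimension `M` nothing is left to choose: both operations have the same shape, and the
    -- axioms of a precontraction fix their boundaries.
    · refine hε.high_ext h h' hκ ?_ ?_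
      · rw [Q.src_κ, c.src_app, P.src_κ]
      · rw [Q.tgt_κ, c.tgt_app, P.tgt_κ]

theorem ResHom.IsCofree.ext {e : M ≤ N} {P Q : OWP.{u} N} {D : OWP.{u} M} {ε : ResHom e Q D}
    (hε : ε.IsCofree) {f g : P ⟶ Q}
    (w : (GlobSet.res e).map f.hom.map ≫ ε.map = (GlobSet.res e).map g.hom.map ≫ ε.map) :
    f = g :=
  OWP.Hom.ext (Operad.Hom.ext (hε.hom_ext (f.hom.map_d.trans g.hom.map_d.symm) w))

end OWP

/-! ### Cofreeness of `S D`. -/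

namespace OWP

variable {n : ℕ} (D : OWP.{u} n)

/-- The counit of `S D`, as a restricted map. -/
noncomputable def susRes : ResHom (dim_le_succ n) D.sus D where
  map := D.susCounit
  map_d := D.susCounit_d
  map_ids := D.susIds_counit
  map_comp _ := D.susComp_counit
  map_κ {k h} π θ₀ θ₁ w₀ w₁ w w₀' w₁' w' := by
    change SCell.toCell (D.susκ π θ₀ θ₁ w₀ w₁ w) h = _
    simp only [susκ, h, dite_true]
    rfl

theorem susRes_isCofree : D.susRes.IsCofree where
  exists_lift a b w := ⟨Operad.susLift a b w, rfl, Operad.susLift_counit a b w⟩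
  hom_ext h₁ h₂ := Operad.sus_ext h₁ h₂
  low_ext {k} h {x y} h₁ h₂ := by
    refine Subtype.ext (Prod.ext ?_ h₁)
    exact (D.low_susCounit h x).symm.trans ((congrArg (SCell.low h) h₂).trans
      (D.low_susCounit h y))
  high_ext {k} h h' {x y} hd hs ht := by
    refine Subtype.ext (Prod.ext (SCell.ext_high h' ?_ ?_) hd)
    · exact congrArg (fun z : D.susC.cell k (dim_pred h) => z.1.1) hs
    · exact congrArg (fun z : D.susC.cell k (dim_pred h) => z.1.1) ht

end OWP

/-! ### The coskeleton of an `n`-globular set. -/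

namespace GlobSet

variable {n : ℕ}

/-- The cells of the coskeleton of an `n`-globular set `X`: those of `X`; in dimension `n + 1` all
pairs of parallel `n`-cells of `X`; in higher dimensions one cell from each cell to itself. -/
inductive CoskCell (X : GlobSet.{u} n) : ℕ → Type u
  | low {k : ℕ} (h : (k : ℕ∞) ≤ n) (x : X.cell k h) : CoskCell X k
  | pair (x y : X.cell n le_rfl) (w : X.Parallel x y) : CoskCell X (n + 1)
  | same {k : ℕ} (h : n < k) (c : CoskCell X k) : CoskCell X (k + 1)

namespace CoskCell

variable {X : GlobSet.{u} n}

def src : ∀ {k : ℕ}, CoskCell X (k + 1) → CoskCell X k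
  | _, low h x => low (dim_pred h) (X.src x)
  | _, pair x _ _ => low le_rfl x
  | _, same _ c => c

def tgt : ∀ {k : ℕ}, CoskCell X (k + 1) → CoskCell X k
  | _, low h x => low (dim_pred h) (X.tgt x)
  | _, pair _ y _ => low le_rfl y
  | _, same _ c => c

theorem not_dim {k : ℕ} (hk : n < k) : ¬ (k : ℕ∞) ≤ n := by
  intro h
  have : k ≤ n := by exact_mod_cast h
  omega

theorem src_src {k : ℕ} (x : CoskCell X (k + 2)) : src (src x) = src (tgt x) := by
  cases x with
  | low h x => exact congrArg (low _) (X.src_src x)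
  | pair _ _ w => exact congrArg (low _) w.1
  | same => rfl

theorem tgt_src {k : ℕ} (x : CoskCell X (k + 2)) : tgt (src x) = tgt (tgt x) := by
  cases x with
  | low h x => exact congrArg (low _) (X.tgt_src x)
  | pair _ _ w => exact congrArg (low _) w.2
  | same => rfl

/-- The cell of `X` given by a low-dimensional cell of the coskeleton. -/
def toCell : ∀ {k : ℕ}, CoskCell X k → (h : (k : ℕ∞) ≤ n) → X.cell k h
  | _, low _ x, _ => x
  | _, pair _ _ _, h => absurd h (not_dim n.lt_succ_self)
  | _, same hk _, h => absurd h (not_dim (Nat.lt_succ_of_lt hk))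

theorem low_toCell {k : ℕ} (x : CoskCell X k) (h : (k : ℕ∞) ≤ n) : low h (x.toCell h) = x := by
  cases x with
  | low => rfl
  | pair => exact absurd h (not_dim n.lt_succ_self)
  | same hk => exact absurd h (not_dim (Nat.lt_succ_of_lt hk))

/-- Pairs occur only in dimension `n + 1` and `same` only above it, so mixed cases are impossible.
As a consequence parallel cells above dimension `n` coincide, which is why `same` already gives all
parallel pairs from dimension `n + 2` on. -/
theorem ext_high {k : ℕ} {x y : CoskCell X (k + 1)} (hk : ¬ ((k + 1 : ℕ) : ℕ∞) ≤ n)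
    (h₁ : src x = src y) (h₂ : tgt x = tgt y) : x = y := by
  cases x with
  | low h => exact absurd h hk
  | pair a b w =>
    cases y with
    | low h => exact absurd h hk
    | pair c d w' =>
      simp only [src, tgt, low.injEq] at h₁ h₂
      subst h₁ h₂
      rfl
    | same h c => exact absurd h (lt_irrefl n)
  | same h c =>
    cases y with
    | low h => exact absurd h hk
    | pair c d w' => exact absurd h (lt_irrefl n)
    | same h' c' => exact congrArg (same h) h₁

def mkPair : ∀ {k : ℕ} (_ : k = n) {h : (k : ℕ∞) ≤ n} (x y : X.cell k h), X.Parallel x y →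
    CoskCell X (k + 1)
  | _, rfl, _, x, y, w => pair x y w

theorem src_mkPair {k : ℕ} (e : k = n) {h : (k : ℕ∞) ≤ n} (x y : X.cell k h) (w) :
    src (mkPair e x y w) = low h x := by
  subst e
  rfl

theorem tgt_mkPair {k : ℕ} (e : k = n) {h : (k : ℕ∞) ≤ n} (x y : X.cell k h) (w) :
    tgt (mkPair e x y w) = low h y := by
  subst e
  rfl

theorem lt_of_not {k : ℕ} (h' : ¬ ((k + 1 : ℕ) : ℕ∞) ≤ n) (e : k ≠ n) : n < k := by
  have h₂ : ¬ k + 1 ≤ n := by exact_mod_cast h'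
  omega

end CoskCell

/-- The right adjoint to restriction of globular sets to dimension `n`. -/
def cosk (X : GlobSet.{u} n) : GlobSet.{u} ⊤ where
  cell k _ := CoskCell X k
  src := CoskCell.src
  tgt := CoskCell.tgt
  src_src := CoskCell.src_src
  tgt_src := CoskCell.tgt_src

namespace cosk

/-- The restriction functor from globular sets to `n`-globular sets. -/
abbrev R (n : ℕ) : GlobSet.{u} ⊤ ⥤ GlobSet.{u} n := res (le_top : (n : ℕ∞) ≤ ⊤)

/-- The counit of the coskeleton. -/
def counit (X : GlobSet.{u} n) : (R n).obj (cosk X) ⟶ X :=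
  GlobSet.Hom.mk (fun {_ h} x => CoskCell.toCell x h)
    (fun {k h} x => by
      change CoskCell X (k + 1) at x
      cases x with
      | low => rfl
      | pair => exact absurd h (CoskCell.not_dim n.lt_succ_self)
      | same hk => exact absurd h (CoskCell.not_dim (Nat.lt_succ_of_lt hk)))
    (fun {k h} x => by
      change CoskCell X (k + 1) at x
      cases x with
      | low => rfl
      | pair => exact absurd h (CoskCell.not_dim n.lt_succ_self)
      | same hk => exact absurd h (CoskCell.not_dim (Nat.lt_succ_of_lt hk)))

variable {X : GlobSet.{u} n} {Y : GlobSet.{u} ⊤}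

theorem parallel_bdry (f : (R n).obj Y ⟶ X) : ∀ {k : ℕ} (h₀ : (k : ℕ∞) ≤ n)
    (y : Y.cell (k + 1) le_top),
    X.Parallel (f.app (h := h₀) (Y.src y)) (f.app (h := h₀) (Y.tgt y))
  | 0, _, _ => trivial
  | k + 1, h₀, y => by
    refine ⟨(f.src_app (h := h₀) (Y.src y)).trans (Eq.trans ?_ (f.src_app (h := h₀) _).symm),
      (f.tgt_app (h := h₀) (Y.src y)).trans (Eq.trans ?_ (f.tgt_app (h := h₀) _).symm)⟩
    · exact congrArg f.app (Y.src_src y)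
    · exact congrArg f.app (Y.tgt_src y)

open Classical in
/-- The cell of the coskeleton corresponding to a cell of `Y`, for a map `R Y ⟶ X`. -/
noncomputable def liftFun (f : (R n).obj Y ⟶ X) : ∀ {k : ℕ}, Y.cell k le_top → CoskCell X k
  | 0, y => CoskCell.low (dim_zero _) (f.app (h := dim_zero _) y)
  | k + 1, y =>
    if h' : ((k + 1 : ℕ) : ℕ∞) ≤ n then CoskCell.low h' (f.app (h := h') y)
    else if e : k = n then CoskCell.mkPair e (f.app (h := by rw [e]) (Y.src y)) (f.app (Y.tgt y))
      (parallel_bdry f _ y)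
    else CoskCell.same (CoskCell.lt_of_not h' e) (liftFun f (Y.src y))

theorem liftFun_low (f : (R n).obj Y ⟶ X) {k : ℕ} (y : Y.cell k le_top) (h' : (k : ℕ∞) ≤ n) :
    liftFun f y = CoskCell.low h' (f.app (h := h') y) := by
  cases k with
  | zero => rfl
  | succ k => simp only [liftFun, h', dite_true]

theorem liftFun_top (f : (R n).obj Y ⟶ X) {k : ℕ} (y : Y.cell (k + 1) le_top) (e : k = n) :
    liftFun f y = CoskCell.mkPair e (f.app (h := by rw [e]) (Y.src y)) (f.app (Y.tgt y))
      (parallel_bdry f _ y) := by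
  rw [liftFun.eq_2, dif_neg (CoskCell.not_dim (by omega)), dif_pos e]

theorem liftFun_high (f : (R n).obj Y ⟶ X) {k : ℕ} (y : Y.cell (k + 1) le_top) (h : n < k) :
    liftFun f y = CoskCell.same h (liftFun f (Y.src y)) := by
  rw [liftFun.eq_2, dif_neg (CoskCell.not_dim (by omega)), dif_neg (by omega)]

theorem liftFun_src (f : (R n).obj Y ⟶ X) {k : ℕ} (y : Y.cell (k + 1) le_top) :
    CoskCell.src (liftFun f y) = liftFun f (Y.src y) := by
  by_cases h' : ((k + 1 : ℕ) : ℕ∞) ≤ n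
  · rw [liftFun_low f y h', liftFun_low f (Y.src y) (dim_pred h')]
    exact congrArg (CoskCell.low _) (f.src_app (h := h') y)
  · by_cases e : k = n
    · rw [liftFun_low f (Y.src y) (by rw [e]), liftFun_top f y e, CoskCell.src_mkPair]
    · rw [liftFun_high f y (CoskCell.lt_of_not h' e)]
      rfl

/-- Above dimension `n + 1` the constructor `same` records only the image of the source of `y`. The
image of the target is the same cell: both images have equal boundaries by globularity and by the
previous dimension, and `CoskCell.ext_high` applies. -/
theorem liftFun_tgt (f : (R n).obj Y ⟶ X) {k : ℕ} (y : Y.cell (k + 1) le_top) :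
    CoskCell.tgt (liftFun f y) = liftFun f (Y.tgt y) := by
  by_cases h' : ((k + 1 : ℕ) : ℕ∞) ≤ n
  · rw [liftFun_low f y h', liftFun_low f (Y.tgt y) (dim_pred h')]
    exact congrArg (CoskCell.low _) (f.tgt_app (h := h') y)
  · by_cases e : k = n
    · rw [liftFun_low f (Y.tgt y) (by rw [e]), liftFun_top f y e, CoskCell.tgt_mkPair]
    · have h := CoskCell.lt_of_not h' e
      rw [liftFun_high f y h]
      induction k with
      | zero => omega
      | succ k ih =>
        change liftFun f (Y.src y) = _
        refine CoskCell.ext_high (CoskCell.not_dim h) ?_ ?_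
        · rw [liftFun_src, liftFun_src, Y.src_src]
        · by_cases e' : k = n
          · rw [liftFun_top f (Y.src y) e', liftFun_top f (Y.tgt y) e', CoskCell.tgt_mkPair,
              CoskCell.tgt_mkPair, Y.tgt_src]
          · have h₁ : n < k := by omega
            have aux : ∀ z : Y.cell (k + 1) le_top,
                CoskCell.tgt (liftFun f z) = liftFun f (Y.tgt z) := fun z => by
              rw [liftFun_high f z h₁]
              exact ih z (CoskCell.not_dim (by omega)) e' h₁
            rw [aux, aux, Y.tgt_src]

/-- The map into the coskeleton corresponding to a map `R Y ⟶ X`. -/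
noncomputable def lift (f : (R n).obj Y ⟶ X) : Y ⟶ cosk X :=
  GlobSet.Hom.mk (fun y => liftFun f y) (fun y => liftFun_src f y) (fun y => liftFun_tgt f y)

theorem lift_counit (f : (R n).obj Y ⟶ X) : (R n).map (lift f) ≫ counit X = f := by
  refine GlobSet.hom_ext fun k h y => ?_
  change CoskCell.toCell (liftFun f _) h = _
  rw [liftFun_low f _ h]
  rfl

/-- Up to dimension `n` the counit detects cells; above it cells are detected by their boundaries,
and induction on the dimension takes over. -/
theorem hom_ext {a b : Y ⟶ cosk X} (w : (R n).map a ≫ counit X = (R n).map b ≫ counit X) :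
    a = b := by
  refine GlobSet.hom_ext fun k h y => ?_
  have low : ∀ {k : ℕ} (y : Y.cell k le_top), (k : ℕ∞) ≤ n → a.app y = b.app y := fun {k} y h' => by
    have := congrArg (fun r : (R n).obj Y ⟶ X => r.app (h := h') y) w
    change CoskCell.toCell (a.app y) h' = CoskCell.toCell (b.app y) h' at this
    exact (CoskCell.low_toCell (a.app y) h').symm.trans
      ((congrArg (CoskCell.low h') this).trans (CoskCell.low_toCell (b.app y) h'))
  induction k with
  | zero => exact low y (dim_zero _)
  | succ k ih =>
    by_cases h' : ((k + 1 : ℕ) : ℕ∞) ≤ n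
    · exact low y h'
    · refine CoskCell.ext_high h' ?_ ?_
      · exact (a.src_app y).trans ((ih _ _).trans (b.src_app y).symm)
      · exact (a.tgt_app y).trans ((ih _ _).trans (b.tgt_app y).symm)

end cosk

end GlobSet

/-! ### The coskeleton of a `T_n`-operad. -/

namespace Operad

variable {n : ℕ} (D : Operad.{u} n)

open cosk

/-- The underlying globular set of the coskeleton of `D`. -/
noncomputable abbrev coskC : GlobSet.{u} ⊤ :=
  pb (cosk.lift (cosk.counit D.C ≫ D.d)) (cosk.lift (down (le_top : (n : ℕ∞) ≤ ⊤) (pt ⊤)))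

noncomputable abbrev coskD : D.coskC ⟶ (T ⊤).obj (pt ⊤) := pb.snd _ _

/-- The counit of the coskeleton of `D`. -/
noncomputable def coskCounit : (R n).obj D.coskC ⟶ D.C :=
  (R n).map (pb.fst _ _) ≫ cosk.counit D.C

theorem coskCounit_d : D.coskCounit ≫ D.d = (R n).map D.coskD ≫ down le_top (pt ⊤) := by
  rw [coskCounit, Category.assoc]
  refine Eq.trans (congrArg ((R n).map (pb.fst _ _) ≫ ·)
    (cosk.lift_counit (cosk.counit D.C ≫ D.d)).symm) ?_
  rw [res_comp_assoc, pb.condition, ← res_comp_assoc, cosk.lift_counit]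

variable {D}

theorem cosk_w {Y : GlobSet.{u} ⊤} (a : Y ⟶ (T ⊤).obj (pt ⊤)) (b : (R n).obj Y ⟶ D.C)
    (w : b ≫ D.d = (R n).map a ≫ down le_top (pt ⊤)) :
    cosk.lift b ≫ cosk.lift (cosk.counit D.C ≫ D.d) = a ≫ cosk.lift (down le_top (pt ⊤)) := by
  apply cosk.hom_ext
  rw [Functor.map_comp, Functor.map_comp, Category.assoc, Category.assoc, cosk.lift_counit,
    cosk.lift_counit, ← Category.assoc, cosk.lift_counit, w]

/-- Maps into the coskeleton of `D`. -/
noncomputable def coskLift {Y : GlobSet.{u} ⊤} (a : Y ⟶ (T ⊤).obj (pt ⊤)) (b : (R n).obj Y ⟶ D.C)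
    (w : b ≫ D.d = (R n).map a ≫ down le_top (pt ⊤)) : Y ⟶ D.coskC :=
  pb.lift (cosk.lift b) a (cosk_w a b w)

theorem coskLift_counit {Y : GlobSet.{u} ⊤} (a : Y ⟶ (T ⊤).obj (pt ⊤)) (b : (R n).obj Y ⟶ D.C)
    (w) : (R n).map (coskLift a b w) ≫ D.coskCounit = b := cosk.lift_counit b

/-- This splits each operad law for the coskeleton into a law of the monad `T`, for the shapes, and
the corresponding law of `D`, for the image under the counit. -/
theorem cosk_ext {Y : GlobSet.{u} ⊤} {a b : Y ⟶ D.coskC} (h₁ : a ≫ D.coskD = b ≫ D.coskD)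
    (h₂ : (R n).map a ≫ D.coskCounit = (R n).map b ≫ D.coskCounit) : a = b := by
  refine pb.hom_ext (cosk.hom_ext ?_) h₁
  rw [Functor.map_comp, Functor.map_comp, Category.assoc, Category.assoc]
  exact h₂

variable (D)

theorem cosk_w_pair {Y : GlobSet.{u} ⊤} {a : Y ⟶ (T ⊤).obj D.coskC} {b : Y ⟶ D.coskC}
    (w : a ≫ (T ⊤).map (toPt D.coskC) = b ≫ D.coskD) :
    ((R n).map a ≫ down le_top D.coskC ≫ (T n).map D.coskCounit) ≫ (T n).map (toPt D.C) =
      ((R n).map b ≫ D.coskCounit) ≫ D.d := by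
  rw [Category.assoc, Category.assoc, ← Functor.map_comp, Category.assoc, coskCounit_d,
    res_comp_assoc, ← w, ← res_comp_assoc, down_naturality]
  rfl

/-- The counit on pairs of composable operations. -/
noncomputable def coskPair : (R n).obj (pb ((T ⊤).map (toPt D.coskC)) D.coskD) ⟶
    pb ((T n).map (toPt D.C)) D.d := pb.lift _ _ (D.cosk_w_pair (pb.condition _ _))

theorem coskPair_fst : D.coskPair ≫ pb.fst _ _ = (R n).map (pb.fst _ _) ≫
    down le_top D.coskC ≫ (T n).map D.coskCounit := rfl

theorem coskPair_snd : D.coskPair ≫ pb.snd _ _ = (R n).map (pb.snd _ _) ≫ D.coskCounit := rfl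

theorem coskComp_w : (D.coskPair ≫ D.comp) ≫ D.d = (R n).map
    (pb.fst _ _ ≫ (T ⊤).map D.coskD ≫ (T ⊤).μ.app _) ≫ down le_top (pt ⊤) := by
  rw [Category.assoc, D.comp_d, ← Category.assoc, coskPair_fst, Functor.map_comp,
    Functor.map_comp, Category.assoc, Category.assoc, Category.assoc, Category.assoc, down_mul,
    down_naturality_assoc, ← Category.assoc ((T n).map D.coskCounit), ← Functor.map_comp,
    coskCounit_d, Functor.map_comp, Category.assoc]

noncomputable def coskComp : pb ((T ⊤).map (toPt D.coskC)) D.coskD ⟶ D.coskC :=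
  coskLift (pb.fst _ _ ≫ (T ⊤).map D.coskD ≫ (T ⊤).μ.app _) (D.coskPair ≫ D.comp) D.coskComp_w

noncomputable def coskIds : pt ⊤ ⟶ D.coskC :=
  coskLift ((T ⊤).η.app (pt ⊤)) D.ids (D.ids_d.trans (unit_down (le_top : (n : ℕ∞) ≤ ⊤) (pt ⊤)).symm)

theorem coskComp_d : D.coskComp ≫ D.coskD = pb.fst _ _ ≫ (T ⊤).map D.coskD ≫ (T ⊤).μ.app _ := rfl

theorem coskComp_counit : (R n).map D.coskComp ≫ D.coskCounit = D.coskPair ≫ D.comp :=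
  coskLift_counit _ _ _

theorem coskIds_d : D.coskIds ≫ D.coskD = (T ⊤).η.app (pt ⊤) := rfl

theorem coskIds_counit : (R n).map D.coskIds ≫ D.coskCounit = D.ids := coskLift_counit _ _ _

theorem lift_coskComp_d {Y : GlobSet.{u} ⊤} {a : Y ⟶ (T ⊤).obj D.coskC} {b : Y ⟶ D.coskC}
    (w : a ≫ (T ⊤).map (toPt D.coskC) = b ≫ D.coskD) : (pb.lift a b w ≫ D.coskComp) ≫ D.coskD =
      a ≫ (T ⊤).map D.coskD ≫ (T ⊤).μ.app _ := rfl

theorem lift_coskComp_counit {Y : GlobSet.{u} ⊤} {a : Y ⟶ (T ⊤).obj D.coskC} {b : Y ⟶ D.coskC}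
    (w : a ≫ (T ⊤).map (toPt D.coskC) = b ≫ D.coskD) :
    (R n).map (pb.lift a b w ≫ D.coskComp) ≫ D.coskCounit =
      pb.lift _ _ (D.cosk_w_pair w) ≫ D.comp := by
  rw [Functor.map_comp, Category.assoc, coskComp_counit]
  rfl

/-- The coskeleton of a `T_n`-operad. -/
noncomputable def cosk : Operad.{u} ⊤ where
  C := D.coskC
  d := D.coskD
  ids := D.coskIds
  comp := D.coskComp
  ids_d := D.coskIds_d
  comp_d := D.coskComp_d
  ids_comp w := by
    apply cosk_ext
    · rw [lift_coskComp_d, ← Category.assoc, ← unit_nat, Category.assoc, (T _).left_unit]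
      rfl
    · rw [lift_coskComp_counit]
      have k := congrArg (fun r => D.coskCounit ≫ r) (D.ids_comp (D.w_unit _))
      refine Eq.trans (Eq.trans ?_ (D.pre_comp D.coskCounit (D.w_unit _)).symm) k
      refine D.comp_congr ?_ ?_ _ _
      · rw [← Category.assoc, unit_down, unit_nat]
      · rw [Functor.map_comp, Category.assoc, coskIds_counit]
        rfl
  comp_ids w := by
    apply cosk_ext
    · rw [lift_coskComp_d, Category.assoc, ← Category.assoc ((T _).map _), ← Functor.map_comp,
        coskIds_d, (T _).right_unit]
      rfl
    · rw [lift_coskComp_counit]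
      have k := congrArg (fun r => D.coskCounit ≫ r) (D.comp_ids D.w_ids)
      refine Eq.trans (Eq.trans ?_ (D.pre_comp D.coskCounit D.w_ids).symm) k
      refine D.comp_congr ?_ rfl _ _
      rw [Functor.map_comp, Category.assoc, down_naturality_assoc, ← Functor.map_comp,
        coskIds_counit, ← Category.assoc, ← Category.assoc, coskCounit_d]
  assoc w₁ w₂ w₃ := by
    apply cosk_ext
    · rw [lift_coskComp_d, lift_coskComp_d, Category.assoc, Category.assoc, Category.assoc,
        ← Category.assoc ((T _).μ.app _), ← mul_nat, Category.assoc, ← (T _).assoc,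
        ← Category.assoc ((T _).map D.coskComp), ← Functor.map_comp, coskComp_d,
        Functor.map_comp, Functor.map_comp, Category.assoc, Category.assoc]
    · rw [lift_coskComp_counit, lift_coskComp_counit]
      -- The counit induces a map from threefold composites in the coskeleton to those in `D`;
      -- associativity in `D` is pulled back along it.
      have hv : ((R n).map
          (pb.fst ((T ⊤).map (toPt (pb ((T ⊤).map (toPt D.coskC)) D.coskD))) D.coskD) ≫
            down _ _ ≫ (T n).map D.coskPair) ≫ (T n).map (toPt (pb ((T n).map (toPt D.C)) D.d)) =
          ((R n).map (pb.snd _ _) ≫ D.coskCounit) ≫ D.d := by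
        rw [Category.assoc, Category.assoc, ← Functor.map_comp, Category.assoc, coskCounit_d,
          res_comp_assoc, ← pb.condition, ← res_comp_assoc, down_naturality]
        rfl
      have k := congrArg (fun r => pb.lift _ _ hv ≫ r)
        (D.assoc (D.w_map _) (D.w_sub _) (D.w_mul _))
      refine Eq.trans (Eq.trans ?_ (D.pre_comp (pb.lift _ _ hv) (D.w_map _)).symm)
        (k.trans (Eq.trans (D.pre_comp (pb.lift _ _ hv) (D.w_mul _)) ?_))
      · refine D.comp_congr ?_ rfl _ _
        rw [pb.lift_fst_assoc, Functor.map_comp, Category.assoc, Category.assoc, Category.assoc,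
          ← Functor.map_comp, ← coskComp_counit, down_naturality_assoc, ← Functor.map_comp]
      · refine D.comp_congr ?_ ?_ _ _
        · rw [pb.lift_fst_assoc, Functor.map_comp, Functor.map_comp, Category.assoc,
            Category.assoc, Category.assoc, Category.assoc,
            ← Category.assoc ((R n).map ((T _).μ.app _)), down_mul,
            ← Category.assoc ((T n).map D.coskPair), ← Functor.map_comp, coskPair_fst,
            Category.assoc, Category.assoc, ← mul_nat,
            down_naturality_assoc, Functor.map_comp, Functor.map_comp, Category.assoc,
            Category.assoc]
        · rw [lift_coskComp_counit]
          refine Eq.trans (D.pre_comp (pb.lift _ _ hv) (D.w_sub _)) ?_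
          refine D.comp_congr ?_ rfl _ _
          rw [pb.lift_fst_assoc, Functor.map_comp, Category.assoc, Category.assoc, Category.assoc,
            ← Functor.map_comp, coskPair_snd, down_naturality_assoc, ← Functor.map_comp]

end Operad

/-! ### The precontraction on the coskeleton, and cofreeness. -/

namespace OWP

variable {n : ℕ} (D : OWP.{u} n)

open cosk

theorem low_coskCounit {k : ℕ} (h : (k : ℕ∞) ≤ n) (θ : D.coskC.cell k le_top) :
    CoskCell.low h (D.coskCounit.app (h := h) θ) = θ.1.1 := CoskCell.low_toCell θ.1.1 h

theorem coskCounit_d_app {k : ℕ} (h : (k : ℕ∞) ≤ n) (θ : D.coskC.cell k le_top) :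
    D.d.app (D.coskCounit.app (h := h) θ) =
      (down le_top (pt ⊤)).app (h := h) (D.coskD.app θ) :=
  congrArg (fun r : (R n).obj D.coskC ⟶ (T n).obj (pt n) => r.app (h := h) θ) D.coskCounit_d

theorem cosk_parallel {k : ℕ} (h : (k : ℕ∞) ≤ n) {θ₀ θ₁ : D.coskC.cell k le_top}
    (w : D.coskC.Parallel θ₀ θ₁) :
    D.C.Parallel (D.coskCounit.app (h := h) θ₀) (D.coskCounit.app (h := h) θ₁) :=
  parallel_map D.coskCounit (h := h) (by
    cases k with
    | zero => trivial
    | succ k => exact w)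

/-- Needed for the target of the precontraction above dimension `n + 1`: there `coskκ` stores only
the cell of `θ₀`, which must also be that of `θ₁`. -/
theorem cosk_parallel_high {k : ℕ} {θ₀ θ₁ : D.coskC.cell k le_top}
    (w : D.coskC.Parallel θ₀ θ₁) (hk : n < k) : θ₀.1.1 = θ₁.1.1 := by
  cases k with
  | zero => omega
  | succ k =>
    refine CoskCell.ext_high (CoskCell.not_dim hk) ?_ ?_
    · exact congrArg (fun z : D.coskC.cell k le_top => z.1.1) w.1
    · exact congrArg (fun z : D.coskC.cell k le_top => z.1.1) w.2

section

variable {k : ℕ} (π : ((T.{u} ⊤).obj (pt ⊤)).cell (k + 1) le_top)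
    (θ₀ θ₁ : D.coskC.cell k le_top) (w₀ : D.coskD.app θ₀ = ((T _).obj (pt _)).src π)
    (w₁ : D.coskD.app θ₁ = ((T _).obj (pt _)).tgt π) (w : D.coskC.Parallel θ₀ θ₁)

open Classical in
/-- The cell underlying the value of the precontraction on the coskeleton of `D`. -/
noncomputable def coskκ : CoskCell D.C (k + 1) :=
  if h' : ((k + 1 : ℕ) : ℕ∞) ≤ n then
    CoskCell.low h' (D.κ (h := h') ((down le_top (pt ⊤)).app (h := h') π)
      (D.coskCounit.app (h := dim_pred h') θ₀) (D.coskCounit.app (h := dim_pred h') θ₁)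
      ((D.coskCounit_d_app _ θ₀).trans ((congrArg _ w₀).trans
        ((down le_top (pt ⊤)).src_app (h := h') π).symm))
      ((D.coskCounit_d_app _ θ₁).trans ((congrArg _ w₁).trans
        ((down le_top (pt ⊤)).tgt_app (h := h') π).symm))
      (D.cosk_parallel _ w))
  else if e : k = n then CoskCell.mkPair e (D.coskCounit.app (h := by rw [e]) θ₀)
    (D.coskCounit.app θ₁) (D.cosk_parallel _ w)
  else CoskCell.same (CoskCell.lt_of_not h' e) θ₀.1.1

theorem src_coskκ : CoskCell.src (D.coskκ π θ₀ θ₁ w₀ w₁ w) = θ₀.1.1 := by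
  rw [coskκ]
  split_ifs with h' e
  · exact (congrArg (CoskCell.low _) (D.src_κ _ _ _ _ _ _)).trans (D.low_coskCounit _ θ₀)
  · exact (CoskCell.src_mkPair _ _ _ _).trans (D.low_coskCounit _ θ₀)
  · rfl

theorem tgt_coskκ : CoskCell.tgt (D.coskκ π θ₀ θ₁ w₀ w₁ w) = θ₁.1.1 := by
  rw [coskκ]
  split_ifs with h' e
  · exact (congrArg (CoskCell.low _) (D.tgt_κ _ _ _ _ _ _)).trans (D.low_coskCounit _ θ₁)
  · exact (CoskCell.tgt_mkPair _ _ _ _).trans (D.low_coskCounit _ θ₁)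
  · exact D.cosk_parallel_high w (CoskCell.lt_of_not h' e)

/-- Up to dimension `n` this is `D.d_κ`. Above it, cells of a coskeleton are equal once their
boundaries are, and on boundaries the equation says that `θ₀` and `θ₁` have the shapes prescribed by
`π`. -/
theorem coskκ_condition : (cosk.lift (cosk.counit D.C ≫ D.d)).app (D.coskκ π θ₀ θ₁ w₀ w₁ w) =
      (cosk.lift (down le_top (pt ⊤))).app π := by
  by_cases h' : ((k + 1 : ℕ) : ℕ∞) ≤ n
  · refine (cosk.liftFun_low _ (Y := GlobSet.cosk D.C) _ h').trans
      (Eq.trans ?_ (cosk.liftFun_low _ _ h').symm)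
    refine congrArg (CoskCell.low h') ?_
    simp only [coskκ, h', dite_true]
    exact D.d_κ _ _ _ _ _ _
  · refine CoskCell.ext_high h' ?_ ?_
    · refine ((cosk.lift (cosk.counit D.C ≫ D.d)).src_app _).trans
        (Eq.trans ?_ ((cosk.lift _).src_app π).symm)
      refine (congrArg (cosk.lift (cosk.counit D.C ≫ D.d)).app
        (D.src_coskκ π θ₀ θ₁ w₀ w₁ w)).trans (θ₀.2.trans ?_)
      exact congrArg (cosk.lift _).app w₀
    · refine ((cosk.lift (cosk.counit D.C ≫ D.d)).tgt_app _).trans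
        (Eq.trans ?_ ((cosk.lift _).tgt_app π).symm)
      refine (congrArg (cosk.lift (cosk.counit D.C ≫ D.d)).app
        (D.tgt_coskκ π θ₀ θ₁ w₀ w₁ w)).trans (θ₁.2.trans ?_)
      exact congrArg (cosk.lift _).app w₁

end

/-- The coskeleton of an operad with precontraction. -/
noncomputable def cosk : OWP.{u} ⊤ where
  toOperad := D.toOperad.cosk
  κ π θ₀ θ₁ w₀ w₁ w := ⟨(D.coskκ π θ₀ θ₁ w₀ w₁ w, π), D.coskκ_condition π θ₀ θ₁ w₀ w₁ w⟩
  d_κ _ _ _ _ _ _ := rfl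
  src_κ π θ₀ θ₁ w₀ w₁ w := Subtype.ext (Prod.ext (D.src_coskκ π θ₀ θ₁ w₀ w₁ w) w₀.symm)
  tgt_κ π θ₀ θ₁ w₀ w₁ w := Subtype.ext (Prod.ext (D.tgt_coskκ π θ₀ θ₁ w₀ w₁ w) w₁.symm)

/-- The counit of the coskeleton, as a restricted map. -/
noncomputable def coskRes : ResHom le_top D.cosk D where
  map := D.coskCounit
  map_d := D.coskCounit_d
  map_ids := D.coskIds_counit
  map_comp _ := D.coskComp_counit
  map_κ {k h} π θ₀ θ₁ w₀ w₁ w w₀' w₁' w' := by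
    change CoskCell.toCell (D.coskκ π θ₀ θ₁ w₀ w₁ w) h = _
    simp only [coskκ, h, dite_true]
    rfl

theorem coskRes_isCofree : D.coskRes.IsCofree where
  exists_lift a b w := ⟨Operad.coskLift a b w, rfl, Operad.coskLift_counit a b w⟩
  hom_ext h₁ h₂ := Operad.cosk_ext h₁ h₂
  low_ext {k} h {x y} h₁ h₂ := by
    refine Subtype.ext (Prod.ext ?_ h₁)
    exact (D.low_coskCounit h x).symm.trans ((congrArg (CoskCell.low h) h₂).trans
      (D.low_coskCounit h y))
  high_ext {k} h h' {x y} hd hs ht := by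
    refine Subtype.ext (Prod.ext (CoskCell.ext_high h' ?_ ?_) hd)
    · exact congrArg (fun z : D.coskC.cell k le_top => z.1.1) hs
    · exact congrArg (fun z : D.coskC.cell k le_top => z.1.1) ht

end OWP

/-! ### Contractions as cofreeness, and initiality of `S R L`. -/

namespace OWP

variable {N M : ℕ∞}

theorem down_injective (e : M ≤ N) (X : GlobSet.{u} N) {k : ℕ} {h : (k : ℕ∞) ≤ M}
    {x y : ((T N).obj X).cell k (h.trans e)}
    (w : (down e X).app (h := h) x = (down e X).app (h := h) y) : x = y := by
  have key := fun z : ((T N).obj X).cell k (h.trans e) => congrArg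
    (fun r : (GlobSet.res e).obj ((T N).obj X) ⟶ _ => r.app (h := h) z) (down_up e X)
  exact (key x).symm.trans ((congrArg (up e X).app w).trans (key y))

/-- The hypothesis on shapes in `low_ext` comes for free: `ε` preserves shapes up to `down`, which
is injective. -/
theorem ResHom.IsCofree.injective {e : M ≤ N} {Q : OWP.{u} N} {D : OWP.{u} M} {ε : ResHom e Q D}
    (hε : ε.IsCofree) {k : ℕ} (h : (k : ℕ∞) ≤ M) {x y : Q.C.cell k (h.trans e)}
    (w : ε.map.app (h := h) x = ε.map.app (h := h) y) : x = y := by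
  refine hε.low_ext h (down_injective e _ (h := h) ?_) w
  rw [← ε.d_app, ← ε.d_app, w]

section Contraction

variable {m : ℕ} (P : OWP.{u} (m + 1 : ℕ)) {Y : GlobSet.{u} (m + 1 : ℕ)}
  {a : Y ⟶ (T (m + 1 : ℕ)).obj (pt (m + 1 : ℕ))}
  {b : (GlobSet.res (dim_le_succ m)).obj Y ⟶ (GlobSet.res (dim_le_succ m)).obj P.C}

theorem contrFun_d (w : b ≫ (P.res (dim_le_succ m)).d = (GlobSet.res (dim_le_succ m)).map a ≫
    down (dim_le_succ m) (pt (m + 1 : ℕ))) {k : ℕ} {h : (k : ℕ∞) ≤ m} (y : Y.cell k (h.trans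
      (dim_le_succ m))) : P.d.app (b.app (h := h) y) = a.app y :=
  down_injective (dim_le_succ m) _ (h := h) (congrArg
    (fun r : (GlobSet.res (dim_le_succ m)).obj Y ⟶ (T m).obj (pt m) => r.app (h := h) y) w)

theorem contrFun_parallel (b : (GlobSet.res (dim_le_succ m)).obj Y ⟶
    (GlobSet.res (dim_le_succ m)).obj P.C) : ∀ {k : ℕ} (h₀ : (k : ℕ∞) ≤ m)
    {h : ((k + 1 : ℕ) : ℕ∞) ≤ (m + 1 : ℕ)} (y : Y.cell (k + 1) h),
    P.C.Parallel (b.app (h := h₀) (Y.src y)) (b.app (h := h₀) (Y.tgt y)) := fun h₀ _ y =>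
  parallel_res (dim_le_succ m) (h := h₀) (coskel.par_aux b h₀ y)

open Classical in
/-- The extension of a map to top-dimensional cells by the precontraction. -/
noncomputable def contrFun (w : b ≫ (P.res (dim_le_succ m)).d =
    (GlobSet.res (dim_le_succ m)).map a ≫ down (dim_le_succ m) (pt (m + 1 : ℕ))) :
    ∀ {k : ℕ} {h : (k : ℕ∞) ≤ (m + 1 : ℕ)}, Y.cell k h → P.C.cell k h
  | 0, _, y => b.app (h := dim_zero _) y
  | k + 1, h, y =>
    if h' : ((k + 1 : ℕ) : ℕ∞) ≤ m then b.app (h := h') y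
    else P.κ (a.app y) (b.app (h := dim_pred_succ h) (Y.src y)) (b.app (h := dim_pred_succ h) (Y.tgt y))
      ((P.contrFun_d w (h := dim_pred_succ h) _).trans (a.src_app y).symm)
      ((P.contrFun_d w (h := dim_pred_succ h) _).trans (a.tgt_app y).symm)
      (P.contrFun_parallel b _ y)

variable (w : b ≫ (P.res (dim_le_succ m)).d =
    (GlobSet.res (dim_le_succ m)).map a ≫ down (dim_le_succ m) (pt (m + 1 : ℕ)))

theorem contrFun_low {k : ℕ} {h : (k : ℕ∞) ≤ (m + 1 : ℕ)} (h' : (k : ℕ∞) ≤ m) (y : Y.cell k h) :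
    P.contrFun w y = b.app (h := h') y := by
  cases k with
  | zero => rfl
  | succ k => simp only [contrFun, h', dite_true]

/-- The map extended to top-dimensional cells by the precontraction. -/
noncomputable def contrHom : Y ⟶ P.C :=
  GlobSet.Hom.mk (fun y => P.contrFun w y)
    (fun {k h} y => by
      refine Eq.trans ?_ (P.contrFun_low w (dim_pred_succ h) (Y.src y)).symm
      by_cases h' : ((k + 1 : ℕ) : ℕ∞) ≤ m
      · rw [contrFun_low P w h' y]
        exact b.src_app (h := h') y
      · simp only [contrFun, h', dite_false]
        exact P.src_κ _ _ _ _ _ _)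
    (fun {k h} y => by
      refine Eq.trans ?_ (P.contrFun_low w (dim_pred_succ h) (Y.tgt y)).symm
      by_cases h' : ((k + 1 : ℕ) : ℕ∞) ≤ m
      · rw [contrFun_low P w h' y]
        exact b.tgt_app (h := h') y
      · simp only [contrFun, h', dite_false]
        exact P.tgt_κ _ _ _ _ _ _)

theorem contrHom_d : P.contrHom w ≫ P.d = a := by
  refine GlobSet.hom_ext fun k h y => ?_
  change P.d.app (P.contrFun w y) = _
  by_cases h' : (k : ℕ∞) ≤ m
  · rw [contrFun_low P w h' y]
    exact P.contrFun_d w (h := h') y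
  · cases k with
    | zero => exact absurd (dim_zero _) h'
    | succ k =>
      simp only [contrFun, h', dite_false]
      exact P.d_κ _ _ _ _ _ _

/-- A `T_{m+1}`-operad with a contraction is determined by its restriction to dimension `m`. -/
theorem unit_isCofree (hP : IsContraction (m + 1) P) :
    (ResHom.unit P (dim_le_succ m)).IsCofree where
  -- Existence needs only the precontraction, which fills in the cells of dimension `m + 1`; that
  -- `P` is a contraction serves for uniqueness.
  exists_lift a b w := ⟨P.contrHom w, P.contrHom_d w,
    GlobSet.hom_ext fun _ h y => P.contrFun_low w h y⟩
  hom_ext {Y} a b h₁ h₂ := by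
    have low : ∀ {k : ℕ} {h : (k : ℕ∞) ≤ (m + 1 : ℕ)} (y : Y.cell k h), (k : ℕ∞) ≤ m →
        a.app y = b.app y := fun {k h} y h' => congrArg
      (fun r : (GlobSet.res (dim_le_succ m)).obj Y ⟶ (GlobSet.res (dim_le_succ m)).obj P.C =>
        r.app (h := h') y) h₂
    refine GlobSet.hom_ext fun k h y => ?_
    by_cases h' : (k : ℕ∞) ≤ m
    · exact low y h'
    · cases k with
      | zero => exact absurd (dim_zero _) h'
      | succ k =>
        obtain rfl := SCell.eq_of_not h h'
        refine hP _ _ (congrArg (fun r : Y ⟶ (T _).obj (pt _) => r.app y) h₁) ?_ ?_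
        · rw [a.src_app, b.src_app, low _ le_rfl]
        · rw [a.tgt_app, b.tgt_app, low _ le_rfl]
  low_ext _ _ _ _ w := w
  high_ext {k} h h' x y hd hs ht := by
    obtain rfl := SCell.eq_of_not h h'
    exact hP _ _ hd hs ht

end Contraction

section Initial

variable {m : ℕ}

/-- Restricted maps from `L` to `D` are the maps from `L` to `D.cosk`. In other words, restriction
is a left adjoint and preserves the initial object. -/
theorem ResHom.unique_of_isInitial {L : OWC.{u}} (hL : Limits.IsInitial L) {e : (m : ℕ∞) ≤ ⊤} {D : OWP.{u} m}
    (f g : ResHom e L D) : f.map = g.map := by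
  obtain ⟨f₁, hf⟩ := D.coskRes_isCofree.lift f
  obtain ⟨g₁, hg⟩ := D.coskRes_isCofree.lift g
  rw [← hf, ← hg, hL.hom_ext f₁ g₁]

/-- The canonical map from the restriction of `L` to dimension `m + 1` to `S` of the restriction of
`L` to dimension `m`. -/
theorem exists_toSus (L : OWC.{u}) (m : ℕ) :
    ∃ q : L.res (le_top : ((m + 1 : ℕ) : ℕ∞) ≤ ⊤) ⟶ (L.res (le_top : (m : ℕ∞) ≤ ⊤)).sus,
      (GlobSet.res (dim_le_succ m)).map q.hom.map ≫ (L.res le_top).susRes.map = 𝟙 _ :=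
  (susRes_isCofree _).lift (ResHom.resRes L le_top (dim_le_succ m))

variable {D : OWP.{u} m} {P : OWP.{u} (m + 1 : ℕ)} {q : P ⟶ D.sus}
  {s : D.C ⟶ (GlobSet.res (dim_le_succ m)).obj P.C}

/-- Both sides have the same image under the counit, which is injective in dimensions up to `m`. -/
theorem low_section (hs : s ≫ (GlobSet.res (dim_le_succ m)).map q.hom.map ≫ D.susRes.map = 𝟙 _)
    {k : ℕ} (h : (k : ℕ∞) ≤ m) (x : D.sus.C.cell k (h.trans (dim_le_succ m))) :
    q.hom.map.app (s.app (h := h) (D.susRes.map.app (h := h) x)) = x :=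
  D.susRes_isCofree.injective h (congrArg (fun r : D.C ⟶ D.C =>
    r.app (h := h) (D.susRes.map.app (h := h) x)) hs)

/-- In dimension `m + 1` the boundary of `x` is lifted through `s` to a parallel pair, and the
precontraction of `P` fills this pair in the shape of `x`. The image of the filler has the shape and
the boundary of `x`, hence equals `x`. -/
theorem surjective_of_section
    (hs : s ≫ (GlobSet.res (dim_le_succ m)).map q.hom.map ≫ D.susRes.map = 𝟙 _)
    {k : ℕ} {h : (k : ℕ∞) ≤ (m + 1 : ℕ)} (x : D.sus.C.cell k h) :
    ∃ y : P.C.cell k h, q.hom.map.app y = x := by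
  by_cases h' : (k : ℕ∞) ≤ m
  · exact ⟨_, low_section hs h' x⟩
  · cases k with
    | zero => exact absurd (dim_zero _) h'
    | succ k =>
      have h₀ : (k : ℕ∞) ≤ m := dim_pred_succ h
      have e₀ := low_section hs h₀ (D.sus.C.src x)
      have e₁ := low_section hs h₀ (D.sus.C.tgt x)
      have hp : P.C.Parallel (s.app (h := h₀) (D.susRes.map.app (h := h₀) (D.sus.C.src x)))
          (s.app (h := h₀) (D.susRes.map.app (h := h₀) (D.sus.C.tgt x))) :=
        parallel_res (dim_le_succ m) (h := h₀) (parallel_map s (coskel.par_aux D.susRes.map h₀ x))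
      refine ⟨P.κ (h := h) (D.sus.d.app x) _ _ ?_ ?_ hp, ?_⟩
      · rw [← hom_d q, e₀, D.sus.d.src_app]
      · rw [← hom_d q, e₁, D.sus.d.tgt_app]
      · refine D.susRes_isCofree.high_ext h h' ?_ ?_ ?_
        · rw [hom_d, P.d_κ]
        · rw [q.hom.map.src_app, P.src_κ, e₀]
        · rw [q.hom.map.tgt_app, P.tgt_κ, e₁]

end Initial

end OWP

open OWP

/-- If `L` is initial, then so is `S` of its restriction. -/
theorem OWCn.isInitial_sus {L : OWC.{u}} (hL : Limits.IsInitial L) (m : ℕ) :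
    Nonempty (Limits.IsInitial (OWCn.sus (L.res (le_top : (m : ℕ∞) ≤ ⊤)))) := by
  -- Since `P` is cofree on its restriction, a map from `S R L` to `P` amounts to a restricted map
  -- to `R P`. The latter is the counit of `S R L` followed by the map from `R L` to `R P` that
  -- comes from the map of `L` to the coskeleton of `R P`.
  have exists_hom : ∀ P : OWCn.{u} (m + 1),
      Nonempty ((L.res (le_top : (m : ℕ∞) ≤ ⊤)).sus ⟶ P.obj) := fun P => by
    have f := (P.obj.res (dim_le_succ m)).coskRes.precomp (hL.to _)
    obtain ⟨g, -⟩ := (P.obj.unit_isCofree P.property).lift ((L.res le_top).susRes.postcomp f.toRes)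
    exact ⟨g⟩
  refine ⟨Limits.IsInitial.ofUniqueHom (fun P => ObjectProperty.homMk (exists_hom P).some)
    fun P g => ?_⟩
  refine ObjectProperty.hom_ext _ ((P.obj.unit_isCofree P.property).ext ?_)
  refine GlobSet.hom_ext fun k h x => ?_
  obtain ⟨q, hq⟩ := exists_toSus L m
  -- Composed with `q`, both maps become restricted maps out of `L` and so agree. By `low_section`,
  -- `q` reaches every cell of dimension at most `m`, and those are the only ones left to compare.
  have key := ResHom.unique_of_isInitial hL
    (((ResHom.unit L le_top).postcomp (q ≫ g.hom)).trans (ResHom.unit P.obj (dim_le_succ m)))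
    (((ResHom.unit L le_top).postcomp (q ≫ (exists_hom P).some)).trans
      (ResHom.unit P.obj (dim_le_succ m)))
  have hx := low_section (q := q) (s := 𝟙 _) (by rw [hq]; rfl) h x
  refine (congrArg g.hom.hom.map.app hx).symm.trans
    (Eq.trans ?_ (congrArg (exists_hom P).some.hom.map.app hx))
  exact congrArg (fun r : (GlobSet.res (le_top : (m : ℕ∞) ≤ ⊤)).obj L.C ⟶ _ => r.app (h := h) _) key

/-! ### Equivalences of categories of algebras from comparisons of monads. -/

section MonadComparison

universe v₁ v₂ u₁ u₂

variable {A : Type u₁} [Category.{v₁} A] {B : Type u₂} [Category.{v₂} B]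

/-- A comparison `ν : R L ⟶ K R` of monads `L`, `K` along a functor `R`, with a section, such that
algebra structures on the objects satisfying `D` correspond under `R`. -/
structure MonadComparison (L : Monad A) (K : Monad B) (R : A ⥤ B) (D : A → Prop) where
  ν : ∀ X, R.obj (L.obj X) ⟶ K.obj (R.obj X)
  σ : ∀ X, K.obj (R.obj X) ⟶ R.obj (L.obj X)
  naturality : ∀ {X Y : A} (f : X ⟶ Y), R.map (L.map f) ≫ ν Y = ν X ≫ K.map (R.map f)
  unit : ∀ X, R.map (L.η.app X) ≫ ν X = K.η.app (R.obj X)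
  mul : ∀ X, R.map (L.μ.app X) ≫ ν X = ν (L.obj X) ≫ K.map (ν X) ≫ K.μ.app (R.obj X)
  sec : ∀ X, σ X ≫ ν X = 𝟙 _
  faithful : ∀ {Z X : A}, D X → ∀ f g : Z ⟶ X, R.map f = R.map g → f = g
  full : ∀ {Z X : A}, D Z → D X → ∀ g : R.obj Z ⟶ R.obj X, ∃ f, R.map f = g
  factor : ∀ {Z : A}, D Z → ∀ h : L.obj Z ⟶ Z, ν Z ≫ σ Z ≫ R.map h = R.map h
  lift : ∀ {Z : A}, D Z → ∀ k : K.obj (R.obj Z) ⟶ R.obj Z, ∃ h : L.obj Z ⟶ Z, R.map h = ν Z ≫ k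
  ess : ∀ Y : B, ∃ X, D X ∧ Nonempty (R.obj X ≅ Y)

namespace MonadComparison

variable {L : Monad A} {K : Monad B} {R : A ⥤ B} {D : A → Prop} (c : MonadComparison L K R D)

theorem naturality_assoc {X Y : A} (f : X ⟶ Y) {Z : B} (r : K.obj (R.obj Y) ⟶ Z) :
    R.map (L.map f) ≫ c.ν Y ≫ r = c.ν X ≫ K.map (R.map f) ≫ r := by
  rw [← Category.assoc, c.naturality, Category.assoc]

theorem mul_assoc (X : A) {Z : B} (r : K.obj (R.obj X) ⟶ Z) : R.map (L.μ.app X) ≫ c.ν X ≫ r =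
    c.ν (L.obj X) ≫ K.map (c.ν X) ≫ K.μ.app (R.obj X) ≫ r := by
  rw [← Category.assoc, c.mul, Category.assoc, Category.assoc]

/-- `ν` is a split epimorphism, so equations of `K`-algebras can be tested after composing with it.
The section `σ` need not be natural for this. -/
theorem hom_ext {X : A} {Z : B} {f g : K.obj (R.obj X) ⟶ Z} (w : c.ν X ≫ f = c.ν X ≫ g) :
    f = g := by
  have := congrArg (fun r => c.σ X ≫ r) w
  simp only [← Category.assoc, c.sec, Category.id_comp] at this
  exact this

/-- The twofold version, needed for associativity: `K.map (c.σ X)` is again a section of `K.map (c.ν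
X)`. -/
theorem map_hom_ext {X : A} {Z : B} {f g : K.obj (K.obj (R.obj X)) ⟶ Z}
    (w : c.ν (L.obj X) ≫ K.map (c.ν X) ≫ f = c.ν (L.obj X) ≫ K.map (c.ν X) ≫ g) : f = g := by
  have := congrArg (fun r => K.map (c.σ X) ≫ r) (c.hom_ext w)
  simp only [← Category.assoc, ← Functor.map_comp, c.sec, CategoryTheory.Functor.map_id,
    Category.id_comp] at this
  exact this

variable {c}

/-- The structure map of the `K`-algebra given by an `L`-algebra. -/
abbrev act (c : MonadComparison L K R D) (X : L.Algebra) :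
    K.obj (R.obj X.A) ⟶ R.obj X.A := c.σ X.A ≫ R.map X.a

/-- Although `act` is defined by a chosen section, the restricted structure map factors through `ν`,
so it does not see the choice. -/
theorem ν_act (X : L.Algebra) (hX : D X.A) : c.ν X.A ≫ c.act X = R.map X.a := c.factor hX X.a

/-- The `K`-algebra given by an `L`-algebra. -/
def algebra (c : MonadComparison L K R D) (X : L.Algebra) (hX : D X.A) : K.Algebra where
  A := R.obj X.A
  a := c.act X
  unit := by
    rw [← c.unit, Category.assoc, ν_act X hX, ← R.map_comp, X.unit]
    exact R.map_id _
  assoc := c.map_hom_ext (by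
    rw [← c.mul_assoc, ν_act X hX, ← R.map_comp, X.assoc, R.map_comp]
    refine (congrArg (R.map (L.map X.a) ≫ ·) (ν_act (c := c) X hX).symm).trans ?_
    refine (c.naturality_assoc _ _).trans (congrArg (c.ν _ ≫ ·) ?_)
    refine (congrArg (fun r => K.map r ≫ c.act X) (ν_act (c := c) X hX).symm).trans ?_
    rw [Functor.map_comp, Category.assoc])

/-- The functor on algebras induced by a comparison. -/
def functor (c : MonadComparison L K R D) :
    ObjectProperty.FullSubcategory (fun X : L.Algebra => D X.A) ⥤ K.Algebra where
  obj X := c.algebra X.obj X.property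
  map {X Y} f :=
    { f := R.map f.hom.f
      h := c.hom_ext (by
        change c.ν X.obj.A ≫ K.map (R.map f.hom.f) ≫ c.act Y.obj =
          c.ν X.obj.A ≫ c.act X.obj ≫ R.map f.hom.f
        rw [← Category.assoc, ← c.naturality, Category.assoc, ν_act _ Y.property, ← Category.assoc,
          ν_act _ X.property, ← R.map_comp, ← R.map_comp, f.hom.h]) }
  map_id X := by
    ext
    exact R.map_id _
  map_comp f g := by
    ext
    exact R.map_comp _ _

theorem functor_faithful : c.functor.Faithful where
  map_injective {X Y} f g w := by
    ext
    exact c.faithful Y.property _ _ (congrArg (fun r : c.functor.obj X ⟶ c.functor.obj Y => r.f) w)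

theorem functor_full : c.functor.Full where
  map_surjective {X Y} g := by
    obtain ⟨f, hf⟩ := c.full X.property Y.property g.f
    -- The algebra square is tested after `R`. It starts at `L X`, which need not satisfy `D`; this
    -- is why `faithful` constrains only the target.
    refine ⟨ObjectProperty.homMk ⟨f, c.faithful Y.property _ _ ?_⟩, ?_⟩
    · have h : K.map g.f ≫ c.act Y.obj = c.act X.obj ≫ g.f := g.h
      rw [R.map_comp, R.map_comp, ← ν_act (c := c) _ Y.property, c.naturality_assoc, hf]
      refine (congrArg (c.ν X.obj.A ≫ ·) h).trans ?_
      exact (Category.assoc _ _ _).symm.trans (congrArg (· ≫ g.f) (ν_act _ X.property))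
    · ext
      exact hf

/-- The `L`-algebra given by a `K`-algebra structure on `R X`. -/
theorem exists_algebra {X : A} (hX : D X) (k : K.obj (R.obj X) ⟶ R.obj X)
    (unit : K.η.app (R.obj X) ≫ k = 𝟙 _) (assoc : K.μ.app (R.obj X) ≫ k = K.map k ≫ k) :
    ∃ (h : L.obj X ⟶ X) (_ : L.η.app X ≫ h = 𝟙 _) (_ : L.μ.app X ≫ h = L.map h ≫ h),
      R.map h = c.ν X ≫ k := by
  obtain ⟨h, hh⟩ := c.lift hX k
  refine ⟨h, c.faithful hX _ _ ?_, c.faithful hX _ _ ?_, hh⟩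
  · rw [R.map_comp, hh, ← Category.assoc, c.unit, unit]
    exact (R.map_id _).symm
  · rw [R.map_comp, R.map_comp, hh, c.mul_assoc, c.naturality_assoc, assoc, hh, Functor.map_comp,
      Category.assoc]

theorem functor_essSurj : c.functor.EssSurj where
  mem_essImage Y := by
    obtain ⟨X, hX, ⟨e⟩⟩ := c.ess Y.A
    -- The structure of `Y` is first transported along `e` to the object `R X`, where it can be
    -- lifted.
    obtain ⟨h, h₁, h₂, hh⟩ := c.exists_algebra hX (K.map e.hom ≫ Y.a ≫ e.inv)
      (by
        have := K.η.naturality_assoc e.hom (Y.a ≫ e.inv)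
        simp only [Functor.id_map] at this
        rw [← this, ← Category.assoc (K.η.app _), Y.unit]
        exact (congrArg (e.hom ≫ ·) (Category.id_comp _)).trans e.hom_inv_id)
      (by
        have := K.μ.naturality_assoc e.hom (Y.a ≫ e.inv)
        simp only [Functor.comp_map] at this
        rw [← this, ← Category.assoc (K.μ.app _), Y.assoc]
        simp only [Functor.map_comp, Category.assoc]
        rw [← K.map_comp_assoc e.inv, e.inv_hom_id, CategoryTheory.Functor.map_id,
          Category.id_comp])
    refine ⟨⟨⟨X, h, h₁, h₂⟩, hX⟩, ⟨Monad.Algebra.isoMk e ?_⟩⟩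
    change K.map e.hom ≫ Y.a = (c.σ X ≫ R.map h) ≫ e.hom
    rw [hh, ← Category.assoc (c.σ X), c.sec]
    simp

theorem isEquivalence : c.functor.IsEquivalence where
  faithful := c.functor_faithful
  full := c.functor_full
  essSurj := c.functor_essSurj

end MonadComparison

end MonadComparison

/-! ### Operads in dimension zero. -/

section ZeroDim

/-- A term of dimension `0` is not an identity, and no two `0`-cells are composable, so only
generators remain. -/
theorem T_cell_zero {N : ℕ∞} {X : GlobSet.{u} N} {h : ((0 : ℕ) : ℕ∞) ≤ N}
    (x : ((T N).obj X).cell 0 h) : ∃ y : X.cell 0 h, ((T N).η.app X).app y = x := by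
  obtain ⟨a, ha, rfl⟩ := mk_surj (X := X) x
  cases a with
  | of h' y => exact ⟨y, rfl⟩
  | comp p a b => exact absurd ha.2.2 (by simp [Cmpb])

variable (P : OWP.{u} ((0 : ℕ) : ℕ∞))

/-- The only `0`-dimensional pasting diagram is the unit, which is the shape of the identity
operation. -/
theorem OWP.toPt_ids_d_zero : (toPt ((T ((0 : ℕ) : ℕ∞)).obj (pt _)) ≫ P.ids) ≫ P.d = 𝟙 _ := by
  rw [Category.assoc, P.ids_d]
  refine GlobSet.hom_ext fun k h x => ?_
  obtain rfl : k = 0 := by simpa using h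
  obtain ⟨y, rfl⟩ := T_cell_zero x
  rfl

/-- In dimension zero, the terminal operad is initial. -/
noncomputable def OWP.ofTerminalZero : OWP.terminal ((0 : ℕ) : ℕ∞) ⟶ P where
  hom :=
    { map := toPt _ ≫ P.ids
      map_d := P.toPt_ids_d_zero
      map_ids := rfl
      map_comp := fun w => by
        -- The map is constant at the identity operation, so compatibility with composition says
        -- that a composite of identities is the identity, an instance of a unit law of `P`.
        have k := congrArg (fun r => pb.snd ((T ((0 : ℕ) : ℕ∞)).map
          (toPt (OWP.terminal ((0 : ℕ) : ℕ∞)).C)) (OWP.terminal ((0 : ℕ) : ℕ∞)).d ≫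
          (toPt _ ≫ P.ids) ≫ r) (P.comp_ids P.w_ids)
        refine Eq.trans (GlobSet.hom_ext fun _ _ _ => rfl) (k.symm.trans
          ((P.pre_comp (pb.snd _ _ ≫ toPt _ ≫ P.ids) P.w_ids).trans (P.comp_congr ?_ rfl _ _)))
        rw [Functor.map_comp, ← Category.assoc (pb.fst _ _)]
        refine Eq.trans ?_ (congrArg (· ≫ (T _).map P.ids) (pb.condition _ _)).symm
        exact congrArg (fun r => pb.snd _ _ ≫ r ≫ (T _).map P.ids) P.toPt_ids_d_zero }
  map_κ {k h} := absurd h (by simp)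

end ZeroDim

/-! ### The quotient map from the restriction of `L` onto `L_n`. -/

namespace OWP

/-- A restricted map onto a `T_n`-operad that identifies only `n`-dimensional operations, and any
two of these which are parallel and have the same shape. -/
structure ResHom.IsQuotient {n : ℕ} {e : (n : ℕ∞) ≤ ⊤} {L : OWC.{u}} {D : OWP.{u} n}
    (r : ResHom e L D) : Prop where
  injective : ∀ {k : ℕ} (h : (k : ℕ∞) ≤ n), k < n → ∀ {x y : L.C.cell k (h.trans e)},
    r.map.app (h := h) x = r.map.app (h := h) y → x = y
  surjective : ∀ {k : ℕ} {h : (k : ℕ∞) ≤ n} (y : D.C.cell k h),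
    ∃ x : L.C.cell k (h.trans e), r.map.app (h := h) x = y
  eq_of_parallel : ∀ x y : D.C.cell n le_rfl, D.d.app x = D.d.app y → D.C.Parallel x y → x = y

/-- By initiality the composite of `L_0` to the terminal operad and back is the identity. Hence an
operation of `L_0` is determined by its shape and is the identity operation, the image of that of
`L`. -/
theorem exists_isQuotient_zero (L : OWC.{u}) (Ln : OWCn.{u} 0) (hLn : Limits.IsInitial Ln) :
    ∃ r : ResHom (le_top : ((0 : ℕ) : ℕ∞) ≤ ⊤) L Ln.obj, r.IsQuotient := by
  have key : Ln.obj.toTerminal ≫ Ln.obj.ofTerminalZero = 𝟙 _ :=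
    congrArg (fun r : Ln ⟶ Ln => r.hom) (hLn.hom_ext
      (ObjectProperty.homMk (Ln.obj.toTerminal ≫ Ln.obj.ofTerminalZero)) (𝟙 _))
  have key' : ∀ {k : ℕ} {h : (k : ℕ∞) ≤ (0 : ℕ)} (x : Ln.obj.C.cell k h),
      Ln.obj.ofTerminalZero.hom.map.app (Ln.obj.d.app x) = x := fun {k h} x =>
    congrArg (fun r : Ln.obj ⟶ Ln.obj => r.hom.map.app x) key
  refine ⟨((ResHom.unit L le_top).postcomp (toTerminal _)).postcomp Ln.obj.ofTerminalZero,
    fun h hk => absurd hk (by omega), fun {k h} y => ?_, fun x y w _ => ?_⟩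
  · obtain rfl : k = 0 := by simpa using h
    obtain ⟨z, hz⟩ := T_cell_zero (Ln.obj.d.app y)
    refine ⟨L.ids.app PUnit.unit, ?_⟩
    refine Eq.trans ?_ (key' y)
    rfl
  · rw [← key' x, ← key' y, w]

/-- For `n = m + 1`, initiality identifies `L_n` with `S R L`, and the map is essentially `q`. It is
injective below `n` because the counit after `q` is the identity, and surjective because the
precontraction fills parallel pairs; the last condition is the contraction property of `L_n`. -/
theorem exists_isQuotient {L : OWC.{u}} (hL : Limits.IsInitial L) :
    ∀ {n : ℕ} {Ln : OWCn.{u} n}, Limits.IsInitial Ln →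
      ∃ r : ResHom (le_top : (n : ℕ∞) ≤ ⊤) L Ln.obj, r.IsQuotient
  | 0, Ln, hLn => exists_isQuotient_zero L Ln hLn
  | m + 1, Ln, hLn => by
    obtain ⟨q, hq⟩ := exists_toSus L m
    obtain ⟨hS⟩ := OWCn.isInitial_sus hL m
    have φ := hS.uniqueUpToIso hLn
    have hom_inv : ∀ {k : ℕ} {h : (k : ℕ∞) ≤ (m + 1 : ℕ)} (x : (L.res le_top).sus.C.cell k h),
        φ.inv.hom.hom.map.app (φ.hom.hom.hom.map.app x) = x := fun x =>
      congrArg (fun r : OWCn.sus (L.res (le_top : (m : ℕ∞) ≤ ⊤)) ⟶ OWCn.sus (L.res le_top) =>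
        r.hom.hom.map.app x) φ.hom_inv_id
    have inv_hom : ∀ {k : ℕ} {h : (k : ℕ∞) ≤ (m + 1 : ℕ)} (x : Ln.obj.C.cell k h),
        φ.hom.hom.hom.map.app (φ.inv.hom.hom.map.app x) = x := fun x =>
      congrArg (fun r : Ln ⟶ Ln => r.hom.hom.map.app x) φ.inv_hom_id
    refine ⟨(ResHom.unit L le_top).postcomp (q ≫ φ.hom.hom), fun {k} h hk x y w => ?_,
      fun {k h} y => ?_, fun x y w hp => Ln.property _ _ w hp.1 hp.2⟩
    · have h₀ : (k : ℕ∞) ≤ m := by exact_mod_cast Nat.lt_succ_iff.1 hk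
      have w' : q.hom.map.app (h := h) x = q.hom.map.app (h := h) y :=
        (hom_inv _).symm.trans ((congrArg φ.inv.hom.hom.map.app w).trans (hom_inv _))
      have hz := fun z : L.C.cell k le_top => congrArg
        (fun r : (GlobSet.res (le_top : (m : ℕ∞) ≤ ⊤)).obj L.C ⟶ _ => r.app (h := h₀) z) hq
      exact (hz x).symm.trans ((congrArg ((L.res le_top).susRes.map.app (h := h₀)) w').trans (hz y))
    · obtain ⟨x, hx⟩ := surjective_of_section (q := q) (s := 𝟙 _) (by rw [hq]; rfl)
        (φ.inv.hom.hom.map.app y)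
      exact ⟨x, (congrArg φ.hom.hom.hom.map.app hx).trans (inv_hom y)⟩

end OWP

/-! ### Free strict categories on globular sets whose `(n+1)`-cells are endomorphisms. -/

theorem Tm.eqv_src_tgt {Z : GlobSet.{u} ⊤} {n : ℕ}
    (hZ : ∀ z : Z.cell (n + 1) le_top, Z.src z = Z.tgt z) :
    ∀ (a : Tm Z (n + 1)), Ok a → Eqv a.src a.tgt
  | of _ x, _ => by
    rw [src_of, tgt_of]
    exact (hZ x) ▸ eqv_of _ _
  | one a, ha => by
    rw [Tm.src_one, Tm.tgt_one]
    exact Ok.eqv (a := a) ha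
  | comp p a b, ha => by
    have iha := Tm.eqv_src_tgt hZ a ha.1
    have ihb := Tm.eqv_src_tgt hZ b ha.2.1
    by_cases hp : p = n
    · subst hp
      rw [src_top, tgt_top]
      -- Endomorphisms composable along dimension `n` all sit on the same `n`-cell.
      exact (iha.trans (cmpb_top.1 ha.2.2)).trans ihb
    · rw [src_low hp, tgt_low hp]
      exact eqv_comp (cmpb_bdry hp (Ok.eqv ha.1) (Ok.eqv ha.2.1) ha.2.2).1 iha ihb

/-- If all `(n+1)`-cells of `Z` are endomorphisms, so are those of the free strict category. -/
theorem T_src_eq_tgt {Z : GlobSet.{u} ⊤} {n : ℕ}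
    (hZ : ∀ z : Z.cell (n + 1) le_top, Z.src z = Z.tgt z)
    (x : ((T ⊤).obj Z).cell (n + 1) le_top) : ((T ⊤).obj Z).src x = ((T ⊤).obj Z).tgt x := by
  obtain ⟨a, ha, rfl⟩ := mk_surj (X := Z) x
  exact mk_eq.2 (eqv_src_tgt hZ a ha)

/-! ### `n`-dimensional globular sets as `n`-globular sets. -/

namespace GlobSet

variable {n : ℕ}

section IsDim

variable {W X : GlobSet.{u} ⊤}

/-- The unique cell of an `n`-dimensional globular set with a given source. -/
noncomputable def IsDim.unit (hX : X.IsDim n) {k : ℕ} (hk : n ≤ k) (x : X.cell k le_top) :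
    X.cell (k + 1) le_top := ((hX k hk).2.2 x).choose

theorem IsDim.src_unit (hX : X.IsDim n) {k : ℕ} (hk : n ≤ k) (x : X.cell k le_top) :
    X.src (hX.unit hk x) = x := ((hX k hk).2.2 x).choose_spec

theorem IsDim.tgt_unit (hX : X.IsDim n) {k : ℕ} (hk : n ≤ k) (x : X.cell k le_top) :
    X.tgt (hX.unit hk x) = x := ((hX k hk).1 _).symm.trans (hX.src_unit hk x)

theorem le_of_not_dim {k : ℕ} (h : ¬((k + 1 : ℕ) : ℕ∞) ≤ n) : n ≤ k := by
  rw [Nat.cast_le] at h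
  omega

open Classical in
/-- The extension to all dimensions of a map into an `n`-dimensional globular set. -/
noncomputable def IsDim.extendFun (hX : X.IsDim n) (g : (cosk.R n).obj W ⟶ (cosk.R n).obj X) :
    ∀ {k : ℕ}, W.cell k le_top → X.cell k le_top
  | 0, y => g.app (h := dim_zero _) y
  | k + 1, y => if h : ((k + 1 : ℕ) : ℕ∞) ≤ n then g.app (h := h) y
      else hX.unit (le_of_not_dim h) (hX.extendFun g (W.src y))

theorem IsDim.extendFun_low (hX : X.IsDim n) (g : (cosk.R n).obj W ⟶ (cosk.R n).obj X) {k : ℕ}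
    (h : (k : ℕ∞) ≤ n) (y : W.cell k le_top) : hX.extendFun g y = g.app (h := h) y := by
  cases k with
  | zero => rw [extendFun]
  | succ k => rw [extendFun, dif_pos h]

theorem IsDim.extendFun_high (hX : X.IsDim n) (g : (cosk.R n).obj W ⟶ (cosk.R n).obj X) {k : ℕ}
    (h : ¬((k + 1 : ℕ) : ℕ∞) ≤ n) (y : W.cell (k + 1) le_top) :
    hX.extendFun g y = hX.unit (le_of_not_dim h) (hX.extendFun g (W.src y)) := by
  rw [extendFun, dif_neg h]

/-- Every cell above dimension `n` is sent to the degenerate cell on the image of its source. The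
hypothesis `hg` makes its target correct in dimension `n + 1`, and globularity does so above.
Nothing is asked of `W`, so the result applies to `T_L Z`, which is not itself `n`-dimensional in
general. -/
theorem IsDim.exists_extension (hX : X.IsDim n) (g : (cosk.R n).obj W ⟶ (cosk.R n).obj X)
    (hg : ∀ w : W.cell (n + 1) le_top,
      g.app (h := le_rfl) (W.src w) = g.app (h := le_rfl) (W.tgt w)) :
    ∃ f : W ⟶ X, (cosk.R n).map f = g := by
  have src_tgt : ∀ {k : ℕ}, n ≤ k → ∀ y : W.cell (k + 1) le_top,
      hX.extendFun g (W.src y) = hX.extendFun g (W.tgt y) := fun {k} hk y => by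
    rcases hk.eq_or_lt with rfl | hk
    · rw [hX.extendFun_low g le_rfl, hX.extendFun_low g le_rfl, hg]
    · obtain ⟨j, rfl⟩ : ∃ j, k = j + 1 := ⟨k - 1, by omega⟩
      have h : ¬((j + 1 : ℕ) : ℕ∞) ≤ n := by
        rw [Nat.cast_le]
        omega
      rw [hX.extendFun_high g h, hX.extendFun_high g h, W.src_src]
  refine ⟨GlobSet.Hom.mk (fun y => hX.extendFun g y) (fun {k _} y => ?_) (fun {k _} y => ?_),
    GlobSet.hom_ext fun k h y => hX.extendFun_low g h y⟩
  · by_cases h : ((k + 1 : ℕ) : ℕ∞) ≤ n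
    · rw [hX.extendFun_low g h, hX.extendFun_low g (dim_pred h)]
      exact g.src_app (h := h) y
    · rw [hX.extendFun_high g h, hX.src_unit]
  · by_cases h : ((k + 1 : ℕ) : ℕ∞) ≤ n
    · rw [hX.extendFun_low g h, hX.extendFun_low g (dim_pred h)]
      exact g.tgt_app (h := h) y
    · rw [hX.extendFun_high g h, hX.tgt_unit, src_tgt (le_of_not_dim h)]

/-- Above dimension `n` a cell of `X` is determined by its source. -/
theorem IsDim.hom_ext (hX : X.IsDim n) (f g : W ⟶ X) (w : (cosk.R n).map f = (cosk.R n).map g) :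
    f = g := by
  refine GlobSet.hom_ext fun k _ => ?_
  induction k with
  | zero =>
    intro y
    exact congrArg (fun r : (cosk.R n).obj W ⟶ (cosk.R n).obj X => r.app (h := dim_zero _) y) w
  | succ k ih =>
    intro y
    by_cases h : ((k + 1 : ℕ) : ℕ∞) ≤ n
    · exact congrArg (fun r : (cosk.R n).obj W ⟶ (cosk.R n).obj X => r.app (h := h) y) w
    · refine (hX k (le_of_not_dim h)).2.1 ?_
      change X.src (f.app y) = X.src (g.app y)
      rw [f.src_app, g.src_app, ih]

end IsDim

/-- The cells of the `n`-dimensional globular set with a given restriction. -/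
inductive ThinCell (Y : GlobSet.{u} n) : ℕ → Type u
  | low {k : ℕ} (h : (k : ℕ∞) ≤ n) (x : Y.cell k h) : ThinCell Y k
  | same {k : ℕ} (h : n ≤ k) (c : ThinCell Y k) : ThinCell Y (k + 1)

namespace ThinCell

variable {Y : GlobSet.{u} n}

def src : ∀ {k : ℕ}, ThinCell Y (k + 1) → ThinCell Y k
  | _, low h x => low (dim_pred h) (Y.src x)
  | _, same _ c => c

def tgt : ∀ {k : ℕ}, ThinCell Y (k + 1) → ThinCell Y k
  | _, low h x => low (dim_pred h) (Y.tgt x)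
  | _, same _ c => c

theorem not_dim {k : ℕ} (h : n ≤ k) : ¬((k + 1 : ℕ) : ℕ∞) ≤ n := by
  rw [Nat.cast_le]
  omega

def toCell : ∀ {k : ℕ}, ThinCell Y k → ∀ h : (k : ℕ∞) ≤ n, Y.cell k h
  | _, low _ x, _ => x
  | _, same h _, h' => absurd h' (not_dim h)

end ThinCell

/-- The `n`-dimensional globular set with a given restriction. -/
def thin (Y : GlobSet.{u} n) : GlobSet.{u} ⊤ where
  cell k _ := ThinCell Y k
  src := ThinCell.src
  tgt := ThinCell.tgt
  src_src x := by
    cases x with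
    | low h x => exact congrArg (ThinCell.low _) (Y.src_src x)
    | same h c => rfl
  tgt_src x := by
    cases x with
    | low h x => exact congrArg (ThinCell.low _) (Y.tgt_src x)
    | same h c => rfl

theorem thin_isDim (Y : GlobSet.{u} n) : (thin Y).IsDim n := fun m hm => by
  refine ⟨fun x => ?_, fun x y w => ?_, fun x => ⟨ThinCell.same hm x, rfl⟩⟩
  · change ThinCell Y (m + 1) at x
    cases x with
    | low h x => exact absurd h (ThinCell.not_dim hm)
    | same h c => rfl
  · change ThinCell Y (m + 1) at x y
    cases x with
    | low h x => exact absurd h (ThinCell.not_dim hm)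
    | same h c =>
      cases y with
      | low h y => exact absurd h (ThinCell.not_dim hm)
      | same h c' => exact congrArg (ThinCell.same h) w

/-- The restriction of `thin Y` is `Y`. -/
def thinIso (Y : GlobSet.{u} n) : (cosk.R n).obj (thin Y) ≅ Y where
  hom := GlobSet.Hom.mk (fun {_ h} x => ThinCell.toCell x h)
    (fun {k h} x => by
      change ThinCell Y (k + 1) at x
      cases x with
      | low => rfl
      | same h' => exact absurd h (ThinCell.not_dim h'))
    (fun {k h} x => by
      change ThinCell Y (k + 1) at x
      cases x with
      | low => rfl
      | same h' => exact absurd h (ThinCell.not_dim h'))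
  inv := GlobSet.Hom.mk (fun {_ h} x => ThinCell.low h x) (fun _ => rfl) (fun _ => rfl)
  hom_inv_id := GlobSet.hom_ext fun k h x => by
    change ThinCell Y k at x
    cases x with
    | low => rfl
    | same h' => exact absurd h (ThinCell.not_dim h')
  inv_hom_id := rfl

end GlobSet

/-! ### The comparison of monads along a restricted map of operads. -/

namespace OWP

variable {N M : ℕ∞} {e : M ≤ N} {P : OWP.{u} N} {D : OWP.{u} M}

namespace ResHom

theorem w_act (r : ResHom e P D) (X : GlobSet.{u} N) :
    ((GlobSet.res e).map (pb.fst ((T N).map (toPt X)) P.d) ≫ down e X) ≫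
      (T M).map (toPt ((GlobSet.res e).obj X)) =
    ((GlobSet.res e).map (pb.snd ((T N).map (toPt X)) P.d) ≫ r.map) ≫ D.d := by
  rw [Category.assoc, Category.assoc, r.map_d, res_comp_assoc, ← pb.condition, ← res_comp_assoc,
    down_naturality]

/-- The comparison of the monads of operads along a restricted map. -/
noncomputable def act (r : ResHom e P D) (X : GlobSet.{u} N) :
    (GlobSet.res e).obj (P.act X) ⟶ D.act ((GlobSet.res e).obj X) :=
  pb.lift _ _ (r.w_act X)

theorem act_naturality (r : ResHom e P D) {X Y : GlobSet.{u} N} (f : X ⟶ Y) :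
    (GlobSet.res e).map (P.actMap f) ≫ r.act Y = r.act X ≫ D.actMap ((GlobSet.res e).map f) := by
  refine pb.hom_ext ?_ rfl
  change (GlobSet.res e).map (pb.fst _ _) ≫ (GlobSet.res e).map ((T N).map f) ≫ down e Y =
    (GlobSet.res e).map (pb.fst _ _) ≫ down e X ≫ (T M).map ((GlobSet.res e).map f)
  rw [down_naturality]

theorem unit_act (r : ResHom e P D) (X : GlobSet.{u} N) :
    (GlobSet.res e).map (P.actUnit X) ≫ r.act X = D.actUnit ((GlobSet.res e).obj X) := by
  refine pb.hom_ext (unit_down e X) ?_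
  exact congrArg (fun z => toPt ((GlobSet.res e).obj X) ≫ z) r.map_ids

/-- On pasting diagrams this is `down_mul`; on operations it is the compatibility of `r` with
composition, together with naturality of `down`. -/
theorem mul_act (r : ResHom e P D) (X : GlobSet.{u} N) :
    (GlobSet.res e).map (P.actMul X) ≫ r.act X =
      r.act (P.act X) ≫ D.actMap (r.act X) ≫ D.actMul ((GlobSet.res e).obj X) := by
  refine pb.hom_ext ?_ ?_
  · change (GlobSet.res e).map (pb.fst _ _) ≫ (GlobSet.res e).map ((T N).map (pb.fst _ _)) ≫
      (GlobSet.res e).map ((T N).μ.app X) ≫ down e X =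
      (GlobSet.res e).map (pb.fst _ _) ≫ down e (P.act X) ≫ (T M).map (r.act X) ≫
        (T M).map (pb.fst _ _) ≫ (T M).μ.app _
    rw [down_mul, down_naturality_assoc, ← Functor.map_comp_assoc (T M).toFunctor,
      ← Functor.map_comp_assoc (T M).toFunctor]
    rfl
  · refine (r.lift_comp (P.w_sub X)).trans (Eq.trans ?_ (D.comp_sub (r.act (P.act X) ≫ D.actMap (r.act X))).symm)
    refine D.comp_congr ?_ rfl _ _
    change (GlobSet.res e).map (pb.fst _ _) ≫ (GlobSet.res e).map ((T N).map (pb.snd _ _)) ≫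
      down e P.C ≫ (T M).map r.map = (GlobSet.res e).map (pb.fst _ _) ≫ down e (P.act X) ≫
        (T M).map (r.act X) ≫ (T M).map (pb.snd _ _)
    rw [down_naturality_assoc, ← Functor.map_comp, ← Functor.map_comp]
    rfl

variable {r : ResHom e P D} {i : D.C ⟶ (GlobSet.res e).obj P.C}

/-- A section of `r` respects shapes because `r` does so up to `down`, which is invertible. No
compatibility of `i` with the operad structure is needed. -/
theorem w_sec (hi : i ≫ r.map = 𝟙 _) (X : GlobSet.{u} N) :
    (pb.fst ((T M).map (toPt ((GlobSet.res e).obj X))) D.d ≫ up e X) ≫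
      (GlobSet.res e).map ((T N).map (toPt X)) =
    (pb.snd ((T M).map (toPt ((GlobSet.res e).obj X))) D.d ≫ i) ≫ (GlobSet.res e).map P.d := by
  have h : i ≫ (GlobSet.res e).map P.d = D.d ≫ up e (pt N) := by
    have h₁ := congrArg (fun z => i ≫ z ≫ up e (pt N)) r.map_d
    simp only [Category.assoc, down_up, Category.comp_id] at h₁
    refine h₁.symm.trans ((Category.assoc _ _ _).symm.trans ?_)
    rw [hi, Category.id_comp]
  rw [Category.assoc, Category.assoc, h, up_naturality, ← Category.assoc, ← Category.assoc,
    ← pb.condition]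

/-- The section of the comparison given by a section of the restricted map. -/
noncomputable def sec (hi : i ≫ r.map = 𝟙 _) (X : GlobSet.{u} N) :
    D.act ((GlobSet.res e).obj X) ⟶ (GlobSet.res e).obj (P.act X) :=
  pb.resLift e _ _ (w_sec hi X)

theorem sec_act (hi : i ≫ r.map = 𝟙 _) (X : GlobSet.{u} N) : sec hi X ≫ r.act X = 𝟙 _ := by
  refine pb.hom_ext ?_ ?_
  · exact congrArg (fun z => pb.fst _ _ ≫ z) (up_down e X)
  · exact congrArg (fun z => pb.snd _ _ ≫ z) hi

end ResHom

end OWP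

/-! ### Algebras for `L` on `n`-dimensional globular sets and algebras for its quotient. -/

namespace OWP.ResHom.IsQuotient

variable {n : ℕ} {L : OWC.{u}} {D : OWP.{u} n} {r : ResHom (le_top : (n : ℕ∞) ≤ ⊤) L D}

/-- Preimages are chosen cell by cell. The choices respect sources and targets automatically, since
these lie below dimension `n`, where `r` is injective. -/
theorem exists_section (hr : r.IsQuotient) :
    ∃ i : D.C ⟶ (cosk.R n).obj L.C, i ≫ r.map = 𝟙 _ := by
  choose f hf using fun (k : ℕ) (h : (k : ℕ∞) ≤ n) (y : D.C.cell k h) => hr.surjective y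
  refine ⟨GlobSet.Hom.mk (fun {k h} y => f k h y) (fun {k h} y => ?_) (fun {k h} y => ?_),
    GlobSet.hom_ext fun k h y => hf k h y⟩
  · refine hr.injective (dim_pred h) (Nat.cast_le.1 h) ?_
    refine (r.map.src_app (h := h) _).symm.trans ?_
    rw [hf, hf]
  · refine hr.injective (dim_pred h) (Nat.cast_le.1 h) ?_
    refine (r.map.tgt_app (h := h) _).symm.trans ?_
    rw [hf, hf]

/-- The pasting diagrams agree since all `(n+1)`-cells of `T Z` are endomorphisms. The operations
then have the same shape, and their images in the quotient are parallel, hence equal. -/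
theorem act_src_eq_tgt (hr : r.IsQuotient) {Z : GlobSet.{u} ⊤} (hZ : Z.IsDim n)
    (x : (L.act Z).cell (n + 1) le_top) :
    (r.act Z).app (h := le_rfl) ((L.act Z).src x) =
      (r.act Z).app (h := le_rfl) ((L.act Z).tgt x) := by
  have hx := T_src_eq_tgt (hZ n le_rfl).1 x.1.1
  refine Subtype.ext (Prod.ext (congrArg (down _ Z).app hx) ?_)
  refine hr.eq_of_parallel _ _ ?_ (cosk.parallel_bdry r.map le_rfl x.1.2)
  refine (r.d_app _).trans (Eq.trans (congrArg (down _ _).app ?_) (r.d_app _).symm)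
  exact ((L.act Z).src x).2.symm.trans ((congrArg ((T ⊤).map (toPt Z)).app hx).trans
    ((L.act Z).tgt x).2)

/-- Boundaries lie below dimension `n`, where `r` is injective. -/
theorem parallel (hr : r.IsQuotient) : ∀ {k : ℕ} (h : (k : ℕ∞) ≤ n) {x y : L.C.cell k le_top},
    r.map.app (h := h) x = r.map.app (h := h) y → L.C.Parallel x y
  | 0, _, _, _, _ => trivial
  | k + 1, h, x, y, w => by
    have hk : k < n := Nat.cast_le.1 h
    refine ⟨hr.injective (dim_pred h) hk ?_, hr.injective (dim_pred h) hk ?_⟩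
    · exact (r.map.src_app (h := h) x).symm.trans ((congrArg D.C.src w).trans
        (r.map.src_app (h := h) y))
    · exact (r.map.tgt_app (h := h) x).symm.trans ((congrArg D.C.tgt w).trans
        (r.map.tgt_app (h := h) y))

/-- A map from `T_L Z` to an `n`-dimensional globular set does not distinguish operations with the
same image in the quotient. -/
theorem app_congr (hr : r.IsQuotient) {Z X : GlobSet.{u} ⊤} (hX : X.IsDim n) (f : L.act Z ⟶ X)
    {k : ℕ} (h : (k : ℕ∞) ≤ n) (x y : (L.act Z).cell k le_top) (h₁ : x.1.1 = y.1.1)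
    (h₂ : r.map.app (h := h) x.1.2 = r.map.app (h := h) y.1.2) : f.app x = f.app y := by
  obtain ⟨⟨τ, θ⟩, hx⟩ := x
  obtain ⟨⟨τ', θ'⟩, hy⟩ := y
  obtain rfl : τ = τ' := h₁
  rcases (Nat.cast_le.1 h : k ≤ n).lt_or_eq with hk | rfl
  · obtain rfl : θ = θ' := hr.injective h hk h₂
    rfl
  -- In dimension `n`, `π` is the identity on the common shape of `θ` and `θ'`. The contraction
  -- gives an operation of shape `π` from `θ` to `θ'`; paired with the identity on `τ` it is a cell
  -- `z` from `(τ, θ)` to `(τ, θ')`. Its image in `X` is an `(n+1)`-cell, so its source and target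
  -- agree.
  · let π := fone (h := le_top) (((T ⊤).map (toPt Z)).app τ)
    let z : (L.act Z).cell (k + 1) le_top :=
      ⟨(fone (h := le_top) τ, L.κ π θ θ'
        (hx.symm.trans ((free (pt ⊤)).src_one _).symm)
        (hy.symm.trans ((free (pt ⊤)).tgt_one _).symm) (hr.parallel h h₂)),
        (T_map_fone _ _).trans (L.d_κ _ _ _ _ _ _).symm⟩
    have hs : (L.act Z).src z = ⟨(τ, θ), hx⟩ :=
      Subtype.ext (Prod.ext ((free Z).src_one (h := le_top) τ) (L.src_κ _ _ _ _ _ _))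
    have ht : (L.act Z).tgt z = ⟨(τ, θ'), hy⟩ :=
      Subtype.ext (Prod.ext ((free Z).tgt_one (h := le_top) τ) (L.tgt_κ _ _ _ _ _ _))
    rw [← hs, ← ht, ← f.src_app, ← f.tgt_app]
    exact (hX k le_rfl).1 _

/-- The comparison of the monads of `L` and of its quotient. -/
theorem exists_comparison (hr : r.IsQuotient) :
    Nonempty (MonadComparison L.monad D.monad (cosk.R.{u} n) (fun Z => Z.IsDim n)) := by
  obtain ⟨i, hi⟩ := hr.exists_section
  exact ⟨{
    ν := r.act
    σ := sec hi
    naturality := r.act_naturality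
    unit := r.unit_act
    mul := r.mul_act
    sec := sec_act hi
    faithful := fun hX f g w => hX.hom_ext f g w
    -- The condition for extending is automatic because the `(n+1)`-cells of `Z` are endomorphisms.
    full := fun {Z X} hZ hX g => hX.exists_extension g fun w =>
      congrArg (g.app (h := le_rfl)) ((hZ n le_rfl).1 w)
    -- Going to the quotient and back along the section keeps the pasting diagram and replaces the
    -- operation by another one with the same image under `r`.
    factor := fun {Z} hZ f => GlobSet.hom_ext fun k h x => by
      refine hr.app_congr hZ f h _ _ ?_ ?_
      · exact congrArg (fun z : (cosk.R n).obj ((T ⊤).obj Z) ⟶ _ => z.app (h := h) x.1.1)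
          (down_up _ Z)
      · exact congrArg (fun z : D.C ⟶ D.C => z.app (r.map.app (h := h) x.1.2)) hi
    -- The extension condition holds already before applying `k`, by `act_src_eq_tgt`.
    lift := fun {Z} hZ k => hZ.exists_extension (W := L.act Z) (r.act Z ≫ k) fun w =>
      congrArg (fun z => k.app (h := le_rfl) z) (hr.act_src_eq_tgt hZ w)
    ess := fun Y => ⟨thin Y, thin_isDim Y, ⟨thinIso Y⟩⟩ }⟩

theorem nonempty_equivalence (hr : r.IsQuotient) :
    Nonempty (WkCat n L.toOperad ≌ D.toOperad.Alg) := by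
  obtain ⟨c⟩ := hr.exists_comparison
  have := c.isEquivalence
  exact ⟨c.functor.asEquivalence⟩

end OWP.ResHom.IsQuotient

/-! ### Existence of `L_n` and the main theorem. -/

theorem OWCn.exists_isInitial : ∀ n : ℕ, ∃ Ln : OWCn.{u} n, Nonempty (Limits.IsInitial Ln)
  -- In dimension `0` being a contraction is no condition, so the initial operad with precontraction
  -- serves; in positive dimensions `S R L` does.
  | 0 => ⟨⟨Generic.owp _, trivial⟩, ⟨Limits.IsInitial.ofUniqueHom
      (fun P => ObjectProperty.homMk ((Generic.isInitial _).to P.obj))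
      fun _ _ => ObjectProperty.hom_ext _ ((Generic.isInitial _).hom_ext _ _)⟩⟩
  | m + 1 => ⟨_, OWCn.isInitial_sus (Generic.isInitial ⊤) m⟩

theorem mainTheorem3 (n : ℕ) :
    (∃ L : OWC.{u}, Nonempty (Limits.IsInitial L)) ∧
    (∃ Ln : OWCn.{u} n, Nonempty (Limits.IsInitial Ln)) ∧
    ∀ L : OWC.{u}, Limits.IsInitial L →
      (∀ Ln : OWCn.{u} n, Limits.IsInitial Ln →
        Nonempty (WkCat n L.toOperad ≌ Ln.obj.toOperad.Alg)) ∧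
      (∀ m : ℕ, n = m + 1 →
        Nonempty (Limits.IsInitial (OWCn.sus (L.res (le_top : (m : ℕ∞) ≤ ⊤))))) := by
  refine ⟨⟨_, ⟨Generic.isInitial ⊤⟩⟩, OWCn.exists_isInitial n, fun L hL => ⟨fun Ln hLn => ?_,
    fun m _ => OWCn.isInitial_sus hL m⟩⟩
  obtain ⟨r, hr⟩ := OWP.exists_isQuotient hL hLn
  exact hr.nonempty_equivalence
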